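/- Let $k$ be an algebraically closed field of characteristic $p>0$ and $r\ge 1$. **The algebras.** Let $X,Y,H$ be the standard basis of $\mathfrak{sl}_2(\mathbb C)$, let $\mathcal U_{\mathbb Z}$ be the subring of its universal enveloping algebra generated by all $X^{(m)}=X^m/m!$ and $Y^{(m)}=Y^m/m!$ ($m\ge 0$), and let $\mathcal U=\mathcal U_{\mathbb Z}\otimes_{\mathbb Z}k$, with $k$-basis $Y^{(m)}\binom Hn X^{(m')}$ ($m,n,m'\ge 0$), where $\binom{H+c}{m}=(H+c)(H+c-1)\cdots(H+c-m+1)/m!$ for $c\in\mathbb Z$. Let $\mathrm{Fr}':\mathcal U\to\mathcal U$ be the $k$-linear map $Y^{(m)}\binom Hn X^{(m')}\mapsto Y^{(mp)}\binom H{np}X^{(m'p)}$. Let $\mathcal U_r$ be the subalgebra generated by $X^{(p^i)},Y^{(p^i)}$ ($0\le i\le r-1$), $\mathcal A$ the subalgebra generated by all $\binom H{p^i}$ and $Y^{(p^i)}X^{(p^i)}$ ($i\ge 0$), and $\mathcal A_r=\mathcal A\cap\mathcal U_r$. **The case of one pair.** For $a\in\mathbb Z$ put $\mu_a=\binom{H-a-1}{p-1}\in\mathcal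 U$. * Let $p$ be odd. Put $\mathcal P=\{0,\dots,p-1\}\times\{0,\dots,(p-1)/2\}$ and, over $\mathbb F_p$, $\varphi_{a,m}(x)=\prod_{i=0}^{m-1}(x-i(i+a+1))$, $\psi(x)=\prod_{i\in\mathbb F_p}(x-i^2)$, $\psi^{(1)}_j(x)=\psi(x)/(x-j^2)$, $\psi_0^{(0)}(x)=\prod_{i\in\mathbb F_p^\times}(x-i^2)$, and $\psi_s^{(0)}(x)=2x(x+s^2)\prod_{i\in\mathbb F_p^\times\setminus\{s,-s\}}(x-i^2)$ for $s\ne 0$. For $(a,j)\in\mathcal P$ and $\varepsilon\in\{0,1\}$ put $B^{(\varepsilon)}(a,j)=\psi^{(\varepsilon)}_j\big(\mu_aYX+(\tfrac{a+1}2)^2\big)\mu_a$, and let $n^{(\varepsilon)}(a,j)$ be the largest $n\ge 0$ with $\varphi_{a,n}(x)\mid\psi_j^{(\varepsilon)}\big(x+(\tfrac{a+1}2)^2\big)$. * Let $p=2$. Put $\mathcal P=\{(0,1/2),(1,0),(1,1)\}$, $B^{(0)}(0,1/2)=\mu_0$, $B^{(1)}(0,1/2)=\mu_0YX$, $B^{(\varepsilon)}(1,0)=\mu_1YX$,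 $B^{(\varepsilon)}(1,1)=\mu_1YX+\mu_1$, and $n^{(\varepsilon)}(0,1/2)=\varepsilon$, $n^{(\varepsilon)}(1,0)=1$, $n^{(\varepsilon)}(1,1)=0$ for $\varepsilon\in\{0,1\}$. In both cases there are unique $c^{(\varepsilon)}_m\in\mathbb F_p$ with $B^{(\varepsilon)}(a,j)=\mu_a\sum_{m=n^{(\varepsilon)}(a,j)}^{p-1}c_m^{(\varepsilon)}Y^mX^m$. For $z\in\mathcal U$ put $$Z^{(\varepsilon)}(z;(a,j))=\mu_a\sum_{m=n^{(\varepsilon)}(a,j)}^{p-1}c^{(\varepsilon)}_mY^mX^{m-s}\,\mathrm{Fr}'(z)\,X^{s}$$ if either $a$ is even and $(p-a+1)/2\le j\le(p-1)/2$, or $a$ is odd and $0\le j\le(a-1)/2$; here $s=1$ if $p=2$, $s=(p-a+1)/2$ if $p$ is odd and $a$ even, and $s=(p-a)/2$ if $p$ and $a$ are odd. For all other $(a,j)\in\mathcal P$ put $Z^{(\varepsilon)}(z;(a,j))=\mathrm{Fr}'(z)B^{(\varepsilon)}(a,j)$. **The case of $r$ pairs.** For $(\boldsymbol a,\boldsymbol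 j)=((a_i,j_i))_{i=0}^{r-1}\in\mathcal P^r$ and $\boldsymbol\varepsilon=(\varepsilon_0,\dots,\varepsilon_{r-1})\in\{0,1\}^r$ define $B^{(\boldsymbol\varepsilon)}(\boldsymbol a,\boldsymbol j)$ recursively: it is $B^{(\varepsilon_0)}(a_0,j_0)$ if $r=1$, and $Z^{(\varepsilon_0)}\big(B^{(\varepsilon_1,\dots,\varepsilon_{r-1})}((a_i,j_i)_{i=1}^{r-1});(a_0,j_0)\big)$ if $r\ge 2$. Call an index $i$ free if $j_i\neq 0$ (for $p$ odd), respectively $a_i\ne 1$ (for $p=2$). Let $w$ be the number of free indices, let $\mathcal X_r(\boldsymbol a,\boldsymbol j)$ be the set of $\boldsymbol\varepsilon\in\{0,1\}^r$ with $\varepsilon_i=0$ for every non-free $i$, and let $\boldsymbol\tau\in\mathcal X_r(\boldsymbol a,\boldsymbol j)$ be the element with $\tau_i=1$ for every free $i$. Let $\mathcal W(\boldsymbol\varepsilon)$ be the number of $i$ with $\varepsilon_i\neq 0$, and put $S_{(\boldsymbol a,\boldsymbol j)}=\mathcal A_r\cdot B^{(\boldsymbol\tau)}(\boldsymbol a,\boldsymbol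 j)$. For an $\mathcal A_r$-module $M$ and $n\ge 0$ let $\mathrm{rad}^nM=(\mathrm{rad}\,\mathcal A_r)^nM$, where $\mathrm{rad}\,\mathcal A_r$ is the Jacobson radical, and let $\mathrm{soc}^nM$ be the set of elements of $M$ annihilated by $(\mathrm{rad}\,\mathcal A_r)^n$; in particular $\mathrm{rad}^0M=M$ and $\mathrm{soc}^0M=0$. The module $M$ is rigid if, for some $L$ that is the least integer $n\ge0$ with $\mathrm{rad}^nM=0$, one has $\mathrm{rad}^iM=\mathrm{soc}^{L-i}M$ for all $0\le i\le L$. **Theorem.** Let $(\boldsymbol a,\boldsymbol j)\in\mathcal P^r$, $\boldsymbol\varepsilon\in\mathcal X_r(\boldsymbol a,\boldsymbol j)$ and $M=\mathcal A_r\cdot B^{(\boldsymbol\varepsilon)}(\boldsymbol a,\boldsymbol j)$. Then $M$ is rigid, and for every integer $i$ with $0\le i\le w-\mathcal W(\boldsymbol\varepsilon)$ $$\mathrm{rad}^i M=\mathrm{soc}^{\,w+1-\mathcal W(\boldsymbol\varepsilon)-i}M.$$ In particular the socle $\mathrm{soc}^1M$ is simple and isomorphic to $S_{(\boldsymbol a,\boldsymbol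 j)}$ as an $\mathcal A_r$-module. -/

import Mathlib

open Polynomial TensorProduct

noncomputable section

namespace SL2Hyper

attribute [local instance 100] LieRing.ofAssociativeRing

/-! ### Generalities on radical and socle series -/

/-- The `n`-th radical `(rad R)^n M` of a left `R`-module `M`. -/
def radPow (R M : Type*) [Ring R] [AddCommGroup M] [Module R M] (n : ℕ) : Submodule R M :=
  (Ring.jacobson R ^ n) • (⊤ : Submodule R M)

/-- The `n`-th socle of a left `R`-module `M`: the elements annihilated by `(rad R)^n`. -/
def socPow (R M : Type*) [Ring R] [AddCommGroup M] [Module R M] (n : ℕ) : Submodule R M where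
  carrier := {x | ∀ c ∈ Ring.jacobson R ^ n, c • x = 0}
  add_mem' := fun {x y} hx hy c hc => by rw [smul_add, hx c hc, hy c hc, add_zero]
  zero_mem' := fun c _ => smul_zero c
  smul_mem' := fun c x hx d hd => by
    rw [← mul_smul]; exact hx _ (Ideal.mul_mem_right _ _ hd)

/-- `L` is the Loewy length of `M`: the least `n` with `(rad R)^n M = 0`. -/
def IsLoewyLength (R M : Type*) [Ring R] [AddCommGroup M] [Module R M] (L : ℕ) : Prop :=
  IsLeast {n : ℕ | radPow R M n = ⊥} L

/-- `M` is rigid: it has finite Loewy length and its radical series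
`M = rad^0 ⊇ rad^1 ⊇ … ⊇ rad^L = 0` coincides with its socle series
`M = soc^L ⊇ … ⊇ soc^1 ⊇ soc^0 = 0`. -/
def IsRigid (R M : Type*) [Ring R] [AddCommGroup M] [Module R M] : Prop :=
  ∃ L : ℕ, IsLoewyLength R M L ∧ ∀ i ≤ L, radPow R M i = socPow R M (L - i)

/-! ### The enveloping algebra of `sl₂` and its divided powers -/

/-- The universal enveloping algebra of `sl₂(ℂ)`. -/
abbrev UC : Type := UniversalEnvelopingAlgebra ℂ (LieAlgebra.SpecialLinear.sl (Fin 2) ℂ)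

/-- `X = (0 1; 0 0)` -/
def slX : LieAlgebra.SpecialLinear.sl (Fin 2) ℂ :=
  ⟨!![0, 1; 0, 0], by simp [LieAlgebra.SpecialLinear.sl, LinearMap.mem_ker]⟩

/-- `Y = (0 0; 1 0)` -/
def slY : LieAlgebra.SpecialLinear.sl (Fin 2) ℂ :=
  ⟨!![0, 0; 1, 0], by simp [LieAlgebra.SpecialLinear.sl, LinearMap.mem_ker]⟩

/-- `H = (1 0; 0 -1)` -/
def slH : LieAlgebra.SpecialLinear.sl (Fin 2) ℂ :=
  ⟨!![1, 0; 0, -1], by simp [LieAlgebra.SpecialLinear.sl, LinearMap.mem_ker]⟩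

/-- `X` in the enveloping algebra. -/
def eX : UC := UniversalEnvelopingAlgebra.ι ℂ slX

/-- `Y` in the enveloping algebra. -/
def eY : UC := UniversalEnvelopingAlgebra.ι ℂ slY

/-- `H` in the enveloping algebra. -/
def eH : UC := UniversalEnvelopingAlgebra.ι ℂ slH

/-- The divided power `u^(m) = u^m / m!`. -/
def dp (u : UC) (m : ℕ) : UC := ((m.factorial : ℂ)⁻¹) • u ^ m

/-- The polynomial `(t+c)(t+c-1)⋯(t+c-m+1) / m!`. -/
def binPoly (c : ℤ) (m : ℕ) : ℂ[X] :=
  C ((m.factorial : ℂ)⁻¹) * ∏ i ∈ Finset.range m, (X + C (c : ℂ) - C (i : ℂ))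

/-- The element `(H+c choose m) = (H+c)(H+c-1)⋯(H+c-m+1) / m!`. -/
def binH (c : ℤ) (m : ℕ) : UC := aeval eH (binPoly c m)

/-- The `ℤ`-form: the subring generated by all `X^(m)` and `Y^(m)`. -/
def UZ : Subalgebra ℤ UC :=
  Algebra.adjoin ℤ (Set.range (dp eX) ∪ Set.range (dp eY))

theorem eXY : eX * eY = eY * eX + eH := by
  have h : ⁅slX, slY⁆ = slH := by
    apply Subtype.ext
    rw [LieAlgebra.SpecialLinear.sl_bracket]
    simp [slX, slY, slH]
  have := congrArg (UniversalEnvelopingAlgebra.ι ℂ) h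
  rw [LieHom.map_lie, LieRing.of_associative_ring_bracket] at this
  rw [eX, eY, eH, ← this]; abel

theorem eHX : eX * eH = (eH - 2) * eX := by
  have h : ⁅slX, slH⁆ = (-2 : ℂ) • slX := by
    apply Subtype.ext
    rw [LieAlgebra.SpecialLinear.sl_bracket]
    simp [slX, slH]
    norm_num
  have := congrArg (UniversalEnvelopingAlgebra.ι ℂ) h
  rw [LieHom.map_lie, LieRing.of_associative_ring_bracket] at this
  erw [map_smul] at this
  change eX * eH - eH * eX = (-2 : ℂ) • eX at this
  rw [sub_eq_iff_eq_add] at this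
  rw [this, sub_mul, neg_smul, ofNat_smul_eq_nsmul, nsmul_eq_mul]
  push_cast; abel

theorem eHY : eH * eY = eY * (eH - 2) := by
  have h : ⁅slH, slY⁆ = (-2 : ℂ) • slY := by
    apply Subtype.ext
    rw [LieAlgebra.SpecialLinear.sl_bracket]
    ext i j; fin_cases i <;> fin_cases j <;> (simp [slY, slH]; try norm_num)
  have := congrArg (UniversalEnvelopingAlgebra.ι ℂ) h
  rw [LieHom.map_lie, LieRing.of_associative_ring_bracket] at this
  erw [map_smul] at this
  change eH * eY - eY * eH = (-2 : ℂ) • eY at this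
  rw [sub_eq_iff_eq_add] at this
  rw [this, mul_sub, neg_smul, ofNat_smul_eq_nsmul, nsmul_eq_mul, (Nat.cast_commute 2 eY).eq]
  push_cast; abel

/-- Evaluation of a polynomial at `H`. -/
abbrev ev (f : ℂ[X]) : UC := aeval eH f

theorem eX_ev (f : ℂ[X]) : eX * ev f = ev (f.comp (X - C 2)) * eX := by
  induction f using Polynomial.induction_on' with
  | add p q hp hq => simp only [ev, map_add, mul_add, add_comp, add_mul] at *; rw [hp, hq]
  | monomial n a =>
    induction n with
    | zero => simp [ev, Algebra.commutes]
    | succ n ih =>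
      have : (monomial (n+1) a : ℂ[X]) = monomial n a * X := by rw [monomial_mul_X]
      rw [this]
      simp only [ev, map_mul, mul_comp, aeval_X, X_comp] at *
      rw [← mul_assoc, ih, mul_assoc, eHX, ← mul_assoc]
      simp [map_sub, map_ofNat]

theorem ev_eY (f : ℂ[X]) : ev f * eY = eY * ev (f.comp (X - C 2)) := by
  induction f using Polynomial.induction_on' with
  | add p q hp hq => simp only [ev, map_add, mul_add, add_comp, add_mul] at *; rw [hp, hq]
  | monomial n a =>
    induction n with
    | zero => simp [ev, Algebra.commutes]
    | succ n ih =>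
      have : (monomial (n+1) a : ℂ[X]) = X * monomial n a := by rw [X_mul_monomial]
      rw [this]
      simp only [ev, map_mul, mul_comp, aeval_X, X_comp] at *
      rw [mul_assoc, ih, ← mul_assoc, eHY, mul_assoc]
      simp [map_sub, map_ofNat]


/-- Polynomials taking integral values at integers. -/
def IV (f : ℂ[X]) : Prop := ∀ z : ℤ, ∃ w : ℤ, f.eval (z : ℂ) = w

theorem IV.mul {f g : ℂ[X]} (hf : IV f) (hg : IV g) : IV (f * g) := fun z => by
  obtain ⟨a, ha⟩ := hf z
  obtain ⟨b, hb⟩ := hg z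
  exact ⟨a * b, by simp [ha, hb]⟩

theorem IV.shift {f : ℂ[X]} (hf : IV f) (c : ℤ) : IV (f.comp (X - C (c : ℂ))) := fun z => by
  obtain ⟨a, ha⟩ := hf (z - c)
  exact ⟨a, by simpa using ha⟩

theorem binPoly_zero (c : ℤ) : binPoly c 0 = 1 := by simp [binPoly]

theorem binPoly_succ (c : ℤ) (m : ℕ) :
    C ((m + 1 : ℕ) : ℂ) * binPoly c (m + 1) = (X + C (c : ℂ) - C (m : ℂ)) * binPoly c m := by
  have h1 : C (((m + 1).factorial : ℂ)⁻¹) * C ((m + 1 : ℕ) : ℂ) = C ((m.factorial : ℂ)⁻¹) := by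
    rw [← C_mul, Nat.factorial_succ]
    congr 1
    have : ((m.factorial : ℕ) : ℂ) ≠ 0 := by exact_mod_cast m.factorial_ne_zero
    have : ((m + 1 : ℕ) : ℂ) ≠ 0 := by exact_mod_cast m.succ_ne_zero
    push_cast at *
    field_simp
  rw [binPoly, binPoly, Finset.prod_range_succ, ← h1]
  ring

theorem binPoly_succ' (c : ℤ) (m : ℕ) :
    C ((m + 1 : ℕ) : ℂ) * binPoly (c + 1) (m + 1) = (X + C (c : ℂ) + 1) * binPoly c m := by
  have h1 : C (((m + 1).factorial : ℂ)⁻¹) * C ((m + 1 : ℕ) : ℂ) = C ((m.factorial : ℂ)⁻¹) := by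
    rw [← C_mul, Nat.factorial_succ]
    congr 1
    have : ((m.factorial : ℕ) : ℂ) ≠ 0 := by exact_mod_cast m.factorial_ne_zero
    have : ((m + 1 : ℕ) : ℂ) ≠ 0 := by exact_mod_cast m.succ_ne_zero
    push_cast at *
    field_simp
  have h2 : ∀ i : ℕ, (X + C (((c + 1 : ℤ)) : ℂ) - C (((i + 1 : ℕ)) : ℂ) : ℂ[X])
      = X + C (c : ℂ) - C (i : ℂ) := fun i => by
    push_cast; simp only [C_add, C_1]; ring
  rw [binPoly, binPoly, Finset.prod_range_succ', ← h1]
  simp_rw [h2]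
  push_cast; simp only [C_add, C_1, C_0]; ring

theorem binPoly_comp (c d : ℤ) (m : ℕ) :
    (binPoly c m).comp (X - C (d : ℂ)) = binPoly (c - d) m := by
  simp only [binPoly, mul_comp, C_comp, prod_comp, sub_comp, add_comp, X_comp]
  congr 1
  refine Finset.prod_congr rfl fun i _ => ?_
  push_cast; simp only [C_sub]; ring

theorem binPoly_eval (c z : ℤ) (m : ℕ) :
    (binPoly c m).eval (z : ℂ) = (Ring.choose (z + c) m : ℤ) := by
  have h3 : (descPochhammer ℤ m).eval (z + c) = ∏ i ∈ Finset.range m, (z + c - i) := by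
    induction m with
    | zero => simp
    | succ n ih => rw [descPochhammer_succ_eval, Finset.prod_range_succ, ih]
  have h := Ring.descPochhammer_eq_factorial_smul_choose (z + c) m
  rw [← aeval_eq_smeval, coe_aeval_eq_eval, h3] at h
  have hm : ((m.factorial : ℕ) : ℂ) ≠ 0 := by exact_mod_cast m.factorial_ne_zero
  have h4 := congrArg (Int.cast : ℤ → ℂ) h
  push_cast [nsmul_eq_mul] at h4
  simp only [binPoly, eval_mul, eval_C, eval_prod, eval_sub, eval_add, eval_X]
  rw [h4, inv_mul_cancel_left₀ hm]

theorem IV_binPoly (c : ℤ) (m : ℕ) : IV (binPoly c m) := fun z => ⟨_, binPoly_eval c z m⟩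

theorem binPoly_eval_nat (n m : ℕ) : (binPoly 0 m).eval (n : ℂ) = (n.choose m : ℂ) := by
  have := binPoly_eval 0 n m
  simpa [Ring.choose_natCast] using this

/-- Newton's expansion of an integer-valued polynomial. -/
theorem IV.newton {f : ℂ[X]} (hf : IV f) :
    ∃ w : ℕ → ℤ, f = ∑ i ∈ Finset.range (f.natDegree + 1), (w i : ℂ) • binPoly 0 i := by
  have hint : ∀ k : ℕ, ∀ z : ℤ, ∃ w : ℤ, (fwdDiff (1 : ℂ))^[k] f.eval (z : ℂ) = w := by
    intro k
    induction k with
    | zero => exact hf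
    | succ k ih =>
      intro z
      obtain ⟨a, ha⟩ := ih (z + 1)
      obtain ⟨b, hb⟩ := ih z
      refine ⟨a - b, ?_⟩
      rw [Function.iterate_succ_apply', fwdDiff]
      push_cast at ha ⊢
      rw [ha, hb]
  choose w hw using fun k => hint k 0
  refine ⟨w, ?_⟩
  refine Polynomial.eq_of_infinite_eval_eq _ _ ?_
  refine Set.Infinite.mono (s := Set.range (Nat.cast : ℕ → ℂ)) ?_
    (Set.infinite_range_of_injective Nat.cast_injective)
  rintro _ ⟨n, rfl⟩
  have h1 := shift_eq_sum_fwdDiff_iter (1 : ℂ) f.eval n 0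
  simp only [Set.mem_ofPred_eq, eval_finsetSum, eval_smul, binPoly_eval_nat, smul_eq_mul]
  simp only [zero_add, nsmul_eq_mul, mul_one] at h1
  rw [h1]
  have e1 : ∀ k, (fwdDiff (1 : ℂ))^[k] f.eval 0 = w k := fun k => by simpa using hw k
  simp only [e1]
  have e2 : ∀ k, f.natDegree < k → (w k : ℂ) = 0 := fun k hk => by
    rw [← e1, Polynomial.fwdDiff_iter_eq_zero_of_degree_lt hk]; rfl
  have A : ∀ N M, N ≤ M → (∀ k, N ≤ k → (n.choose k : ℂ) * w k = 0) →
      ∑ k ∈ Finset.range M, (n.choose k : ℂ) * w k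
        = ∑ k ∈ Finset.range N, (n.choose k : ℂ) * w k := fun N M hNM h => by
    symm
    refine Finset.sum_subset (Finset.range_mono hNM) fun k _ hk => h k ?_
    simpa using hk
  have B1 := A (n + 1) (max (n + 1) (f.natDegree + 1)) (le_max_left _ _) fun k hk => by
    rw [Nat.choose_eq_zero_of_lt (by omega)]; simp
  have B2 := A (f.natDegree + 1) (max (n + 1) (f.natDegree + 1)) (le_max_right _ _) fun k hk => by
    rw [e2 k (by omega)]; simp
  rw [← B1, B2]
  exact Finset.sum_congr rfl fun _ _ => mul_comm _ _

/-- divided power with integral exponent, zero for negative exponents -/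
def dpz (u : UC) (n : ℤ) : UC := if n < 0 then 0 else dp u n.toNat

theorem dp_zero (u : UC) : dp u 0 = 1 := by simp [dp]

theorem mul_dp (u : UC) (m : ℕ) : u * dp u m = ((m + 1 : ℕ) : ℂ) • dp u (m + 1) := by
  rw [dp, dp, smul_smul, Nat.factorial_succ, mul_smul_comm, ← pow_succ']
  congr 1
  have : ((m.factorial : ℕ) : ℂ) ≠ 0 := by exact_mod_cast m.factorial_ne_zero
  have : ((m + 1 : ℕ) : ℂ) ≠ 0 := by exact_mod_cast m.succ_ne_zero
  push_cast at *
  field_simp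

theorem dp_mul (u : UC) (m n : ℕ) : dp u m * dp u n = ((m + n).choose m : ℂ) • dp u (m + n) := by
  rw [dp, dp, dp, smul_mul_smul_comm, ← pow_add, smul_smul]
  congr 1
  rw [Nat.cast_add_choose]
  have : ((m.factorial : ℕ) : ℂ) ≠ 0 := by exact_mod_cast m.factorial_ne_zero
  have : ((n.factorial : ℕ) : ℂ) ≠ 0 := by exact_mod_cast n.factorial_ne_zero
  have : (((m+n).factorial : ℕ) : ℂ) ≠ 0 := by exact_mod_cast (m+n).factorial_ne_zero
  field_simp

theorem eX_dp (n : ℕ) : eX * dp eY (n + 1)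
    = dp eY (n + 1) * eX + dp eY n * ev (X - C (n : ℂ)) := by
  have hne : ((n + 1 : ℕ) : ℂ) ≠ 0 := by exact_mod_cast n.succ_ne_zero
  induction n with
  | zero => simp [dp, eXY]
  | succ n ih =>
    have hne' : ((n + 1 : ℕ) : ℂ) ≠ 0 := by exact_mod_cast n.succ_ne_zero
    have ih := ih hne'
    have key : ((n + 1 + 1 : ℕ) : ℂ) • (eX * dp eY (n + 1 + 1))
        = ((n + 1 + 1 : ℕ) : ℂ) • (dp eY (n + 1 + 1) * eX + dp eY (n + 1) *
          ev (X - C ((n + 1 : ℕ) : ℂ))) := by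
      have h3 : eH * dp eY (n + 1) = dp eY (n + 1) * (eH - (2 * (n + 1 : ℕ) : ℂ) • (1 : UC)) := by
        have : ∀ m : ℕ, eH * eY ^ m = eY ^ m * (eH - (2 * (m : ℕ) : ℂ) • (1 : UC)) := by
          intro m
          induction m with
          | zero => simp
          | succ m ihm =>
            have := ev_eY X
            simp only [ev, aeval_X, X_comp, map_sub, aeval_C] at this
            rw [pow_succ, ← mul_assoc, ihm, mul_assoc, mul_assoc, sub_mul, this]
            simp only [Algebra.algebraMap_eq_smul_one, smul_mul_assoc, one_mul]
            simp only [mul_sub, mul_smul_comm, mul_one]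
            push_cast
            module
        rw [dp, mul_smul_comm, this, smul_mul_assoc]
      rw [← mul_smul_comm, ← mul_dp, ← mul_assoc, eXY, add_mul, mul_assoc, ih, mul_add,
        ← mul_assoc, mul_dp, ← mul_assoc, mul_dp, h3]
      simp only [ev, map_sub, aeval_X, aeval_C, Algebra.algebraMap_eq_smul_one]
      simp only [mul_sub, mul_smul_comm, mul_one, smul_add, smul_sub, smul_mul_assoc]
      push_cast
      module
    exact smul_right_injective _ (by exact_mod_cast (n+1).succ_ne_zero) key

theorem eX_dpz (n : ℤ) : eX * dpz eY n
    = dpz eY n * eX + dpz eY (n - 1) * ev (X - C (n : ℂ) + 1) := by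
  rcases lt_trichotomy n 0 with h | h | h
  · simp [dpz, h, show n - 1 < 0 by omega]
  · subst h; simp [dpz, dp_zero]
  · obtain ⟨m, rfl⟩ : ∃ m : ℕ, n = (m + 1 : ℕ) := ⟨(n - 1).toNat, by omega⟩
    have h1 : dpz eY ((m + 1 : ℕ) : ℤ) = dp eY (m + 1) := by
      rw [dpz, if_neg (by omega), Int.toNat_natCast]
    have h2 : dpz eY (((m + 1 : ℕ) : ℤ) - 1) = dp eY m := by
      rw [dpz, if_neg (by omega)]; congr 1; omega
    rw [h1, h2, eX_dp]
    congr 3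
    push_cast; simp only [C_add, C_1]; ring

theorem comm_formula (m : ℕ) (n : ℤ) : dp eX m * dpz eY n = ∑ k ∈ Finset.range (m + 1),
    dpz eY (n - k) * ev (binPoly (-m - n + 2 * k) k) * dp eX (m - k) := by
  induction m with
  | zero => simp [dp_zero, binPoly_zero, ev]
  | succ m ih =>
    have hne : ((m + 1 : ℕ) : ℂ) ≠ 0 := by exact_mod_cast m.succ_ne_zero
    refine smul_right_injective _ hne ?_
    change ((m + 1 : ℕ) : ℂ) • _ = ((m + 1 : ℕ) : ℂ) • _
    rw [← smul_mul_assoc, ← mul_dp, mul_assoc, ih, Finset.mul_sum, Finset.smul_sum]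
    set P : ℕ → UC := fun k => dpz eY (n - k) *
      ev (C ((m + 1 : ℂ) - k) * binPoly (-m - n + 2 * k - 2) k) * dp eX (m + 1 - k) with hP
    set Q : ℕ → UC := fun k => dpz eY (n - k - 1) *
      ev ((X - C ((n - k : ℤ) : ℂ) + 1) * binPoly (-m - n + 2 * k) k) * dp eX (m - k) with hQ
    have s1 : ∀ k ∈ Finset.range (m + 1), eX * (dpz eY (n - k) *
        ev (binPoly (-m - n + 2 * k) k) * dp eX (m - k)) = P k + Q k := by
      intro k hk
      have hk : k ≤ m := by simpa [Nat.lt_succ_iff] using hk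
      have hb := eX_ev (binPoly (-m - n + 2 * k) k)
      have h2 := binPoly_comp (-m - n + 2 * k) 2 k
      push_cast at h2
      rw [h2] at hb
      rw [← mul_assoc, ← mul_assoc, eX_dpz, add_mul, add_mul, mul_assoc _ eX, hb, mul_assoc,
        mul_assoc _ eX, mul_dp]
      congr 1
      · have e : m - k + 1 = m + 1 - k := by omega
        simp only [hP, e, ev, map_mul, aeval_C, Algebra.algebraMap_eq_smul_one]
        simp only [smul_mul_assoc, mul_smul_comm, one_mul, mul_assoc]
        congr 1
        push_cast [Nat.cast_sub (show k ≤ m + 1 by omega)]; ring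
      · simp only [hQ, ev, map_mul, mul_assoc]
    rw [Finset.sum_congr rfl s1, Finset.sum_add_distrib]
    have s2 : ∑ k ∈ Finset.range (m + 1), P k = ∑ k ∈ Finset.range (m + 1 + 1), P k := by
      rw [Finset.sum_range_succ _ (m + 1)]
      simp [hP]
    rw [s2, Finset.sum_range_succ', Finset.sum_range_succ' _ (m + 1), add_right_comm,
      ← Finset.sum_add_distrib]
    congr 1
    · refine Finset.sum_congr rfl fun k hk => ?_
      have hk : k ≤ m := by simpa [Nat.lt_succ_iff] using hk
      have e1 : m + 1 - (k + 1) = m - k := by omega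
      have e2 : n - ((k + 1 : ℕ) : ℤ) = n - k - 1 := by push_cast; ring
      simp only [hP, hQ, e1, e2]
      rw [← add_mul, ← mul_add, ← smul_mul_assoc, ← mul_smul_comm]
      congr 2
      rw [← map_add, ← map_smul]
      congr 1
      have hk1 : (C ((k + 1 : ℕ) : ℂ)) ≠ 0 := by
        rw [Ne, C_eq_zero]; exact_mod_cast k.succ_ne_zero
      refine mul_left_cancel₀ hk1 ?_
      have r1 := binPoly_succ (-m - n + 2 * k) k
      have r2 := binPoly_succ' (-m - n + 2 * k) k
      have e3 : (-(m:ℤ) - n + 2 * ((k + 1 : ℕ) : ℤ) - 2) = -m - n + 2 * k := by push_cast; ring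
      have e4 : (-((m + 1 : ℕ):ℤ) - n + 2 * ((k + 1 : ℕ) : ℤ)) = -m - n + 2 * k + 1 := by
        push_cast; ring
      rw [e3, e4, mul_add, smul_eq_C_mul, mul_left_comm, r1, mul_left_comm (C _) (C _), r2]
      push_cast
      simp only [C_add, C_sub, C_neg, C_1, C_mul, C_ofNat]
      ring
    · have e5 : ((m : UC) + 1) = ((m : ℂ) + 1) • (1 : UC) := by
        rw [add_smul, one_smul, Nat.cast_smul_eq_nsmul, nsmul_eq_mul, mul_one]
      simp only [hP, binPoly_zero, ev]
      simp [e5]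

theorem dpX_mem (m : ℕ) : dp eX m ∈ UZ := Algebra.subset_adjoin (Or.inl ⟨m, rfl⟩)

theorem dpY_mem (m : ℕ) : dp eY m ∈ UZ := Algebra.subset_adjoin (Or.inr ⟨m, rfl⟩)

theorem dpz_mem (n : ℤ) : dpz eY n ∈ UZ := by
  rw [dpz]; split_ifs
  · exact zero_mem _
  · exact dpY_mem _

theorem int_smul_UC (w : ℤ) (u : UC) : (w : ℂ) • u = w • u := Int.cast_smul_eq_zsmul ℂ w u

theorem IV.mem_of_bin {N : ℕ} (h : ∀ i ≤ N, ev (binPoly 0 i) ∈ UZ) {f : ℂ[X]} (hf : IV f)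
    (hd : f.natDegree ≤ N) : ev f ∈ UZ := by
  obtain ⟨w, hw⟩ := hf.newton
  rw [hw, ev, map_sum]
  refine sum_mem fun i hi => ?_
  rw [map_smul, int_smul_UC]
  exact zsmul_mem (h i (by have := Finset.mem_range.1 hi; omega)) _

theorem natDegree_binPoly (c : ℤ) (m : ℕ) : (binPoly c m).natDegree = m := by
  have h : ∀ i : ℕ, (X + C (c : ℂ) - C (i : ℂ) : ℂ[X]) = X - C ((i : ℂ) - c) := fun i => by
    rw [C_sub]; ring
  rw [binPoly, natDegree_C_mul (inv_ne_zero (by exact_mod_cast m.factorial_ne_zero))]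
  simp_rw [h]
  rw [natDegree_prod_of_monic _ _ fun i _ => monic_X_sub_C _,
    Finset.sum_congr rfl fun i _ => natDegree_X_sub_C _]
  simp

theorem bin0_mem (m : ℕ) : ev (binPoly 0 m) ∈ UZ := by
  induction m using Nat.strong_induction_on with
  | _ m ih =>
    have h := comm_formula m m
    rw [Finset.sum_range_succ] at h
    have h1 : dpz eY ((m : ℤ) - m) = 1 := by simp [dpz, dp_zero]
    have h2 : (-(m : ℤ) - m + 2 * m) = 0 := by ring
    rw [h1, h2, Nat.sub_self, dp_zero, one_mul, mul_one, ← sub_eq_iff_eq_add'] at h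
    rw [← h]
    refine sub_mem (mul_mem (dpX_mem _) (dpz_mem _)) (sum_mem fun k hk => ?_)
    have hk := Finset.mem_range.1 hk
    refine mul_mem (mul_mem (dpz_mem _) ?_) (dpX_mem _)
    exact IV.mem_of_bin (N := k) (fun i hi => ih i (by omega)) (IV_binPoly _ _)
      (natDegree_binPoly _ _).le

theorem IV.mem {f : ℂ[X]} (hf : IV f) : ev f ∈ UZ :=
  IV.mem_of_bin (N := f.natDegree) (fun i _ => bin0_mem i) hf le_rfl

theorem binH_mem (c : ℤ) (m : ℕ) : binH c m ∈ UZ := (IV_binPoly c m).mem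

/-- The monomial `Y^(m) (H choose n) X^(m')` for `v = (m, n, m')`, in the `ℤ`-form. -/
def monZ (v : ℕ × ℕ × ℕ) : UZ :=
  ⟨dp eY v.1, dpY_mem _⟩ * ⟨binH 0 v.2.1, binH_mem _ _⟩ * ⟨dp eX v.2.2, dpX_mem _⟩

theorem monZ_coe (v : ℕ × ℕ × ℕ) :
    (monZ v : UC) = dp eY v.1 * ev (binPoly 0 v.2.1) * dp eX v.2.2 := rfl

/-- the `ℤ`-span of the monomials -/
def spanZ : Submodule ℤ UC := Submodule.span ℤ (Set.range fun v => (monZ v : UC))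

theorem mem_spanZ {f : ℂ[X]} (hf : IV f) (m l : ℕ) : dp eY m * ev f * dp eX l ∈ spanZ := by
  obtain ⟨w, hw⟩ := hf.newton
  rw [hw, ev, map_sum, Finset.mul_sum, Finset.sum_mul]
  refine sum_mem fun i _ => ?_
  rw [map_smul, int_smul_UC, mul_smul_comm, smul_mul_assoc]
  exact Submodule.smul_mem _ _ (Submodule.subset_span ⟨(m, i, l), rfl⟩)

theorem eX_pow_ev (a : ℕ) (f : ℂ[X]) :
    dp eX a * ev f = ev (f.comp (X - C ((2 * a : ℤ) : ℂ))) * dp eX a := by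
  have : ∀ a : ℕ, eX ^ a * ev f = ev (f.comp (X - C ((2 * a : ℤ) : ℂ))) * eX ^ a := by
    intro a
    induction a with
    | zero => simp
    | succ a ih =>
      rw [pow_succ', mul_assoc, ih, ← mul_assoc, eX_ev, mul_assoc, comp_assoc]
      congr 3
      simp only [sub_comp, X_comp, C_comp]
      push_cast
      simp only [mul_add, C_add, mul_one]
      ring
  rw [dp, smul_mul_assoc, this, mul_smul_comm]

theorem dpX_mul_spanZ (a : ℕ) {u : UC} (hu : u ∈ spanZ) : dp eX a * u ∈ spanZ := by
  induction hu using Submodule.span_induction with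
  | mem u hu =>
    obtain ⟨⟨m, n, l⟩, rfl⟩ := hu
    have h := comm_formula a m
    have hm : dpz eY (m : ℤ) = dp eY m := by
      rw [dpz, if_neg (by omega), Int.toNat_natCast]
    rw [hm] at h
    simp only [monZ_coe]
    rw [← mul_assoc, ← mul_assoc, h, Finset.sum_mul, Finset.sum_mul]
    refine sum_mem fun k hk => ?_
    rw [dpz]
    split_ifs
    · simp
    · rw [mul_assoc _ (dp eX (a - k)), eX_pow_ev, ← mul_assoc, mul_assoc _ (dp eX (a - k)),
        dp_mul, mul_smul_comm, mul_assoc (dp eY _), ← map_mul]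
      rw [Nat.cast_smul_eq_nsmul]
      exact nsmul_mem (mem_spanZ ((IV_binPoly _ _).mul ((IV_binPoly _ _).shift _)) _ _) _
  | zero => simp
  | add u v _ _ hu hv => rw [mul_add]; exact add_mem hu hv
  | smul c u _ hu => rw [mul_smul_comm]; exact Submodule.smul_mem _ _ hu

theorem dpY_mul_spanZ (a : ℕ) {u : UC} (hu : u ∈ spanZ) : dp eY a * u ∈ spanZ := by
  induction hu using Submodule.span_induction with
  | mem u hu =>
    obtain ⟨⟨m, n, l⟩, rfl⟩ := hu
    simp only [monZ_coe]
    rw [← mul_assoc, ← mul_assoc, dp_mul, smul_mul_assoc, smul_mul_assoc,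
      Nat.cast_smul_eq_nsmul]
    exact nsmul_mem (mem_spanZ (IV_binPoly _ _) _ _) _
  | zero => simp
  | add u v _ _ hu hv => rw [mul_add]; exact add_mem hu hv
  | smul c u _ hu => rw [mul_smul_comm]; exact Submodule.smul_mem _ _ hu

theorem UZ_mul_spanZ {x : UC} (hx : x ∈ UZ) : ∀ u ∈ spanZ, x * u ∈ spanZ := by
  induction hx using Algebra.adjoin_induction with
  | mem x hx =>
    intro u hu
    rcases hx with ⟨a, rfl⟩ | ⟨a, rfl⟩
    · exact dpX_mul_spanZ a hu
    · exact dpY_mul_spanZ a hu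
  | algebraMap r =>
    intro u hu
    rw [← Algebra.smul_def]; exact Submodule.smul_mem _ _ hu
  | add x y _ _ hx hy => intro u hu; rw [add_mul]; exact add_mem (hx u hu) (hy u hu)
  | mul x y _ _ hx hy => intro u hu; rw [mul_assoc]; exact hx _ (hy u hu)

theorem UZ_le_spanZ {x : UC} (hx : x ∈ UZ) : x ∈ spanZ := by
  have h1 : (1 : UC) ∈ spanZ := by
    have := mem_spanZ (IV_binPoly 0 0) 0 0
    simpa [dp_zero, binPoly_zero, ev] using this
  simpa using UZ_mul_spanZ hx 1 h1

theorem monZ_span : ⊤ ≤ Submodule.span ℤ (Set.range monZ) := by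
  rintro ⟨x, hx⟩ -
  have h := UZ_le_spanZ hx
  rw [spanZ, Set.range_comp' (fun y : UZ => (y : UC)) monZ] at h
  have e : Submodule.span ℤ ((fun y : UZ => (y : UC)) '' Set.range monZ)
      = (Submodule.span ℤ (Set.range monZ)).map UZ.val.toLinearMap := by
    rw [Submodule.map_span]; rfl
  rw [e] at h
  obtain ⟨y, hy, hyx⟩ := h
  have : y = ⟨x, hx⟩ := Subtype.ext hyx
  rwa [← this]

/-! Linear independence, through the action on polynomials by differential operators. -/

/-- the operator by which `H` acts on the Verma module of highest weight `c` -/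
def opH (c : ℂ) : Module.End ℂ ℂ[X] :=
  c • LinearMap.id - (2 : ℂ) • (LinearMap.mulLeft ℂ X ∘ₗ derivative)

/-- the operator by which `X` acts on the Verma module of highest weight `c` -/
def opX (c : ℂ) : Module.End ℂ ℂ[X] :=
  c • derivative - LinearMap.mulLeft ℂ X ∘ₗ derivative ∘ₗ derivative

/-- the operator by which `Y` acts on the Verma module of highest weight `c` -/
def opY : Module.End ℂ ℂ[X] := LinearMap.mulLeft ℂ X

/-- the action of `sl₂` on the Verma module -/
def vermaLin (c : ℂ) : LieAlgebra.SpecialLinear.sl (Fin 2) ℂ →ₗ[ℂ] Module.End ℂ ℂ[X] where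
  toFun A := A.1 0 0 • opH c + A.1 0 1 • opX c + A.1 1 0 • opY
  map_add' A B := by simp [add_smul]; abel
  map_smul' r A := by simp [mul_smul]

/-- the action of `sl₂` on the Verma module, as a homomorphism of Lie algebras -/
def vermaLie (c : ℂ) : LieAlgebra.SpecialLinear.sl (Fin 2) ℂ →ₗ⁅ℂ⁆ Module.End ℂ ℂ[X] :=
  { vermaLin c with
    map_lie' := by
      intro A B
      have tr : ∀ A : LieAlgebra.SpecialLinear.sl (Fin 2) ℂ, A.1 1 1 = - A.1 0 0 := fun A => by
        have h : Matrix.trace A.1 = 0 := LinearMap.mem_ker.1 A.2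
        rw [Matrix.trace_fin_two] at h
        exact eq_neg_of_add_eq_zero_right h
      have hA := tr A
      have hB := tr B
      have hC : (C 2 : ℂ[X]) = 2 := rfl
      refine LinearMap.ext fun f => ?_
      simp only [vermaLin, AddHom.toFun_eq_coe]
      simp [LieRing.of_associative_ring_bracket, Matrix.mul_apply, Fin.sum_univ_two, hA, hB,
        opH, opX, opY, smul_eq_C_mul, derivative_mul, hC]
      ring }

/-- the action of the enveloping algebra on the Verma module -/
def verma (c : ℂ) : UC →ₐ[ℂ] Module.End ℂ ℂ[X] := UniversalEnvelopingAlgebra.lift ℂ (vermaLie c)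

theorem verma_X (c : ℂ) : verma c eX = opX c := by
  rw [verma, eX, UniversalEnvelopingAlgebra.lift_ι_apply]
  change vermaLin c slX = _
  simp [vermaLin, slX]

theorem verma_Y (c : ℂ) : verma c eY = opY := by
  rw [verma, eY, UniversalEnvelopingAlgebra.lift_ι_apply]
  change vermaLin c slY = _
  simp [vermaLin, slY]

theorem verma_H (c : ℂ) : verma c eH = opH c := by
  rw [verma, eH, UniversalEnvelopingAlgebra.lift_ι_apply]
  change vermaLin c slH = _
  simp [vermaLin, slH]

theorem opX_pow (c : ℂ) (i : ℕ) :
    opX c (X ^ (i + 1)) = C ((i + 1) * (c - i)) * X ^ i := by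
  rcases i with _ | i
  · simp [opX, smul_eq_C_mul]
  · simp [opX, smul_eq_C_mul, derivative_mul]
    ring

theorem opX_one (c : ℂ) : opX c 1 = 0 := by simp [opX]

theorem opX_iter (c : ℂ) (l : ℕ) :
    (opX c ^ l) (X ^ l) = C (∏ i ∈ Finset.range l, ((i + 1) * (c - i) : ℂ)) := by
  induction l with
  | zero => simp
  | succ l ih =>
    rw [pow_succ, Module.End.mul_apply, opX_pow, ← smul_eq_C_mul, map_smul, ih,
      Finset.prod_range_succ, smul_eq_C_mul, ← C_mul, mul_comm]

theorem opX_iter_zero (c : ℂ) (l k : ℕ) : (opX c ^ (l + 1 + k)) (X ^ l) = 0 := by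
  have e : l + 1 + k = k + 1 + l := by ring
  rw [e, pow_add, Module.End.mul_apply, opX_iter, pow_succ, Module.End.mul_apply]
  rw [show (C (∏ i ∈ Finset.range l, ((i + 1) * (c - i) : ℂ)) : ℂ[X])
    = (∏ i ∈ Finset.range l, ((i + 1) * (c - i) : ℂ)) • 1 by rw [smul_eq_C_mul, mul_one],
    map_smul, opX_one, smul_zero, map_zero]

theorem verma_ev (c : ℂ) (f : ℂ[X]) : verma c (ev f) 1 = C (f.eval c) := by
  have h1 : opH c 1 = c • 1 := by simp [opH]
  rw [ev, ← aeval_algHom_apply, verma_H]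
  have := Module.End.aeval_apply_of_hasEigenvector (f := opH c) (p := f) (μ := c) (x := 1)
    (Module.End.hasEigenvector_iff.2 ⟨Module.End.mem_eigenspace_iff.2 h1, one_ne_zero⟩)
  rw [this, smul_eq_C_mul, mul_one]

theorem verma_mon (c : ℂ) (v : ℕ × ℕ × ℕ) : verma c (monZ v) (X ^ v.2.2) =
    C ((v.1.factorial : ℂ)⁻¹ * (v.2.2.factorial : ℂ)⁻¹
      * (∏ i ∈ Finset.range v.2.2, ((i + 1) * (c - i) : ℂ)) * (binPoly 0 v.2.1).eval c)
      * X ^ v.1 := by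
  rw [monZ_coe, map_mul, map_mul, Module.End.mul_apply, Module.End.mul_apply]
  have hx : verma c (dp eX v.2.2) (X ^ v.2.2) = ((v.2.2.factorial : ℂ)⁻¹ *
      ∏ i ∈ Finset.range v.2.2, ((i + 1) * (c - i) : ℂ)) • 1 := by
    rw [dp, map_smul (verma c), map_pow (verma c), verma_X, LinearMap.smul_apply, opX_iter, smul_eq_C_mul,
      smul_eq_C_mul, mul_one, C_mul]
  have hy : ∀ m : ℕ, verma c (dp eY m) 1 = C ((m.factorial : ℂ)⁻¹) * X ^ m := fun m => by
    rw [dp, map_smul (verma c), map_pow (verma c), verma_Y, LinearMap.smul_apply, smul_eq_C_mul]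
    congr 1
    rw [opY, LinearMap.pow_mulLeft]; simp
  rw [hx, map_smul, verma_ev, ← mul_one (C (eval _ _)), ← smul_eq_C_mul, smul_smul, map_smul, hy,
    smul_eq_C_mul, ← mul_assoc, ← C_mul]
  congr 2
  ring

theorem verma_mon_zero (c : ℂ) (v : ℕ × ℕ × ℕ) (l : ℕ) (h : l < v.2.2) :
    verma c (monZ v) (X ^ l) = 0 := by
  obtain ⟨k, hk⟩ := Nat.exists_eq_add_of_lt h
  have hk : v.2.2 = l + 1 + k := by omega
  have hx : verma c (dp eX v.2.2) (X ^ l) = 0 := by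
    rw [dp, map_smul (verma c), map_pow (verma c), verma_X, LinearMap.smul_apply, hk,
      opX_iter_zero, smul_zero]
  rw [monZ_coe, map_mul, Module.End.mul_apply, hx, map_zero]

theorem monZ_li : LinearIndependent ℤ monZ := by
  rw [linearIndependent_iff]
  intro g hg
  by_contra hne
  have hs : g.support.Nonempty := Finsupp.support_nonempty_iff.2 hne
  obtain ⟨v₀, hv₀, hmin⟩ := Finset.exists_min_image g.support (fun v => v.2.2) hs
  set l := v₀.2.2 with hl
  set T := g.support.filter (fun v => v.1 = v₀.1 ∧ v.2.2 = l) with hT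
  have hpoly : ∀ N : ℕ, l ≤ N → ∑ v ∈ T, (g v : ℂ) * (binPoly 0 v.2.1).eval (N : ℂ) = 0 := by
    intro N hN
    have h1 : verma (N : ℂ) ((Finsupp.linearCombination ℤ monZ g : UZ) : UC) (X ^ l) = 0 := by
      rw [hg]; simp
    rw [Finsupp.linearCombination_apply, Finsupp.sum] at h1
    have h2 : ((∑ v ∈ g.support, g v • monZ v : UZ) : UC)
        = ∑ v ∈ g.support, (g v : ℂ) • (monZ v : UC) := by
      rw [AddSubmonoidClass.coe_finsetSum]
      exact Finset.sum_congr rfl fun v _ => by rw [int_smul_UC]; rfl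
    rw [h2, map_sum, LinearMap.sum_apply] at h1
    have h3 := congrArg (fun q : ℂ[X] => q.coeff v₀.1) h1
    simp only [finsetSum_coeff, coeff_zero, map_smul, LinearMap.smul_apply] at h3
    set K : ℂ := (v₀.1.factorial : ℂ)⁻¹ * (l.factorial : ℂ)⁻¹
      * (∏ i ∈ Finset.range l, ((i + 1) * ((N : ℂ) - i) : ℂ)) with hK
    have hK0 : K ≠ 0 := by
      refine mul_ne_zero (mul_ne_zero ?_ ?_) ?_
      · exact inv_ne_zero (by exact_mod_cast Nat.factorial_ne_zero _)
      · exact inv_ne_zero (by exact_mod_cast Nat.factorial_ne_zero _)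
      · refine Finset.prod_ne_zero_iff.2 fun i hi => mul_ne_zero ?_ ?_
        · exact_mod_cast i.succ_ne_zero
        · have := Finset.mem_range.1 hi
          rw [sub_ne_zero]; exact_mod_cast (by omega : N ≠ i)
    refine (mul_eq_zero.1 (?_ : K * _ = 0)).resolve_left hK0
    rw [Finset.mul_sum, ← h3, hT, Finset.sum_filter]
    refine Finset.sum_congr rfl fun v hv => ?_
    have hlv := hmin v hv
    rcases hlv.lt_or_eq with hlt | heq
    · rw [if_neg (by omega), verma_mon_zero _ _ _ hlt]; simp
    · have e : (X ^ l : ℂ[X]) = X ^ v.2.2 := by rw [← heq]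
      rw [e, verma_mon, coeff_smul, coeff_C_mul, coeff_X_pow]
      split_ifs with h5 h6 h6
      · have e2 : v.2.2 = l := heq.symm
        rw [hK, h5.1, e2, smul_eq_mul]; ring
      · exact absurd h5.1.symm h6
      · exact absurd ⟨h6.symm, heq.symm⟩ h5
      · simp
  have hzero : ∑ v ∈ T, C (g v : ℂ) * binPoly 0 v.2.1 = 0 := by
    refine Polynomial.eq_of_infinite_eval_eq _ _ ?_
    refine Set.Infinite.mono (s := (Nat.cast : ℕ → ℂ) '' Set.Ici l) ?_
      ((Set.Ici_infinite l).image Nat.cast_injective.injOn)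
    rintro _ ⟨N, hN, rfl⟩
    simpa [eval_finsetSum] using hpoly N hN
  have hTne : T.Nonempty := ⟨v₀, by simp [hT, hv₀, hl]⟩
  obtain ⟨v₁, hv₁, hmax⟩ := Finset.exists_max_image T (fun v => v.2.1) hTne
  have h7 := congrArg (fun q : ℂ[X] => q.coeff v₁.2.1) hzero
  simp only [finsetSum_coeff, coeff_C_mul, coeff_zero] at h7
  rw [Finset.sum_eq_single v₁] at h7
  · rcases mul_eq_zero.1 h7 with h8 | h8
    · have : v₁ ∈ g.support := (Finset.mem_filter.1 hv₁).1
      exact Finsupp.mem_support_iff.1 this (by exact_mod_cast h8)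
    · have h9 : (binPoly 0 v₁.2.1).leadingCoeff = 0 := by
        rw [leadingCoeff, natDegree_binPoly, h8]
      rw [leadingCoeff_eq_zero] at h9
      have h10 := binPoly_eval_nat v₁.2.1 v₁.2.1
      rw [h9] at h10
      simp at h10
  · intro v hv hvne
    have h8 := hmax v hv
    have h9 : v.2.1 ≠ v₁.2.1 := fun h => hvne (by
      have a := (Finset.mem_filter.1 hv).2
      have b := (Finset.mem_filter.1 hv₁).2
      exact Prod.ext (a.1.trans b.1.symm) (Prod.ext h (a.2.trans b.2.symm)))
    rw [coeff_eq_zero_of_natDegree_lt (by rw [natDegree_binPoly]; omega), mul_zero]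
  · intro h; exact absurd hv₁ h

/-- The monomials form a `ℤ`-basis of the `ℤ`-form. -/
def basisZ : Module.Basis (ℕ × ℕ × ℕ) ℤ UZ := Module.Basis.mk monZ_li monZ_span

/-! ### The hyperalgebra -/

section Hyperalgebra

variable (k : Type*) [Field k]

/-- The hyperalgebra `𝒰 = Dist(SL₂) = k ⊗ 𝒰_ℤ`. -/
def Hyp : Type _ := k ⊗[ℤ] UZ

instance : Ring (Hyp k) := inferInstanceAs (Ring (k ⊗[ℤ] UZ))

instance : Algebra k (Hyp k) := inferInstanceAs (Algebra k (k ⊗[ℤ] UZ))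

/-- The image in the hyperalgebra of an element of the `ℤ`-form. -/
def img : UZ →+* Hyp k :=
  (Algebra.TensorProduct.includeRight : UZ →ₐ[ℤ] k ⊗[ℤ] UZ).toRingHom

theorem img_apply (u : UZ) : img k u = (1 : k) ⊗ₜ[ℤ] u := rfl

/-- `X^(m)` in the hyperalgebra. -/
def dX (m : ℕ) : Hyp k := img k ⟨dp eX m, dpX_mem m⟩

/-- `Y^(m)` in the hyperalgebra. -/
def dY (m : ℕ) : Hyp k := img k ⟨dp eY m, dpY_mem m⟩

/-- `(H+c choose m)` in the hyperalgebra. -/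
def dH (c : ℤ) (m : ℕ) : Hyp k := img k ⟨binH c m, binH_mem c m⟩

/-- The `k`-basis `Y^(m) (H choose n) X^(m')` of the hyperalgebra, indexed by `(m, n, m')`. -/
def monBasis : Module.Basis (ℕ × ℕ × ℕ) k (Hyp k) := Algebra.TensorProduct.basis k basisZ

theorem monBasis_apply (v : ℕ × ℕ × ℕ) :
    monBasis k v = dY k v.1 * dH k 0 v.2.1 * dX k v.2.2 := by
  rw [dY, dH, dX, ← map_mul, ← map_mul, img_apply]
  refine (Algebra.TensorProduct.basis_apply (A := k) basisZ v).trans ?_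
  rw [basisZ, Module.Basis.mk_apply]
  rfl

/-- The `k`-linear map `Fr'` with
`Y^(m) (H choose n) X^(m') ↦ Y^(mp) (H choose np) X^(m'p)`. -/
def frobSection (p : ℕ) : Hyp k →ₗ[k] Hyp k :=
  (monBasis k).constr k fun v => dY k (v.1 * p) * dH k 0 (v.2.1 * p) * dX k (v.2.2 * p)

/-- `𝒰_r`: the subalgebra generated by `X^(p^i)` and `Y^(p^i)` for `0 ≤ i ≤ r-1`. -/
def frobKernelAlg (p r : ℕ) : Subalgebra k (Hyp k) :=
  Algebra.adjoin k {u | ∃ i < r, u = dX k (p ^ i) ∨ u = dY k (p ^ i)}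

/-- `𝒰⁰`: the subalgebra generated by all `(H choose p^i)`. -/
def cartanAlg (p : ℕ) : Subalgebra k (Hyp k) :=
  Algebra.adjoin k (Set.range fun i : ℕ => dH k 0 (p ^ i))

/-- `𝒜`: the subalgebra generated by `𝒰⁰` and all `Y^(p^i) X^(p^i)`. -/
def degZeroAlg (p : ℕ) : Subalgebra k (Hyp k) :=
  Algebra.adjoin k ((cartanAlg k p : Set (Hyp k)) ∪
    Set.range fun i : ℕ => dY k (p ^ i) * dX k (p ^ i))

/-- `𝒜_r = 𝒜 ∩ 𝒰_r`. -/
def Ar (p r : ℕ) : Subalgebra k (Hyp k) := degZeroAlg k p ⊓ frobKernelAlg k p r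

end Hyperalgebra

/-! ### Index sets and integers attached to them -/

/-- The index set `𝒫`: it is `{0,…,p-1} × {0,…,(p-1)/2}` for odd `p`, and
`{(0,1/2), (1,0), (1,1)}` for `p = 2`. -/
def pairSet (p : ℕ) : Set (ℕ × ℚ) :=
  if p = 2 then {(0, 1 / 2), (1, 0), (1, 1)}
  else {q | q.1 < p ∧ ∃ s : ℕ, s ≤ (p - 1) / 2 ∧ q.2 = s}

/-- Condition (A): `a` is even and `(p-a+1)/2 ≤ j ≤ (p-1)/2`. -/
def condA (p a : ℕ) (j : ℚ) : Prop :=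
  Even a ∧ ((p : ℚ) - a + 1) / 2 ≤ j ∧ j ≤ ((p : ℚ) - 1) / 2

/-- Condition (C): `a` is odd and `0 ≤ j ≤ (a-1)/2`. -/
def condC (a : ℕ) (j : ℚ) : Prop :=
  Odd a ∧ 0 ≤ j ∧ j ≤ ((a : ℚ) - 1) / 2

/-- The integer `s(a,j)`, used under conditions (A) and (C). -/
def sInt (p a : ℕ) : ℕ :=
  if p = 2 then 1 else if Even a then (p - a + 1) / 2 else (p - a) / 2

/-- Whether the pair `(a,j)` carries a genuine choice `ε ∈ {0,1}`:
`j ≠ 0` for odd `p`, and `a ≠ 1` for `p = 2`. -/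
def IsFree (p a : ℕ) (j : ℚ) : Prop := if p = 2 then a ≠ 1 else j ≠ 0

/-- The set `𝒳_r(a,j)`: those `ε` with `ε_i = 0` whenever `j_i = 0` (`p` odd), respectively
whenever `a_i = 1` (`p = 2`). -/
def admissible (p : ℕ) {r : ℕ} (a : Fin r → ℕ) (j : Fin r → ℚ) : Set (Fin r → Fin 2) :=
  {ε | ∀ i, ¬ IsFree p (a i) (j i) → ε i = 0}

/-- The number `w`: the Hamming weight of `j` for odd `p`, and `r` minus the Hamming weight of `a`
for `p = 2`. -/
def wInt (p : ℕ) {r : ℕ} (a : Fin r → ℕ) (j : Fin r → ℚ) : ℕ :=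
  if p = 2 then r - hammingNorm a else hammingNorm j

open Classical in
/-- The element `τ` of largest Hamming weight in `𝒳_r(a,j)`. -/
def tau (p : ℕ) {r : ℕ} (a : Fin r → ℕ) (j : Fin r → ℚ) : Fin r → Fin 2 :=
  fun i => if IsFree p (a i) (j i) then 1 else 0

/-! ### The polynomials over `𝔽_p` -/

section Polynomials

variable (p : ℕ) [Fact p.Prime]

/-- `φ_{a,m}(x) = ∏_{i<m} (x - i(i+a+1))`. -/
def phi (a : ℤ) (m : ℕ) : (ZMod p)[X] :=
  ∏ i ∈ Finset.range m, (X - C ((i : ZMod p) * (i + a + 1)))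

/-- `ψ(x) = ∏_{i ∈ 𝔽_p} (x - i²)`. -/
def psi : (ZMod p)[X] := ∏ i : ZMod p, (X - C (i ^ 2))

/-- `ψ_s^{(ε)}(x)`: for `ε = 1` it is `ψ(x)/(x-s²)`; for `ε = 0` it is `∏_{i ≠ 0} (x - i²)` if
`s = 0`, and `2x(x+s²) ∏_{i ≠ 0, s, -s} (x - i²)` if `s ≠ 0`. -/
def psiEps (ε : Fin 2) (s : ZMod p) : (ZMod p)[X] :=
  if ε = 1 then psi p /ₘ (X - C (s ^ 2))
  else if s = 0 then ∏ i : ZMod p with i ≠ 0, (X - C (i ^ 2))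
  else 2 * X * (X + C (s ^ 2)) * ∏ i : ZMod p with i ≠ 0 ∧ i ≠ s ∧ i ≠ -s, (X - C (i ^ 2))

/-- `((a+1)/2)²` in `𝔽_p`, for odd `p`. -/
def halfSq (a : ℤ) : ZMod p := (((a : ZMod p) + 1) / 2) ^ 2

/-- `n^{(ε)}(a,j)`: for odd `p` the largest `n` such that `φ_{a,n}(x)` divides
`ψ_j^{(ε)}(x + ((a+1)/2)²)`; for `p = 2` it is given by a table. -/
def nInt (ε : Fin 2) (a : ℕ) (j : ℚ) : ℕ :=
  if p = 2 then
    if a = 0 then (ε : ℕ) else if j = 0 then 1 else 0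
  else sSup {n : ℕ | phi p a n ∣ (psiEps p ε (j : ZMod p)).comp (X + C (halfSq p a))}

end Polynomials

/-! ### The elements `B^{(ε)}(a,j)` -/

section Elements

variable (k : Type*) [Field k] (p : ℕ) [Fact p.Prime] [CharP k p]

/-- `μ_a = (H-a-1 choose p-1)`. -/
def mu (a : ℤ) : Hyp k := dH k (-a - 1) (p - 1)

/-- `B^{(ε)}(a,j)` for a single pair: for odd `p` it is
`ψ_j^{(ε)}(μ_a YX + ((a+1)/2)²) μ_a`. For `p = 2` it is given by
`B^{(0)}(0,1/2) = μ_0`, `B^{(1)}(0,1/2) = μ_0 YX`, `B^{(ε)}(1,0) = μ_1 YX`,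
`B^{(ε)}(1,1) = μ_1 YX + μ_1`. -/
def Bone (ε : Fin 2) (a : ℕ) (j : ℚ) : Hyp k :=
  if p = 2 then
    if a = 0 then
      if ε = 0 then mu k p 0 else mu k p 0 * dY k 1 * dX k 1
    else if j = 0 then mu k p 1 * dY k 1 * dX k 1
    else mu k p 1 * dY k 1 * dX k 1 + mu k p 1
  else
    aeval (mu k p a * dY k 1 * dX k 1
        + algebraMap k (Hyp k) (ZMod.castHom (dvd_refl p) k (halfSq p a)))
      ((psiEps p ε (j : ZMod p)).map (ZMod.castHom (dvd_refl p) k)) * mu k p a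

/-- `c` is a system of coefficients in an expansion
`B^{(ε)}(a,j) = μ_a ∑_{m = n^{(ε)}(a,j)}^{p-1} c_m Y^m X^m`. -/
def IsCoeff (ε : Fin 2) (a : ℕ) (j : ℚ) (c : ℕ → ZMod p) : Prop :=
  Bone k p ε a j = mu k p a * ∑ m ∈ Finset.Icc (nInt p ε a j) (p - 1),
    ZMod.castHom (dvd_refl p) k (c m) • (dY k 1 ^ m * dX k 1 ^ m)

open Classical in
/-- The coefficients `c_m^{(ε)} ∈ 𝔽_p` of the expansion
`B^{(ε)}(a,j) = μ_a ∑_{m = n^{(ε)}(a,j)}^{p-1} c_m^{(ε)} Y^m X^m`. -/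
def coeffB (ε : Fin 2) (a : ℕ) (j : ℚ) : ℕ → ZMod p :=
  if h : ∃ c, IsCoeff k p ε a j c then h.choose else 0

open Classical in
/-- `Z^{(ε)}(z; (a,j))`: it is `μ_a ∑_m c_m^{(ε)} Y^m X^{m-s(a,j)} Fr'(z) X^{s(a,j)}` under (A) or
(C), and `Fr'(z) B^{(ε)}(a,j)` for the other pairs of `𝒫`. -/
def Zel (ε : Fin 2) (a : ℕ) (j : ℚ) (z : Hyp k) : Hyp k :=
  if condA p a j ∨ condC a j then
    mu k p a * ∑ m ∈ Finset.Icc (nInt p ε a j) (p - 1),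
      ZMod.castHom (dvd_refl p) k (coeffB k p ε a j m) •
        (dY k 1 ^ m * dX k 1 ^ (m - sInt p a) * frobSection k p z * dX k 1 ^ sInt p a)
  else frobSection k p z * Bone k p ε a j

/-- `B^{(ε)}(a,j)` for `r`-tuples with `r ≥ 1` (the value for `r = 0` is not used). -/
def Bel : (r : ℕ) → (Fin r → Fin 2) → (Fin r → ℕ) → (Fin r → ℚ) → Hyp k
  | 0, _, _, _ => 1
  | 1, ε, a, j => Bone k p (ε 0) (a 0) (j 0)
  | r + 2, ε, a, j => Zel k p (ε 0) (a 0) (j 0)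
      (Bel (r + 1) (fun i => ε i.succ) (fun i => a i.succ) (fun i => j i.succ))

/-- The `𝒜_r`-module `𝒜_r · B^{(ε)}(a,j)`. -/
def AB {r : ℕ} (ε : Fin r → Fin 2) (a : Fin r → ℕ) (j : Fin r → ℚ) :
    Submodule (Ar k p r) (Hyp k) :=
  Submodule.span (Ar k p r) {Bel k p r ε a j}

/-- `S_{(a,j)} = 𝒜_r · B^{(τ)}(a,j)`. -/
def simpleS {r : ℕ} (a : Fin r → ℕ) (j : Fin r → ℚ) : Submodule (Ar k p r) (Hyp k) :=
  AB k p (tau p a j) a j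

end Elements

end SL2Hyper

end

set_option linter.unusedSectionVars false

namespace SL2Hyper

noncomputable section

/-! The elements B^(ε)(a,j), for all (a,j) ∈ 𝒫^r and ε ∈ 𝒳_r(a,j), form a k-basis of 𝒜_r and
multiply like squarefree monomials. Products for different (a,j) vanish; for a fixed (a,j), the
product of B^(ε) and B^(ε') is B^(ε+ε') if the supports are disjoint and 0 otherwise. So 𝒜_r is the
product over (a,j) of the algebras k[x_i : i free]/(x_i²). There rad^n is spanned by the monomials
of degree at least n, and M consists of the multiples of the monomial with support that of ε. If a
combination of monomials is killed by all monomials of degree at least n, it involves only monomials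
of degree greater than w - n: otherwise multiply it by the complement of a smallest monomial that
occurs. Hence both series of M are the filtration by degree, and the socle is the line of the top
monomial, which is S_(a,j). This part is purely formal (`IsMonomialFamily`).

The multiplication rules for one pair come from a commutative picture. The Cartan part of 𝒰 is the
algebra of k-valued functions on ℤ that are periodic modulo a power of p (`cartan`); there μ_a is
the indicator of the class of a modulo p, and Fr' is the pullback along N ↦ ⌊N/p⌋. Since Y^m X^m μ_a
= φ_{a,m}(YX) μ_a, one has φ_{a,p}(YX) μ_a = 0, and B^(ε)(a,j) = P^(ε)(YX) μ_a with P^(ε) mattering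
only modulo φ_{a,p}. The pair selects a root ρ of φ_{a,p}, double if the pair is free and simple
otherwise. P^(0) is the idempotent of the ρ-primary part, and for a free pair P^(1) has square zero
(`IsPairData`).

To pass to r pairs one needs Fr' to be multiplicative, which it is not. It becomes so after
multiplication by f(YX) μ_b if φ_{b,p} divides φ_{b,p-b} f, because the unwanted terms of the
commutation formula then die (`frobSection_mul`). Outside the exceptional cases (A) and (C) of the
definition of Z, the idempotent of the pair satisfies this. In those cases it does so after a twist
by Y^s on the left and X^s on the right, which moves the residue a to 0 or 1. Thus Z^(ε)(z)
Z^(ε')(z') = Z^(ε'')(zz') whenever P^(ε) P^(ε') ≡ P^(ε'') modulo φ_{a,p} (`Zel_mul_Zel`), and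
induction on r gives the rules.

That the family is a basis follows by counting. The rules and the non-vanishing of the top monomials
imply independence, there are p^{2r} elements, and the triangular decomposition bounds dim 𝒜_r by
p^{2r} (`toSubmodule_Ar_eq_level`). -/

theorem periodic_emod {α : Type*} {f : ℤ → α} {c : ℤ} (h : Function.Periodic f c) (N : ℤ) :
    f (N % c) = f N := by
  have := h.sub_zsmul_eq (x := N) (N / c)
  rw [← this]; congr 1
  rw [smul_eq_mul, Int.emod_def, mul_comm]

/-! ### Functions on the integers that are periodic modulo a power of `p` -/

section Periodic

variable (k : Type*) [Field k] (p : ℕ) [Fact p.Prime]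

/-- The `k`-valued functions on `ℤ` that are periodic modulo some power of `p`. -/
def PerFun : Subalgebra k (ℤ → k) where
  carrier := {f | ∃ r : ℕ, Function.Periodic f ((p : ℤ) ^ r)}
  mul_mem' := by
    rintro f g ⟨r, hf⟩ ⟨s, hg⟩
    refine ⟨r + s, fun N => ?_⟩
    have h1 := (hf.nat_mul (p ^ s)) N
    have h2 := (hg.nat_mul (p ^ r)) N
    push_cast at h1 h2
    rw [Pi.mul_apply, Pi.mul_apply, ← h1, ← h2]
    congr 2 <;> ring
  add_mem' := by
    rintro f g ⟨r, hf⟩ ⟨s, hg⟩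
    refine ⟨r + s, fun N => ?_⟩
    have h1 := (hf.nat_mul (p ^ s)) N
    have h2 := (hg.nat_mul (p ^ r)) N
    push_cast at h1 h2
    rw [Pi.add_apply, Pi.add_apply, ← h1, ← h2]
    congr 2 <;> ring
  algebraMap_mem' := fun c => ⟨0, fun N => rfl⟩

variable {k p}

theorem PerFun.ext {f g : PerFun k p} (h : ∀ N, f.1 N = g.1 N) : f = g := Subtype.ext (funext h)

-- In Vandermonde's expansion every term but one carries a factor (p^r choose l) with 0 < l < p^r,
-- which is divisible by p.
variable (k) in
theorem choose_add_prime_pow [CharP k p] (N : ℤ) {m r : ℕ} (h : m < p ^ r) :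
    ((Ring.choose (N + (p : ℤ) ^ r) m : ℤ) : k) = (Ring.choose N m : ℤ) := by
  rw [Ring.add_choose_eq _ (Commute.all _ _), Int.cast_sum,
    Finset.sum_eq_single (m, 0)]
  · simp
  · rintro ⟨i, l⟩ hil hne
    replace hil : i + l = m := Finset.HasAntidiagonal.mem_antidiagonal.1 hil
    have hl : l ≠ 0 := by rintro rfl; exact hne (by simpa using hil)
    have h2 : Ring.choose ((p : ℤ) ^ r) l = (((p ^ r).choose l : ℕ) : ℤ) := by
      rw [← Ring.choose_natCast]; push_cast; rfl
    have h3 : (((p ^ r).choose l : ℕ) : k) = 0 :=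
      (CharP.cast_eq_zero_iff k p _).2 ((Fact.out : p.Prime).dvd_choose_pow hl (by omega))
    rw [h2, Int.cast_mul, Int.cast_natCast, h3, mul_zero]
  · simp

variable (k p) in
/-- The function `N ↦ (N + c choose m)`. -/
def bin [CharP k p] (c : ℤ) (m : ℕ) : PerFun k p :=
  -- The exponent m is a wasteful but uniform choice, since m < p ^ m; `bin_periodic` gives the
  -- sharp period.
  ⟨fun N => ((Ring.choose (N + c) m : ℤ) : k), m, fun N => by
    have h := choose_add_prime_pow k (N + c) (Nat.lt_pow_self (Fact.out : p.Prime).one_lt : m < p ^ m)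
    change ((Ring.choose (N + _ + c) m : ℤ) : k) = _
    change _ = ((Ring.choose (N + c) m : ℤ) : k)
    rw [← h]; congr 2; ring⟩

theorem bin_apply [CharP k p] (c : ℤ) (m : ℕ) (N : ℤ) :
    (bin k p c m).1 N = ((Ring.choose (N + c) m : ℤ) : k) := rfl

theorem bin_periodic [CharP k p] (c : ℤ) {m r : ℕ} (h : m < p ^ r) :
    Function.Periodic (bin k p c m).1 ((p : ℤ) ^ r) := fun N => by
  rw [bin_apply, bin_apply, ← choose_add_prime_pow k (N + c) h]; congr 2; ring

theorem bin_zero [CharP k p] (c : ℤ) : bin k p c 0 = 1 := PerFun.ext fun N => by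
  rw [bin_apply, Ring.choose_zero_right]; simp

theorem bin_zero_natCast [CharP k p] (m n : ℕ) :
    (bin k p 0 m).1 (n : ℤ) = (n.choose m : k) := by
  rw [bin_apply, add_zero, Ring.choose_natCast]; simp

/-- A periodic function is the combination of binomial functions given by Newton's formula. -/
theorem periodic_eq_sum_bin [CharP k p] {f : PerFun k p} {r : ℕ}
    (hf : Function.Periodic f.1 ((p : ℤ) ^ r)) :
    f = ∑ n ∈ Finset.range (p ^ r), ((fwdDiff (1 : ℤ))^[n] f.1 0) • bin k p 0 n := by
  set g := ∑ n ∈ Finset.range (p ^ r), ((fwdDiff (1 : ℤ))^[n] f.1 0) • bin k p 0 n with hg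
  have hgv : ∀ N, g.1 N = ∑ n ∈ Finset.range (p ^ r),
      ((fwdDiff (1 : ℤ))^[n] f.1 0) * (bin k p 0 n).1 N := fun N => by
    have : g.1 = ∑ n ∈ Finset.range (p ^ r),
      (((fwdDiff (1 : ℤ))^[n] f.1 0) • bin k p 0 n : PerFun k p).1 := by
      rw [hg]; exact map_sum (PerFun k p).val _ _
    rw [this, Finset.sum_apply]; rfl
  have hgp : Function.Periodic g.1 ((p : ℤ) ^ r) := fun N => by
    rw [hgv, hgv]
    exact Finset.sum_congr rfl fun n hn => by rw [bin_periodic 0 (Finset.mem_range.1 hn) N]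
  have key : ∀ n < p ^ r, f.1 (n : ℤ) = g.1 (n : ℤ) := fun n hn => by
    have h := shift_eq_sum_fwdDiff_iter (1 : ℤ) f.1 n 0
    simp only [zero_add, nsmul_eq_mul, mul_one] at h
    rw [h, hgv]
    simp_rw [bin_zero_natCast, mul_comm]
    refine Finset.sum_subset (Finset.range_mono hn) fun i _ hi => ?_
    rw [Nat.choose_eq_zero_of_lt (by simpa using hi)]; simp
  have hpos : (0 : ℤ) < (p : ℤ) ^ r := by
    have := (Fact.out : p.Prime).pos
    positivity
  refine PerFun.ext fun N => ?_
  rw [← periodic_emod hf N, ← periodic_emod hgp N]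
  have h0 := Int.emod_nonneg N hpos.ne'
  have h1 := Int.emod_lt_of_pos N hpos
  obtain ⟨n, hn⟩ := Int.eq_ofNat_of_zero_le h0
  rw [hn]
  exact key n (by rw [hn] at h1; exact_mod_cast h1)

/-- Unitriangularity: evaluated at the least index n of the support, all other terms vanish because
(n choose m) = 0 for m > n. -/
theorem bin_linearIndependent [CharP k p] : LinearIndependent k (bin k p 0) := by
  rw [linearIndependent_iff]
  intro g hg
  by_contra hne
  have hs := Finsupp.support_nonempty_iff.2 hne
  obtain ⟨n, hn, hmin⟩ := Finset.exists_min_image g.support id hs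
  have h := congrArg (fun f : PerFun k p => f.1 (n : ℤ)) hg
  have h2 : (Finsupp.linearCombination k (bin k p 0) g).1 (n : ℤ)
      = ∑ m ∈ g.support, g m * (n.choose m : k) := by
    rw [Finsupp.linearCombination_apply, Finsupp.sum,
      show (∑ a ∈ g.support, g a • bin k p 0 a).1 = ∑ a ∈ g.support, (g a • bin k p 0 a).1 from
        map_sum (PerFun k p).val _ _, Finset.sum_apply]
    exact Finset.sum_congr rfl fun m _ => by
      rw [← bin_zero_natCast (k := k) (p := p)]; rfl
  replace h : (Finsupp.linearCombination k (bin k p 0) g).1 (n : ℤ) = 0 := h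
  rw [h2, Finset.sum_eq_single n] at h
  · simp at h
    exact Finsupp.mem_support_iff.1 hn h
  · intro m hm hmn
    have := hmin m hm
    simp only [id] at this
    rw [Nat.choose_eq_zero_of_lt (by omega)]; simp
  · exact fun h => absurd hn h

variable (k p) in
/-- The binomial functions form a basis of the algebra of periodic functions. -/
def binBasis [CharP k p] : Module.Basis ℕ k (PerFun k p) :=
  Module.Basis.mk bin_linearIndependent (by
    rintro f -
    obtain ⟨r, hr⟩ := f.2
    rw [periodic_eq_sum_bin hr]
    exact sum_mem fun n _ => Submodule.smul_mem _ _ (Submodule.subset_span ⟨n, rfl⟩))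

theorem binBasis_apply [CharP k p] (n : ℕ) : binBasis k p n = bin k p 0 n :=
  Module.Basis.mk_apply _ _ _

/-- Translation of functions, `f ↦ f(· + c)`. -/
def shift (c : ℤ) : PerFun k p →ₐ[k] PerFun k p where
  toFun f := ⟨fun N => f.1 (N + c), f.2.imp fun r hr N => by
    change f.1 (N + _ + c) = f.1 (N + c)
    rw [add_right_comm]; exact hr _⟩
  map_one' := rfl
  map_mul' _ _ := rfl
  map_zero' := rfl
  map_add' _ _ := rfl
  commutes' _ := rfl

theorem shift_apply (c : ℤ) (f : PerFun k p) (N : ℤ) : (shift c f).1 N = f.1 (N + c) := rfl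

theorem shift_shift (c d : ℤ) (f : PerFun k p) : shift c (shift d f) = shift (c + d) f :=
  PerFun.ext fun N => by simp only [shift_apply, add_assoc]

theorem shift_zero (f : PerFun k p) : shift 0 f = f :=
  PerFun.ext fun N => by simp only [shift_apply, add_zero]

theorem shift_bin [CharP k p] (c d : ℤ) (m : ℕ) : shift c (bin k p d m) = bin k p (c + d) m :=
  PerFun.ext fun N => by simp only [shift_apply, bin_apply, add_assoc]

/-- The algebra endomorphism `f ↦ f(⌊· / p⌋)`. -/
def pull : PerFun k p →ₐ[k] PerFun k p where
  toFun f := ⟨fun N => f.1 (N / p), f.2.imp' (· + 1) fun r hr N => by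
    have hp : (p : ℤ) ≠ 0 := by exact_mod_cast (Fact.out : p.Prime).ne_zero
    change f.1 _ = f.1 _
    rw [pow_succ, Int.add_mul_ediv_right _ _ hp]; exact hr _⟩
  map_one' := rfl
  map_mul' _ _ := rfl
  map_zero' := rfl
  map_add' _ _ := rfl
  commutes' _ := rfl

theorem pull_apply (f : PerFun k p) (N : ℤ) : (pull f).1 N = f.1 (N / p) := rfl

/-- The indicator function of the residue class of `b` modulo `p`. -/
def ind (b : ℤ) : PerFun k p :=
  ⟨fun N => if (N : ZMod p) = b then 1 else 0, 1, fun N => by simp⟩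

theorem ind_apply (b N : ℤ) :
    (ind b : PerFun k p).1 N = if (N : ZMod p) = b then 1 else 0 := rfl

theorem shift_ind (c b : ℤ) : shift c (ind b : PerFun k p) = ind (b - c) :=
  PerFun.ext fun N => by
    simp only [shift_apply, ind_apply, Int.cast_add, Int.cast_sub, eq_sub_iff_add_eq]

theorem ind_congr {b c : ℤ} (h : (b : ZMod p) = c) : (ind b : PerFun k p) = ind c :=
  PerFun.ext fun N => by simp only [ind_apply, h]

theorem ind_mul_ind (b c : ℤ) : (ind b : PerFun k p) * ind c = if (b : ZMod p) = c then ind b else 0 :=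
  PerFun.ext fun N => by
    change (ind b : PerFun k p).1 N * (ind c : PerFun k p).1 N = _
    rw [ind_apply, ind_apply]
    split_ifs with h1 h2 h3 h4
    · rw [ind_apply, if_pos h1, mul_one]
    · exact absurd (h1.symm.trans h2) h3
    · exact absurd (h1.trans h4) h2
    · simp
    · rw [ind_apply, if_neg h1, zero_mul]
    · rw [zero_mul]; rfl
    · rw [ind_apply, if_neg h1, zero_mul]
    · rw [zero_mul]; rfl

/-- Lucas' theorem for integers. -/
theorem choose_mul_add [CharP k p] (N : ℤ) (n : ℕ) {i : ℕ} (hi : i < p) :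
    ((Ring.choose N (n * p + i) : ℤ) : k)
      = (Ring.choose (N / p) n : ℤ) * (Ring.choose (N % p) i : ℤ) := by
  have hpp : p.Prime := Fact.out
  have hp : (p : ℤ) ≠ 0 := by exact_mod_cast hpp.ne_zero
  set r := n * p + i with hr
  -- Both sides are periodic in N modulo p ^ (r + 1), which reduces the claim to natural N and the
  -- classical theorem.
  have h1 : r < p ^ (r + 1) := (Nat.lt_pow_self hpp.one_lt).trans_le (Nat.pow_le_pow_right hpp.pos r.le_succ)
  have h2 : n < p ^ r := by
    have : n ≤ r := by rw [hr]; nlinarith [hpp.one_lt]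
    exact this.trans_lt (Nat.lt_pow_self hpp.one_lt)
  have P1 : Function.Periodic (fun N : ℤ => ((Ring.choose N (n * p + i) : ℤ) : k))
      ((p : ℤ) ^ (r + 1)) := fun N => choose_add_prime_pow k N h1
  have P2 : Function.Periodic (fun N : ℤ => ((Ring.choose (N / p) n : ℤ) : k) *
      (Ring.choose (N % p) i : ℤ)) ((p : ℤ) ^ (r + 1)) := fun N => by
    simp only
    rw [pow_succ, Int.add_mul_ediv_right _ _ hp, Int.add_mul_emod_self_right,
      choose_add_prime_pow k _ h2]
  have hpos : (0 : ℤ) < (p : ℤ) ^ (r + 1) := by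
    have := hpp.pos
    positivity
  have e1 := periodic_emod P1 N
  have e2 := periodic_emod P2 N
  beta_reduce at e1 e2
  rw [← e1, ← e2]
  obtain ⟨m, hm⟩ := Int.eq_ofNat_of_zero_le (Int.emod_nonneg N hpos.ne')
  rw [hm]
  have h3 : ((m : ℤ) / p) = ((m / p : ℕ) : ℤ) := by push_cast; rfl
  have h4 : ((m : ℤ) % p) = ((m % p : ℕ) : ℤ) := by push_cast; rfl
  rw [h3, h4, Ring.choose_natCast, Ring.choose_natCast, Ring.choose_natCast]
  have h5 := Choose.choose_modEq_choose_mod_mul_choose_div (n := m) (k := n * p + i) (p := p)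
  rw [add_comm (n * p) i, Nat.add_mul_mod_self_right, Nat.mod_eq_of_lt hi,
    Nat.add_mul_div_right _ _ hpp.pos, Nat.div_eq_of_lt hi, zero_add, add_comm i] at h5
  have h6 := (CharP.intCast_eq_intCast k p).2 h5
  push_cast at h6 ⊢
  rw [h6, mul_comm]

/-- By Lucas' theorem. This identifies Fr' on the Cartan part with an algebra endomorphism of
functions. -/
theorem pull_bin [CharP k p] (n : ℕ) : pull (bin k p 0 n) = bin k p 0 (n * p) :=
  PerFun.ext fun N => by
    have h := choose_mul_add (k := k) (p := p) N n (Fact.out : p.Prime).pos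
    simp only [add_zero, Ring.choose_zero_right] at h
    rw [pull_apply, bin_apply, bin_apply, add_zero, add_zero, h]; simp

/-- By Lucas only the last digit of N - a - 1 matters, and (m choose p-1) is nonzero for a digit m
only if m = p - 1, that is N ≡ a. So μ_a is the idempotent of a residue class. -/
theorem bin_pred_eq_ind [CharP k p] (a : ℤ) : bin k p (-a - 1) (p - 1) = ind a :=
  PerFun.ext fun N => by
    have hpp : p.Prime := Fact.out
    have h := choose_mul_add (k := k) (p := p) (N + (-a - 1)) 0 (i := p - 1) (by have := hpp.pos; omega)
    rw [zero_mul, zero_add, Ring.choose_zero_right] at h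
    rw [bin_apply, ind_apply, h]
    have hpos : (0 : ℤ) < p := by exact_mod_cast hpp.pos
    have h0 := Int.emod_nonneg (N + (-a - 1)) hpos.ne'
    have h1 := Int.emod_lt_of_pos (N + (-a - 1)) hpos
    have hiff : ((N : ZMod p) = a) ↔ (N + (-a - 1)) % p = p - 1 := by
      rw [ZMod.intCast_eq_intCast_iff_dvd_sub]
      constructor
      · rintro ⟨c, hc⟩
        have e : N + (-a - 1) = (p - 1) + p * (-c - 1) := by linarith
        rw [e, Int.add_mul_emod_self_left, Int.emod_eq_of_lt] <;> omega
      · intro h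
        have := Int.emod_add_mul_ediv (N + (-a - 1)) p
        exact ⟨-((N + (-a - 1)) / p) - 1, by rw [h] at this; linarith⟩
    obtain ⟨m, hm⟩ := Int.eq_ofNat_of_zero_le h0
    rw [hm] at h1 hiff ⊢
    rw [Ring.choose_natCast]
    split_ifs with h2
    · have : m = p - 1 := by have := hiff.1 h2; omega
      rw [this]; simp
    · have : m < p - 1 := by
        have h3 : (m : ℤ) ≠ p - 1 := fun h => h2 (hiff.2 h)
        omega
      rw [Nat.choose_eq_zero_of_lt this]; simp

end Periodic

end

end SL2Hyper

namespace SL2Hyper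

noncomputable section

attribute [local instance 100] LieRing.ofAssociativeRing

/-! ### The Cartan part of the hyperalgebra as an algebra of functions -/

theorem ev_dpY (a : ℕ) (f : ℂ[X]) :
    ev f * dp eY a = dp eY a * ev (f.comp (X - C ((2 * a : ℤ) : ℂ))) := by
  have : ∀ a : ℕ, ev f * eY ^ a = eY ^ a * ev (f.comp (X - C ((2 * a : ℤ) : ℂ))) := by
    intro a
    induction a with
    | zero => simp
    | succ a ih =>
      rw [pow_succ, ← mul_assoc, ih, mul_assoc, ev_eY, ← mul_assoc, comp_assoc]
      congr 3
      simp only [sub_comp, X_comp, C_comp]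
      push_cast
      simp only [mul_add, C_add, mul_one]
      ring
  rw [dp, mul_smul_comm, this, smul_mul_assoc]

section Cartan

variable {k : Type*} [Field k] {p : ℕ} [Fact p.Prime] [CharP k p]

variable (k p) in
/-- The linear map from periodic functions to the hyperalgebra with `(· choose n) ↦ (H choose n)`. -/
def cartanLin : PerFun k p →ₗ[k] Hyp k := (binBasis k p).constr k fun n => dH k 0 n

theorem cartanLin_bin_zero (n : ℕ) : cartanLin k p (bin k p 0 n) = dH k 0 n := by
  rw [cartanLin, ← binBasis_apply, Module.Basis.constr_basis]

/-- The same integral Newton coefficients expand f in 𝒰_ℤ and its reduced values F among functions.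
Hence identities in the Cartan part of the hyperalgebra can be checked on values at integers. -/
theorem cartanLin_eq_img {f : ℂ[X]} (hf : IV f) (F : PerFun k p)
    (hF : ∀ N w : ℤ, f.eval (N : ℂ) = w → F.1 N = (w : k)) :
    cartanLin k p F = img k ⟨ev f, hf.mem⟩ := by
  obtain ⟨w, hw⟩ := hf.newton
  have h1 : F = ∑ i ∈ Finset.range (f.natDegree + 1), (w i : k) • bin k p 0 i := by
    refine PerFun.ext fun N => ?_
    have h2 : f.eval (N : ℂ) = (∑ i ∈ Finset.range (f.natDegree + 1), w i * Ring.choose N i : ℤ) := by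
      conv_lhs => rw [hw]
      rw [eval_finsetSum]
      push_cast
      refine Finset.sum_congr rfl fun i _ => ?_
      rw [eval_smul, binPoly_eval, add_zero, smul_eq_mul]
    rw [hF N _ h2, show (∑ i ∈ Finset.range (f.natDegree + 1), (w i : k) • bin k p 0 i).1
      = ∑ i ∈ Finset.range (f.natDegree + 1), ((w i : k) • bin k p 0 i).1 from
        map_sum (PerFun k p).val _ _, Finset.sum_apply]
    push_cast
    refine Finset.sum_congr rfl fun i _ => ?_
    change _ = (w i : k) * (bin k p 0 i).1 N
    rw [bin_apply, add_zero]
  have h3 : (⟨ev f, hf.mem⟩ : UZ) = ∑ i ∈ Finset.range (f.natDegree + 1),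
      w i • (⟨binH 0 i, binH_mem 0 i⟩ : UZ) := by
    apply Subtype.ext
    rw [show ((∑ i ∈ Finset.range (f.natDegree + 1), w i • (⟨binH 0 i, binH_mem 0 i⟩ : UZ) : UZ) : UC)
      = ∑ i ∈ Finset.range (f.natDegree + 1), ((w i • (⟨binH 0 i, binH_mem 0 i⟩ : UZ) : UZ) : UC) from
      map_sum UZ.val _ _]
    refine (congrArg ev hw).trans ?_
    rw [ev, map_sum]
    refine Finset.sum_congr rfl fun i _ => ?_
    rw [map_smul, int_smul_UC]; rfl
  rw [h1, h3, map_sum, map_sum]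
  refine Finset.sum_congr rfl fun i _ => ?_
  rw [map_smul, cartanLin_bin_zero, map_zsmul, Int.cast_smul_eq_zsmul]
  rfl

theorem cartanLin_mul (F G : PerFun k p) :
    cartanLin k p (F * G) = cartanLin k p F * cartanLin k p G := by
  have key : ((LinearMap.mul k (PerFun k p)).compr₂ (cartanLin k p)) =
      (LinearMap.mul k (Hyp k)).compl₁₂ (cartanLin k p) (cartanLin k p) := by
    refine (binBasis k p).ext fun m => (binBasis k p).ext fun n => ?_
    simp only [binBasis_apply, LinearMap.compr₂_apply, LinearMap.mul_apply',
      LinearMap.compl₁₂_apply, cartanLin_bin_zero]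
    rw [cartanLin_eq_img ((IV_binPoly 0 m).mul (IV_binPoly 0 n)), dH, dH, ← map_mul]
    · congr 1
      exact Subtype.ext (map_mul _ _ _)
    · intro N w hw
      rw [eval_mul, binPoly_eval, binPoly_eval, add_zero] at hw
      change (bin k p 0 m).1 N * (bin k p 0 n).1 N = _
      rw [bin_apply, bin_apply, add_zero]
      exact_mod_cast congrArg (Int.cast : ℤ → k) (by exact_mod_cast hw)
  exact LinearMap.congr_fun (LinearMap.congr_fun key F) G

theorem dH_zero (c : ℤ) : dH k c 0 = 1 := by
  rw [dH, ← map_one (img k)]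
  congr 1
  exact Subtype.ext (by simp [binH, binPoly_zero])

variable (k p) in
/-- The homomorphism from periodic functions to the hyperalgebra with
`(· choose n) ↦ (H choose n)`. -/
def cartan : PerFun k p →ₐ[k] Hyp k :=
  AlgHom.ofLinearMap (cartanLin k p)
    (by rw [← bin_zero (k := k) (p := p) 0, cartanLin_bin_zero, dH_zero]) cartanLin_mul

theorem cartan_eq_img {f : ℂ[X]} (hf : IV f) (F : PerFun k p)
    (hF : ∀ N w : ℤ, f.eval (N : ℂ) = w → F.1 N = (w : k)) :
    cartan k p F = img k ⟨ev f, hf.mem⟩ := cartanLin_eq_img hf F hF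

theorem cartan_bin (c : ℤ) (n : ℕ) : cartan k p (bin k p c n) = dH k c n :=
  cartan_eq_img (IV_binPoly c n) _ fun N w hw => by
    rw [binPoly_eval] at hw
    rw [bin_apply]
    exact_mod_cast congrArg (Int.cast : ℤ → k) (by exact_mod_cast hw)

theorem mu_eq_cartan (a : ℤ) : mu k p a = cartan k p (ind a) := by
  rw [mu, ← cartan_bin (p := p), bin_pred_eq_ind]

variable (p) in
theorem dX_mul_cartan (m : ℕ) (F : PerFun k p) :
    dX k m * cartan k p F = cartan k p (shift (-2 * m) F) * dX k m := by
  have key : LinearMap.mulLeft k (dX k m) ∘ₗ (cartan k p).toLinearMap =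
      LinearMap.mulRight k (dX k m) ∘ₗ (cartan k p).toLinearMap ∘ₗ
        (shift (-2 * m)).toLinearMap := by
    refine (binBasis k p).ext fun n => ?_
    simp only [binBasis_apply, LinearMap.comp_apply, LinearMap.mulLeft_apply,
      LinearMap.mulRight_apply, AlgHom.toLinearMap_apply]
    rw [cartan_bin, shift_bin, cartan_bin, dX, dH, dH, ← map_mul, ← map_mul]
    congr 1
    apply Subtype.ext
    change dp eX m * ev (binPoly 0 n) = ev (binPoly _ n) * dp eX m
    rw [eX_pow_ev, binPoly_comp]
    congr 3; ring
  exact LinearMap.congr_fun key F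

theorem cartan_mul_dY (m : ℕ) (F : PerFun k p) :
    cartan k p F * dY k m = dY k m * cartan k p (shift (-2 * m) F) := by
  have key : LinearMap.mulRight k (dY k m) ∘ₗ (cartan k p).toLinearMap =
      LinearMap.mulLeft k (dY k m) ∘ₗ (cartan k p).toLinearMap ∘ₗ
        (shift (-2 * m)).toLinearMap := by
    refine (binBasis k p).ext fun n => ?_
    simp only [binBasis_apply, LinearMap.comp_apply, LinearMap.mulLeft_apply,
      LinearMap.mulRight_apply, AlgHom.toLinearMap_apply]
    rw [cartan_bin, shift_bin, cartan_bin, dY, dH, dH, ← map_mul, ← map_mul]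
    congr 1
    apply Subtype.ext
    change ev (binPoly 0 n) * dp eY m = dp eY m * ev (binPoly _ n)
    rw [ev_dpY, binPoly_comp]
    congr 3; ring
  exact LinearMap.congr_fun key F

theorem cartan_mul_dX (m : ℕ) (F : PerFun k p) :
    cartan k p F * dX k m = dX k m * cartan k p (shift (2 * m) F) := by
  rw [dX_mul_cartan, shift_shift, show (-2 * m + 2 * m : ℤ) = 0 by ring, shift_zero]

theorem dY_mul_cartan (m : ℕ) (F : PerFun k p) :
    dY k m * cartan k p F = cartan k p (shift (2 * m) F) * dY k m := by
  rw [cartan_mul_dY, shift_shift, show (-2 * m + 2 * m : ℤ) = 0 by ring, shift_zero]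

theorem dX_mul_dX (m n : ℕ) : dX k m * dX k n = ((m + n).choose m : k) • dX k (m + n) := by
  rw [dX, dX, dX, ← map_mul, Nat.cast_smul_eq_nsmul, ← map_nsmul]
  congr 1
  apply Subtype.ext
  change dp eX m * dp eX n = _ • dp eX (m + n)
  rw [dp_mul, Nat.cast_smul_eq_nsmul]

theorem dY_mul_dY (m n : ℕ) : dY k m * dY k n = ((m + n).choose m : k) • dY k (m + n) := by
  rw [dY, dY, dY, ← map_mul, Nat.cast_smul_eq_nsmul, ← map_nsmul]
  congr 1
  apply Subtype.ext
  change dp eY m * dp eY n = _ • dp eY (m + n)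
  rw [dp_mul, Nat.cast_smul_eq_nsmul]

theorem dX_zero : dX k 0 = 1 := by
  rw [dX, ← map_one (img k)]; congr 1; exact Subtype.ext (dp_zero _)

theorem dY_zero : dY k 0 = 1 := by
  rw [dY, ← map_one (img k)]; congr 1; exact Subtype.ext (dp_zero _)

theorem dX_one_pow (m : ℕ) : dX k 1 ^ m = (m.factorial : k) • dX k m := by
  induction m with
  | zero => simp [dX_zero]
  | succ m ih =>
    rw [pow_succ, ih, smul_mul_assoc, dX_mul_dX, smul_smul, Nat.factorial_succ]
    congr 1
    rw [Nat.choose_symm_add]; push_cast [Nat.choose_one_right]; ring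

theorem dY_one_pow (m : ℕ) : dY k 1 ^ m = (m.factorial : k) • dY k m := by
  induction m with
  | zero => simp [dY_zero]
  | succ m ih =>
    rw [pow_succ, ih, smul_mul_assoc, dY_mul_dY, smul_smul, Nat.factorial_succ]
    congr 1
    rw [Nat.choose_symm_add]; push_cast [Nat.choose_one_right]; ring

-- Kostant's commutation formula, carried over from the ℤ-form. Stopping at min m n drops the terms
-- that `dpz` made zero through negative exponents.
variable (p) in
theorem dX_mul_dY (m n : ℕ) : dX k m * dY k n = ∑ l ∈ Finset.range (min m n + 1),
    dY k (n - l) * cartan k p (bin k p (2 * l - m - n) l) * dX k (m - l) := by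
  have h1 : (⟨dp eX m, dpX_mem m⟩ * ⟨dp eY n, dpY_mem n⟩ : UZ) =
      ∑ l ∈ Finset.range (min m n + 1), ⟨dp eY (n - l), dpY_mem _⟩ *
        ⟨binH (2 * l - m - n) l, binH_mem _ _⟩ * ⟨dp eX (m - l), dpX_mem _⟩ := by
    apply Subtype.ext
    rw [show ∀ f : ℕ → UZ, ((∑ l ∈ Finset.range (min m n + 1), f l : UZ) : UC)
      = ∑ l ∈ Finset.range (min m n + 1), (f l : UC) from fun f => map_sum UZ.val _ _]
    have h := comm_formula m n
    have hn : dpz eY (n : ℤ) = dp eY n := by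
      rw [dpz, if_neg (by omega), Int.toNat_natCast]
    rw [hn] at h
    change dp eX m * dp eY n = _
    rw [h]
    symm
    have : Finset.range (min m n + 1) ⊆ Finset.range (m + 1) := Finset.range_mono (by omega)
    rw [← Finset.sum_subset this]
    · refine Finset.sum_congr rfl fun l hl => ?_
      have hl := Finset.mem_range.1 hl
      have e : dpz eY ((n : ℤ) - l) = dp eY (n - l) := by
        rw [dpz, if_neg (by omega)]; congr 1; omega
      rw [e]
      change dp eY (n - l) * ev _ * dp eX (m - l) = _
      congr 4; ring
    · intro l hl hl2
      rw [Finset.mem_range] at hl hl2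
      rw [dpz, if_pos (by omega)]; simp
  have h2 := congrArg (img k) h1
  rw [map_mul, map_sum] at h2
  refine h2.trans (Finset.sum_congr rfl fun l _ => ?_)
  rw [map_mul, map_mul, cartan_bin]; rfl

end Cartan

end

end SL2Hyper

namespace SL2Hyper

noncomputable section

/-! ### Triangular decomposition -/

section Triangular

variable {k : Type*} [Field k] {p : ℕ} [Fact p.Prime] [CharP k p]

/-- The element `Y^(u) F X^(v)`. -/
def tri (u : ℕ) (F : PerFun k p) (v : ℕ) : Hyp k := dY k u * cartan k p F * dX k v

theorem tri_add (u v : ℕ) (F G : PerFun k p) : tri u (F + G) v = tri u F v + tri u G v := by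
  rw [tri, tri, tri, map_add, mul_add, add_mul]

theorem tri_smul (u v : ℕ) (c : k) (F : PerFun k p) : tri u (c • F) v = c • tri u F v := by
  rw [tri, tri, map_smul, mul_smul_comm, smul_mul_assoc]

variable (k p) in
/-- `Y^(u) F X^(v)` as a linear function of `F`. -/
def triLin (u v : ℕ) : PerFun k p →ₗ[k] Hyp k where
  toFun F := tri u F v
  map_add' := tri_add u v
  map_smul' := tri_smul u v

theorem monBasis_eq_tri (w : ℕ × ℕ × ℕ) : monBasis k w = tri w.1 (bin k p 0 w.2.1) w.2.2 := by
  rw [monBasis_apply, tri, cartan_bin]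

variable (p) in
@[elab_as_elim]
theorem tri_induction {P : Hyp k → Prop} (zero : P 0) (add : ∀ x y, P x → P y → P (x + y))
    (smul : ∀ (c : k) x, P x → P (c • x)) (of_tri : ∀ u (F : PerFun k p) v, P (tri u F v))
    (z : Hyp k) : P z := by
  have hz : z ∈ Submodule.span k (Set.range (monBasis k)) := by
    rw [(monBasis k).span_eq]; trivial
  induction hz using Submodule.span_induction with
  | mem x hx =>
    obtain ⟨w, rfl⟩ := hx
    rw [monBasis_eq_tri (p := p)]
    exact of_tri _ _ _
  | zero => exact zero
  | add x y _ _ hx hy => exact add x y hx hy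
  | smul c x _ hx => exact smul c x hx

-- Allows multiplicativity of Fr' to be checked with a single divided power as the left factor.
variable (k) in
theorem adjoin_dX_dY :
    Algebra.adjoin k (Set.range (dX k) ∪ Set.range (dY k)) = ⊤ := by
  have key : ∀ u : UC, ∀ hu : u ∈ UZ,
      img k ⟨u, hu⟩ ∈ Algebra.adjoin k (Set.range (dX k) ∪ Set.range (dY k)) := by
    intro u hu
    induction hu using Algebra.adjoin_induction with
    | mem x hx =>
      rcases hx with ⟨m, rfl⟩ | ⟨m, rfl⟩
      · exact Algebra.subset_adjoin (Or.inl ⟨m, rfl⟩)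
      · exact Algebra.subset_adjoin (Or.inr ⟨m, rfl⟩)
    | algebraMap r =>
      have : img k ⟨algebraMap ℤ UC r, Subalgebra.algebraMap_mem _ r⟩ = (r : Hyp k) := by
        rw [show (⟨algebraMap ℤ UC r, Subalgebra.algebraMap_mem _ r⟩ : UZ) = (r : UZ) from rfl,
          map_intCast]
      rw [this]
      exact intCast_mem _ r
    | add x y hx hy h1 h2 =>
      have : img k ⟨x + y, add_mem hx hy⟩ = img k ⟨x, hx⟩ + img k ⟨y, hy⟩ := (map_add (img k) _ _).symm ▸ rfl
      rw [this]; exact add_mem h1 h2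
    | mul x y hx hy h1 h2 =>
      have : img k ⟨x * y, mul_mem hx hy⟩ = img k ⟨x, hx⟩ * img k ⟨y, hy⟩ := (map_mul (img k) _ _).symm ▸ rfl
      rw [this]; exact mul_mem h1 h2
  refine eq_top_iff.2 fun z _ => ?_
  have hz : z ∈ Submodule.span k (Set.range (monBasis k)) := by
    rw [(monBasis k).span_eq]; trivial
  refine (Submodule.span_le (p := Subalgebra.toSubmodule (Algebra.adjoin k _))).2 ?_ hz
  rintro _ ⟨w, rfl⟩
  rw [monBasis_apply, SetLike.mem_coe, Subalgebra.mem_toSubmodule]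
  exact mul_mem (mul_mem (key _ _) (key _ _)) (key _ _)

variable (k p) in
/-- The linear form `Y^(u') F X^(v') ↦ δ_{u u'} δ_{v v'} F(N)`. -/
def triCoeff (u v : ℕ) (N : ℤ) : Hyp k →ₗ[k] k :=
  (monBasis k).constr k fun w => if w.1 = u ∧ w.2.2 = v then (bin k p 0 w.2.1).1 N else 0

theorem triCoeff_tri (u v u' v' : ℕ) (N : ℤ) (F : PerFun k p) :
    triCoeff k p u v N (tri u' F v') = if u' = u ∧ v' = v then F.1 N else 0 := by
  have key : triCoeff k p u v N ∘ₗ triLin k p u' v' =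
      if u' = u ∧ v' = v then (LinearMap.proj N) ∘ₗ (PerFun k p).val.toLinearMap else 0 := by
    refine (binBasis k p).ext fun n => ?_
    rw [binBasis_apply, LinearMap.comp_apply]
    have : triLin k p u' v' (bin k p 0 n) = monBasis k (u', n, v') :=
      (monBasis_eq_tri (p := p) (u', n, v')).symm
    rw [this, triCoeff, Module.Basis.constr_basis]
    split_ifs <;> rfl
  have h := LinearMap.congr_fun key F
  rw [LinearMap.comp_apply] at h
  refine h.trans ?_
  split_ifs <;> rfl

-- Among the basis vectors occurring in z take one with least middle index n; at N = n the other
-- functions (· choose n') with the same u and v vanish, so its coefficient is isolated.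
variable (p) in
theorem eq_zero_of_triCoeff {z : Hyp k} (h : ∀ u v N : ℕ, triCoeff k p u v (N : ℤ) z = 0) :
    z = 0 := by
  by_contra hne
  have h0 : (monBasis k).repr z ≠ 0 := by simpa using hne
  obtain ⟨w, hw, hmin⟩ := Finset.exists_min_image ((monBasis k).repr z).support (fun w => w.2.1)
    (Finsupp.support_nonempty_iff.2 h0)
  have h1 := h w.1 w.2.2 w.2.1
  rw [triCoeff, Module.Basis.constr_apply, Finsupp.sum, Finset.sum_eq_single w] at h1
  · rw [if_pos ⟨rfl, rfl⟩, bin_zero_natCast] at h1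
    simp at h1
    exact Finsupp.mem_support_iff.1 hw h1
  · intro v hv hvw
    split_ifs with h2
    · have h3 := hmin v hv
      have h4 : v.2.1 ≠ w.2.1 := fun h => hvw (Prod.ext h2.1 (Prod.ext h h2.2))
      rw [bin_zero_natCast, Nat.choose_eq_zero_of_lt (by omega)]; simp
    · rw [smul_zero]
  · exact fun h => absurd hw h

/-- A description of Fr' free of the binomial basis: it acts on the function in the middle by an
algebra map. -/
theorem frobSection_tri (u v : ℕ) (F : PerFun k p) :
    frobSection k p (tri u F v) = tri (u * p) (pull F) (v * p) := by
  have key : frobSection k p ∘ₗ triLin k p u v =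
      triLin k p (u * p) (v * p) ∘ₗ pull.toLinearMap := by
    refine (binBasis k p).ext fun n => ?_
    rw [binBasis_apply, LinearMap.comp_apply, LinearMap.comp_apply]
    have : triLin k p u v (bin k p 0 n) = monBasis k (u, n, v) :=
      (monBasis_eq_tri (p := p) (u, n, v)).symm
    rw [this, frobSection, Module.Basis.constr_basis, AlgHom.toLinearMap_apply, pull_bin]
    simp only [triLin, LinearMap.coe_mk, AddHom.coe_mk, tri, cartan_bin]
  exact LinearMap.congr_fun key F

theorem frobSection_one : frobSection k p 1 = 1 := by
  have h1 : (1 : Hyp k) = tri 0 (1 : PerFun k p) 0 := by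
    rw [tri, dY_zero, dX_zero, map_one, mul_one, mul_one]
  conv_lhs => rw [h1, frobSection_tri, map_one, zero_mul]
  exact h1.symm

/-- Multiplication of triangular elements. -/
theorem dX_mul_tri (m u v : ℕ) (F : PerFun k p) :
    dX k m * tri u F v = ∑ l ∈ Finset.range (min m u + 1), ((m - l + v).choose (m - l) : k) •
      tri (u - l) (bin k p (2 * l - m - u) l * shift (-2 * (m - l : ℕ)) F) (m - l + v) := by
  rw [tri, ← mul_assoc, ← mul_assoc, dX_mul_dY p, Finset.sum_mul, Finset.sum_mul]
  refine Finset.sum_congr rfl fun l _ => ?_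
  rw [mul_assoc _ (dX k (m - l)), dX_mul_cartan, ← mul_assoc, mul_assoc _ (dX k (m - l)), dX_mul_dX,
    mul_smul_comm, mul_assoc (dY k _), ← map_mul, tri]

theorem dY_mul_tri (m u v : ℕ) (F : PerFun k p) :
    dY k m * tri u F v = ((m + u).choose m : k) • tri (m + u) F v := by
  rw [tri, tri, ← mul_assoc, ← mul_assoc, dY_mul_dY, smul_mul_assoc, smul_mul_assoc]

theorem cartan_mul_tri (G : PerFun k p) (u v : ℕ) (F : PerFun k p) :
    cartan k p G * tri u F v = tri u (shift (-2 * u) G * F) v := by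
  rw [tri, tri, ← mul_assoc, ← mul_assoc, cartan_mul_dY, mul_assoc (dY k u), ← map_mul]

/-! ### The elements `YX` and `μ_a` -/

variable (k) in
/-- The element `YX`. -/
def yx : Hyp k := dY k 1 * dX k 1

theorem dY_mul_dX_mul_cartan (m : ℕ) (F : PerFun k p) :
    dY k m * dX k m * cartan k p F = cartan k p F * (dY k m * dX k m) := by
  rw [mul_assoc, dX_mul_cartan, ← mul_assoc, ← mul_assoc, cartan_mul_dY]

theorem yx_commute_cartan (F : PerFun k p) : Commute (yx k) (cartan k p F) :=
  dY_mul_dX_mul_cartan 1 F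

theorem aeval_yx_commute_cartan (f : k[X]) (F : PerFun k p) :
    Commute (aeval (yx k) f) (cartan k p F) := by
  have := yx_commute_cartan F
  induction f using Polynomial.induction_on' with
  | add f g hf hg => rw [map_add]; exact hf.add_left hg
  | monomial n a =>
    rw [aeval_monomial]
    exact (Algebra.commute_algebraMap_left _ _).mul_left (this.pow_left n)

/-- Multiplication by the indicator μ_b forgets the values outside the class of b. -/
theorem cartan_mul_mu {F G : PerFun k p} {b : ℤ}
    (h : ∀ N : ℤ, (N : ZMod p) = b → F.1 N = G.1 N) :
    cartan k p F * mu k p b = cartan k p G * mu k p b := by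
  rw [mu_eq_cartan, ← map_mul, ← map_mul]
  congr 1
  refine PerFun.ext fun N => ?_
  change F.1 N * (ind b : PerFun k p).1 N = G.1 N * (ind b : PerFun k p).1 N
  rw [ind_apply]
  split_ifs with hN
  · rw [h N hN]
  · simp

theorem mu_mul_mu (b c : ℤ) :
    mu k p b * mu k p c = if (b : ZMod p) = c then mu k p b else 0 := by
  rw [mu_eq_cartan, mu_eq_cartan, ← map_mul, ind_mul_ind]
  split_ifs <;> simp

theorem mu_mul_self (b : ℤ) : mu k p b * mu k p b = mu k p b := by rw [mu_mul_mu, if_pos rfl]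

theorem mu_congr {b c : ℤ} (h : (b : ZMod p) = c) : mu k p b = mu k p c := by
  rw [mu_eq_cartan, mu_eq_cartan, ind_congr h]

theorem dX_mul_mu (m : ℕ) (b : ℤ) : dX k m * mu k p b = mu k p (b + 2 * m) * dX k m := by
  rw [mu_eq_cartan, dX_mul_cartan, shift_ind, mu_eq_cartan]
  congr 3; ring

theorem mu_mul_dY (m : ℕ) (b : ℤ) : mu k p b * dY k m = dY k m * mu k p (b + 2 * m) := by
  rw [mu_eq_cartan, cartan_mul_dY, shift_ind, mu_eq_cartan]
  congr 3; ring

theorem X_mul_mu (b : ℤ) : dX k 1 * mu k p b = mu k p (b + 2) * dX k 1 := by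
  simpa using dX_mul_mu (p := p) 1 b

theorem mu_mul_Y (b : ℤ) : mu k p b * dY k 1 = dY k 1 * mu k p (b + 2) := by
  simpa using mu_mul_dY (p := p) 1 b

theorem aeval_yx_commute_mu (f : k[X]) (b : ℤ) :
    Commute (aeval (yx k) f) (mu k p b) := by
  rw [mu_eq_cartan]; exact aeval_yx_commute_cartan f _

/-- XY = YX + H, and H is the function N ↦ N, whose value in k on the class of b is the constant b.
-/
theorem X_mul_Y_mul_mu (b : ℤ) :
    dX k 1 * dY k 1 * mu k p b = (yx k + algebraMap k _ (b : k)) * mu k p b := by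
  have h := dX_mul_dY (k := k) p 1 1
  rw [show min 1 1 + 1 = 2 from rfl, Finset.sum_range_succ, Finset.sum_range_one] at h
  simp only [Nat.sub_zero, Nat.sub_self, dX_zero, dY_zero, one_mul, mul_one, bin_zero, map_one] at h
  rw [h, add_mul, add_mul, yx]
  congr 1
  have : cartan k p (algebraMap k _ (b : k)) = algebraMap k _ (b : k) := AlgHom.commutes _ _
  rw [← this]
  refine cartan_mul_mu fun N hN => ?_
  rw [bin_apply, Ring.choose_one_right]
  change _ = (b : k)
  rw [← (CharP.intCast_eq_intCast k p).2 ((ZMod.intCast_eq_intCast_iff _ _ _).1 hN)]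
  push_cast; ring

/-- X · YX = XY · X, and XY equals YX + (b + 2) on μ_{b+2}; so moving X to the right translates the
variable of f by b + 2. -/
theorem X_mul_aeval_yx_mul_mu (f : k[X]) (b : ℤ) :
    dX k 1 * (aeval (yx k) f * mu k p b) =
      aeval (yx k) (f.comp (X + C ((b : k) + 2))) * mu k p (b + 2) * dX k 1 := by
  induction f using Polynomial.induction_on' with
  | add f g hf hg => simp only [map_add, add_mul, mul_add, add_comp] at *; rw [hf, hg]
  | monomial n a =>
    induction n with
    | zero =>
      simp only [monomial_zero_left, aeval_C, C_comp]
      rw [← mul_assoc, ← Algebra.commutes, mul_assoc, X_mul_mu, mul_assoc]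
    | succ n ih =>
      have h1 : aeval (yx k) (monomial (n + 1) a) = yx k * aeval (yx k) (monomial n a) := by
        rw [← X_mul_monomial, map_mul, aeval_X]
      have h2 := X_mul_Y_mul_mu (k := k) (p := p) (b + 2)
      rw [← X_mul_monomial, map_mul, aeval_X, yx, mul_assoc, mul_assoc, ← mul_assoc, ← yx, ih,
        mul_comp, X_comp, map_mul, ← mul_assoc, ← mul_assoc,
        mul_assoc (dX k 1 * dY k 1), (aeval_yx_commute_mu _ _).eq, ← mul_assoc, h2,
        mul_assoc _ (mu k p _), ← (aeval_yx_commute_mu _ _).eq, mul_assoc, mul_assoc, mul_assoc,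
        mul_assoc]
      congr 1
      simp

variable (k p) in
/-- `φ_{a,m}` with coefficients in `k`. -/
def phiK (a : ℤ) (m : ℕ) : k[X] := (phi p a m).map (ZMod.castHom (dvd_refl p) k)

theorem phiK_eq_prod (a : ℤ) (m : ℕ) :
    phiK k p a m = ∏ i ∈ Finset.range m, (X - C ((i : k) * (i + a + 1))) := by
  rw [phiK, phi, Polynomial.map_prod]
  exact Finset.prod_congr rfl fun i _ => by simp

variable (k) in
/-- The constant by which the variable is translated when passing from `φ_{a,·}` to
`φ_{a+2s,·}`. -/
def trans (a : ℤ) (s : ℕ) : k := (s : k) * (s + a + 1)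

/-- The roots satisfy (s+i)(s+i+a+1) = s(s+a+1) + i(i+(a+2s)+1). Up to the translation `trans`, the
tail of φ_{a,·} is therefore φ_{a+2s,·}. -/
theorem phiK_add (a : ℤ) (s m : ℕ) :
    phiK k p a (s + m) = phiK k p a s * (phiK k p (a + 2 * s) m).comp (X - C (trans k a s)) := by
  rw [phiK_eq_prod, phiK_eq_prod, phiK_eq_prod, Finset.prod_range_add, prod_comp]
  congr 1
  refine Finset.prod_congr rfl fun i _ => ?_
  rw [sub_comp, X_comp, C_comp, sub_sub, ← C_add]
  congr 2
  rw [trans]; push_cast; ring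

theorem X_pow_mul_aeval_yx_mul_mu (f : k[X]) (a : ℤ) (s : ℕ) :
    dX k 1 ^ s * (aeval (yx k) f * mu k p a) =
      aeval (yx k) (f.comp (X + C (trans k a s))) * mu k p (a + 2 * s) * dX k 1 ^ s := by
  induction s with
  | zero => simp [trans]
  | succ s ih =>
    rw [pow_succ', mul_assoc, ih, ← mul_assoc, X_mul_aeval_yx_mul_mu, mul_assoc _ (dX k 1),
      comp_assoc]
    congr 3
    · simp only [add_comp, X_comp, C_comp]
      rw [add_assoc, ← C_add]
      congr 4
      rw [trans, trans]; push_cast; ring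
    · push_cast; ring

theorem aeval_yx_mul_mu_mul_X_pow (f : k[X]) (a : ℤ) (s : ℕ) :
    aeval (yx k) f * mu k p (a + 2 * s) * dX k 1 ^ s =
      dX k 1 ^ s * (aeval (yx k) (f.comp (X - C (trans k a s))) * mu k p a) := by
  rw [X_pow_mul_aeval_yx_mul_mu, comp_assoc]
  congr 3
  simp

/-- The relation that turns calculations in 𝒜_r into calculations with polynomials modulo φ_{a,p}.
Peeling off the outer Y and the inner X changes μ_a into μ_{a+2}, so the induction must vary a. -/
theorem Y_pow_mul_X_pow_mul_mu (a : ℤ) (s : ℕ) :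
    dY k 1 ^ s * dX k 1 ^ s * mu k p a = aeval (yx k) (phiK k p a s) * mu k p a := by
  induction s generalizing a with
  | zero => simp [phiK_eq_prod]
  | succ s ih =>
    have h1 := aeval_yx_mul_mu_mul_X_pow (p := p) (phiK k p (a + 2) s) a 1
    rw [Nat.cast_one, mul_one, pow_one] at h1
    rw [pow_succ', pow_succ, mul_assoc, mul_assoc, mul_assoc, X_mul_mu, ← mul_assoc (dX k 1 ^ s),
      ← mul_assoc (dY k 1 ^ s), ← mul_assoc (dY k 1 ^ s), ih, h1, ← mul_assoc, ← mul_assoc, ← yx,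
      add_comm s 1, phiK_add, map_mul]
    congr 2
    simp [phiK_eq_prod]

theorem X_pow_mul_Y_pow_mul_mu (a : ℤ) (s : ℕ) :
    dX k 1 ^ s * dY k 1 ^ s * mu k p (a + 2 * s) =
      aeval (yx k) ((phiK k p a s).comp (X + C (trans k a s))) * mu k p (a + 2 * s) := by
  induction s with
  | zero => simp [phiK_eq_prod]
  | succ s ih =>
    have e : (a + 2 * ((s + 1 : ℕ) : ℤ)) = (a + 2 * s) + 2 := by push_cast; ring
    set b := a + 2 * (s : ℤ) with hb
    set g := (phiK k p a s).comp (X + C (trans k a s)) with hg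
    calc dX k 1 ^ (s + 1) * dY k 1 ^ (s + 1) * mu k p (a + 2 * ((s + 1 : ℕ) : ℤ))
        = dX k 1 * (dX k 1 ^ s * dY k 1 ^ s * mu k p b) * dY k 1 := by
          rw [e, pow_succ', pow_succ]
          simp only [mul_assoc]
          rw [mu_mul_Y]
      _ = aeval (yx k) (g.comp (X + C ((b : k) + 2))) * (dX k 1 * dY k 1 * mu k p (b + 2)) := by
          rw [ih, X_mul_aeval_yx_mul_mu, mul_assoc (dX k 1), ← mu_mul_Y, ← mul_assoc (dX k 1),
            X_mul_mu]
          simp only [mul_assoc]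
      _ = _ := by
          rw [X_mul_Y_mul_mu, ← mul_assoc, e]
          congr 1
          have h1 : yx k + algebraMap k _ ((b + 2 : ℤ) : k)
            = aeval (yx k) (X + C ((b : k) + 2)) := by simp
          have h2 : trans k a (s + 1) = (b : k) + 2 + trans k a s := by
            rw [trans, trans, hb]; push_cast; ring
          rw [h1, ← map_mul, phiK_add, mul_comp, hg, comp_assoc, comp_assoc]
          congr 1
          rw [add_comp, X_comp, C_comp, add_assoc, ← C_add, ← h2]
          have h3 : (phiK k p (a + 2 * s) 1) = X := by simp [phiK_eq_prod]
          have h4 : trans k a (s + 1) - trans k a s = b + 2 := by rw [h2]; ring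
          rw [h3, X_comp, sub_comp, X_comp, C_comp, add_sub_assoc, ← C_sub, h4]

/-! ### Vanishing and commutation special to characteristic p -/

theorem dY_one_pow_prime : dY k 1 ^ p = 0 := by
  rw [dY_one_pow, (CharP.cast_eq_zero_iff k p _).2 ((Fact.out : p.Prime).dvd_factorial.2 le_rfl),
    zero_smul]

/-- Exchanging φ_{b,m}(YX) μ_b for Y^m X^m μ_b produces Y^{s+m}, which is zero. With s = 0 it shows
that polynomials in YX matter on μ_b only modulo φ_{b,p}. -/
theorem Y_pow_mul_aeval_phiK {s m : ℕ} (h : p ≤ s + m) (b : ℤ) {f : k[X]} (hf : phiK k p b m ∣ f) :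
    dY k 1 ^ s * (aeval (yx k) f * mu k p b) = 0 := by
  obtain ⟨g, rfl⟩ := hf
  rw [map_mul, mul_assoc, (aeval_yx_commute_mu g b).eq, ← mul_assoc (aeval _ _),
    ← Y_pow_mul_X_pow_mul_mu, ← mul_assoc, ← mul_assoc, ← mul_assoc, ← pow_add,
    pow_eq_zero_of_le h dY_one_pow_prime, zero_mul, zero_mul, zero_mul]

theorem aeval_phiK_prime_mul_mu (b : ℤ) {f : k[X]} (hf : phiK k p b p ∣ f) :
    aeval (yx k) f * mu k p b = 0 := by
  simpa using Y_pow_mul_aeval_phiK (s := 0) (m := p) (by simp) b hf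

theorem choose_mul_add_mul_add (u v i l : ℕ) (hi : i < p) (hl : l < p) :
    (((u * p + i).choose (v * p + l) : ℕ) : k) = (u.choose v : k) * (i.choose l : k) := by
  have h := choose_mul_add (k := k) (p := p) ((u * p + i : ℕ) : ℤ) v hl
  have hpos := (Fact.out : p.Prime).pos
  have h1 : ((u * p + i : ℕ) : ℤ) / p = (u : ℤ) := by
    rw [← Int.natCast_ediv]; congr 1
    rw [add_comm, Nat.add_mul_div_right _ _ hpos, Nat.div_eq_of_lt hi, zero_add]
  have h2 : ((u * p + i : ℕ) : ℤ) % p = (i : ℤ) := by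
    rw [← Int.natCast_emod]; congr 1
    rw [add_comm, Nat.add_mul_mod_self_right, Nat.mod_eq_of_lt hi]
  rw [h1, h2, Ring.choose_natCast, Ring.choose_natCast, Ring.choose_natCast] at h
  exact_mod_cast h

theorem choose_mul_mul (u v : ℕ) :
    (((u * p).choose (v * p) : ℕ) : k) = (u.choose v : k) := by
  have hpos := (Fact.out : p.Prime).pos
  simpa using choose_mul_add_mul_add (k := k) (p := p) u v 0 0 hpos hpos

theorem dX_mul_prime_add (v i : ℕ) (hi : i < p) : dX k (v * p + i) = dX k i * dX k (v * p) := by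
  have h := choose_mul_add_mul_add (k := k) (p := p) v 0 i i hi hi
  rw [zero_mul, zero_add, Nat.choose_zero_right, Nat.choose_self, Nat.cast_one, mul_one] at h
  rw [dX_mul_dX, add_comm i, h, one_smul]

theorem dY_mul_prime_add (u i : ℕ) (hi : i < p) : dY k (u * p + i) = dY k (u * p) * dY k i := by
  have h := choose_mul_add_mul_add (k := k) (p := p) u 0 i i hi hi
  rw [zero_mul, zero_add, Nat.choose_zero_right, Nat.choose_self, Nat.cast_one, mul_one] at h
  rw [dY_mul_dY, Nat.choose_symm_add, h, one_smul]

theorem dX_commute (m n : ℕ) : Commute (dX k m) (dX k n) := by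
  rw [Commute, SemiconjBy, dX_mul_dX, dX_mul_dX, add_comm n m, Nat.choose_symm_add]

theorem dY_commute (m n : ℕ) : Commute (dY k m) (dY k n) := by
  rw [Commute, SemiconjBy, dY_mul_dY, dY_mul_dY, add_comm n m, Nat.choose_symm_add]

/-- Commuting X^(vp) past Y leaves an error ending in X^(vp-1), and X^(vp-1) X = vp X^(vp) = 0. -/
theorem yx_commute_dX (v : ℕ) : Commute (yx k) (dX k (v * p)) := by
  rcases v.eq_zero_or_pos with rfl | hv
  · rw [zero_mul, dX_zero]; exact Commute.one_right _
  have hpos : 1 ≤ v * p := Nat.mul_pos hv (Fact.out : p.Prime).pos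
  have h := dX_mul_dY (k := k) p (v * p) 1
  rw [min_eq_right hpos, Finset.sum_range_succ, Finset.sum_range_one] at h
  simp only [Nat.sub_zero, Nat.sub_self, dY_zero, one_mul, bin_zero, map_one, mul_one] at h
  have h2 : dX k (v * p - 1) * dX k 1 = 0 := by
    rw [dX_mul_dX, Nat.choose_symm_add, Nat.choose_one_right, Nat.sub_add_cancel hpos]
    simp
  rw [Commute, SemiconjBy, yx, ← mul_assoc, h, add_mul, mul_assoc, mul_assoc (dY k 1),
    mul_assoc (cartan k p _), h2,
    mul_zero, add_zero, (dX_commute 1 _).eq]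

theorem yx_commute_dY (u : ℕ) : Commute (yx k) (dY k (u * p)) := by
  rcases u.eq_zero_or_pos with rfl | hv
  · rw [zero_mul, dY_zero]; exact Commute.one_right _
  have hpos : 1 ≤ u * p := Nat.mul_pos hv (Fact.out : p.Prime).pos
  have h := dX_mul_dY (k := k) p 1 (u * p)
  rw [min_eq_left hpos, Finset.sum_range_succ, Finset.sum_range_one] at h
  simp only [Nat.sub_zero, Nat.sub_self, dX_zero, bin_zero, map_one, mul_one] at h
  have h2 : dY k 1 * dY k (u * p - 1) = 0 := by
    rw [dY_mul_dY, Nat.choose_one_right,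
      Nat.add_sub_cancel' hpos]
    simp
  rw [Commute, SemiconjBy, yx, mul_assoc, h, mul_add, ← mul_assoc, ← mul_assoc (dY k 1), h2,
    zero_mul, add_zero, (dY_commute 1 _).eq, mul_assoc]

/-! ### Multiplicativity of `Fr'` -/

theorem yx_commute_frobSection (z : Hyp k) : Commute (yx k) (frobSection k p z) := by
  induction z using tri_induction (k := k) p with
  | zero => rw [map_zero]; exact Commute.zero_right _
  | add x y hx hy => rw [map_add]; exact hx.add_right hy
  | smul c x hx => rw [map_smul]; exact hx.smul_right c
  | of_tri u F v =>
    rw [frobSection_tri]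
    exact ((yx_commute_dY u).mul_right (yx_commute_cartan _)).mul_right (yx_commute_dX v)

theorem mu_commute_frobSection (b : ℤ) (z : Hyp k) : Commute (mu k p b) (frobSection k p z) := by
  induction z using tri_induction (k := k) p with
  | zero => rw [map_zero]; exact Commute.zero_right _
  | add x y hx hy => rw [map_add]; exact hx.add_right hy
  | smul c x hx => rw [map_smul]; exact hx.smul_right c
  | of_tri u F v =>
    rw [frobSection_tri, tri]
    have e : ∀ n : ℕ, mu k p (b + 2 * (n * p : ℕ)) = mu k p b := fun n => mu_congr (by simp)
    refine (Commute.mul_right ?_ ?_).mul_right ?_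
    · rw [Commute, SemiconjBy, mu_mul_dY, e]
    · rw [mu_eq_cartan, Commute, SemiconjBy, ← map_mul, ← map_mul, mul_comm]
    · rw [Commute, SemiconjBy, dX_mul_mu, e]

theorem aeval_yx_commute_of_commute {z : Hyp k} (h : Commute (yx k) z) (f : k[X]) :
    Commute (aeval (yx k) f) z := by
  induction f using Polynomial.induction_on' with
  | add f g hf hg => rw [map_add]; exact hf.add_left hg
  | monomial n a =>
    rw [aeval_monomial]
    exact (Algebra.commute_algebraMap_left _ _).mul_left (h.pow_left n)

theorem aeval_mul_mu_commute_frobSection (f : k[X]) (b : ℤ) (z : Hyp k) :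
    Commute (aeval (yx k) f * mu k p b) (frobSection k p z) :=
  (aeval_yx_commute_of_commute (yx_commute_frobSection z) f).mul_left (mu_commute_frobSection b z)

theorem factorial_cast_ne_zero {i : ℕ} (hi : i < p) : (i.factorial : k) ≠ 0 := fun h =>
  absurd ((Fact.out : p.Prime).dvd_factorial.1 ((CharP.cast_eq_zero_iff k p _).1 h)) (by omega)

/-- Up to a unit Y^(i) X^(i) is Y^i X^i, which acts on μ_b as φ_{b,i}(YX). As φ_{b,p-b} divides
φ_{b,i}, the hypothesis makes φ_{b,i} f a multiple of φ_{b,p}. -/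
theorem dY_mul_dX_mul_aeval_mul_mu {b : ℕ} {f : k[X]}
    (hf : phiK k p b p ∣ phiK k p b (p - b) * f) {i : ℕ} (hi : i < p) (hbi : p - b ≤ i) :
    dY k i * dX k i * (aeval (yx k) f * mu k p b) = 0 := by
  have h1 : dY k 1 ^ i * dX k 1 ^ i * (aeval (yx k) f * mu k p b) = 0 := by
    rw [(aeval_yx_commute_mu f b).eq, ← mul_assoc, Y_pow_mul_X_pow_mul_mu, mul_assoc,
      ← (aeval_yx_commute_mu f b).eq, ← mul_assoc, ← map_mul]
    refine aeval_phiK_prime_mul_mu _ (hf.trans (mul_dvd_mul_right ?_ _))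
    obtain ⟨c, rfl⟩ := Nat.exists_eq_add_of_le hbi
    exact ⟨_, phiK_add _ _ _⟩
  rw [dX_one_pow, dY_one_pow, smul_mul_smul_comm, smul_mul_assoc] at h1
  exact (smul_eq_zero.1 h1).resolve_left
    (mul_ne_zero (factorial_cast_ne_zero hi) (factorial_cast_ne_zero hi))

theorem pull_shift (c : ℤ) (F : PerFun k p) : pull (shift c F) = shift (c * p) (pull F) :=
  PerFun.ext fun N => by
    have hp : (p : ℤ) ≠ 0 := by exact_mod_cast (Fact.out : p.Prime).ne_zero
    rw [pull_apply, shift_apply, shift_apply, pull_apply, Int.add_mul_ediv_right _ _ hp]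

theorem pull_bin_shifted (c : ℤ) (n : ℕ) : pull (bin k p c n) = bin k p (c * p) (n * p) := by
  have h := shift_bin (k := k) (p := p) c 0 n
  rw [add_zero] at h
  rw [← h, pull_shift, pull_bin, shift_bin, add_zero]

/-- In the commutation sum for X^(mp) Y^(up), the terms whose index L is a multiple of p are exactly
the image under Fr' of the sum for X^(m) Y^(u). The lemma holds because every other term is killed
by f(YX) μ_b. -/
theorem dX_mul_tri_frob_eq {b : ℕ} (hb : b < p) {f : k[X]}
    (hf : phiK k p b p ∣ phiK k p b (p - b) * f) (m u v : ℕ) (F : PerFun k p) :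
    dX k (m * p) * frobSection k p (tri u F v) * (aeval (yx k) f * mu k p b) =
      frobSection k p (dX k m * tri u F v) * (aeval (yx k) f * mu k p b) := by
  have hpp : p.Prime := Fact.out
  rw [frobSection_tri, dX_mul_tri, dX_mul_tri, map_sum, Finset.sum_mul, Finset.sum_mul]
  symm
  refine Finset.sum_of_injOn (fun l => l * p) ?_ ?_ ?_ ?_
  · exact fun x _ y _ h => Nat.eq_of_mul_eq_mul_right hpp.pos h
  · intro l hl
    simp only [Finset.coe_range, Set.mem_Iio] at hl ⊢
    have h1 : l * p ≤ m * p := Nat.mul_le_mul_right _ (by omega)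
    have h2 : l * p ≤ u * p := Nat.mul_le_mul_right _ (by omega)
    omega
  · intro L hL hL'
    rw [Finset.mem_range] at hL
    have hLm : L ≤ m * p := by omega
    have hLu : L ≤ u * p := by omega
    have hdvd : ¬ p ∣ L := by
      rintro ⟨l, rfl⟩
      refine hL' ⟨l, ?_, mul_comm _ _⟩
      rw [mul_comm] at hLm hLu
      have h1 := Nat.le_of_mul_le_mul_right hLm hpp.pos
      have h2 := Nat.le_of_mul_le_mul_right hLu hpp.pos
      simp only [Finset.coe_range, Set.mem_Iio]
      omega
    -- The number i is the distance from L up to the next multiple of p. It is the last digit of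
    -- both remaining exponents, so Y^(i) and X^(i) split off from them.
    obtain ⟨q, i, hi, hip, hq⟩ : ∃ q i, 0 < i ∧ i < p ∧ L + i = (q + 1) * p := by
      have h1 := Nat.div_add_mod L p
      have h2 := Nat.mod_lt L hpp.pos
      have h3 : L % p ≠ 0 := fun h => hdvd (Nat.dvd_of_mod_eq_zero h)
      exact ⟨L / p, p - L % p, by omega, by omega, by rw [add_mul, one_mul, mul_comm]; omega⟩
    have hlt : ∀ n, L ≤ n * p → q + 1 ≤ n := fun n hn => by
      by_contra hc
      have : n * p ≤ q * p := Nat.mul_le_mul_right _ (by omega)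
      rw [add_mul] at hq
      omega
    obtain ⟨m', rfl⟩ := Nat.exists_eq_add_of_le (hlt m hLm)
    obtain ⟨u', rfl⟩ := Nat.exists_eq_add_of_le (hlt u hLu)
    have e1 : (q + 1 + u') * p - L = u' * p + i := by rw [add_mul, ← hq]; omega
    have e2 : (q + 1 + m') * p - L + v * p = (m' + v) * p + i := by
      rw [add_mul, ← hq, add_mul]; omega
    rw [smul_mul_assoc]
    refine smul_eq_zero_of_right _ ?_
    rw [e1, e2, tri, dY_mul_prime_add _ _ hip, dX_mul_prime_add _ _ hip]
    set e := aeval (yx k) f * mu k p b with he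
    set G := shift (-2 * (((q + 1 + m') * p - L : ℕ) : ℤ)) (pull F)
    set B := bin k p (2 * (L : ℤ) - ((q + 1 + m') * p : ℕ) - ((q + 1 + u') * p : ℕ)) L
    have hcomm : dX k ((m' + v) * p) * e = e * dX k ((m' + v) * p) := by
      have h := aeval_mul_mu_commute_frobSection f b (dX k (m' + v))
      have h2 : frobSection k p (dX k (m' + v)) = dX k ((m' + v) * p) := by
        have h3 := frobSection_tri 0 (m' + v) (1 : PerFun k p)
        simpa only [tri, zero_mul, dY_zero, map_one, one_mul] using h3
      rw [h2] at h
      exact h.eq.symm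
    have key : dY k i * cartan k p (B * G) * dX k i * e = 0 := by
      rw [dY_mul_cartan, mul_assoc _ (dY k i)]
      -- For i ≥ p - b the factor Y^(i) X^(i) kills f(YX) μ_b. For smaller i the binomial function
      -- has, on the class of b, the Lucas factor (b choose p-i), which is zero since b < p - i.
      by_cases hbi : p - b ≤ i
      · rw [mul_assoc, dY_mul_dX_mul_aeval_mul_mu hf hip hbi, mul_zero]
      · rw [← dY_mul_dX_mul_cartan, he, (aeval_yx_commute_mu f b).eq, mul_assoc, ← mul_assoc (cartan _ _ _)]
        rw [cartan_mul_mu (G := 0), map_zero, zero_mul, zero_mul, mul_zero]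
        intro N hN
        change B.1 (N + 2 * i) * G.1 (N + 2 * i) = 0
        rw [bin_apply]
        have e3 : L = q * p + (p - i) := by rw [add_mul] at hq; omega
        have e4 : (N + 2 * (i : ℤ) + (2 * (L : ℤ) - ((q + 1 + m') * p : ℕ) - ((q + 1 + u') * p : ℕ)))
            = N + (-m' - u') * p := by
          have : (L : ℤ) + i = (q + 1) * p := by exact_mod_cast hq
          push_cast
          linear_combination 2 * this
        rw [e4]
        conv_lhs => rw [e3]
        rw [choose_mul_add _ _ (by omega : p - i < p), Int.add_mul_emod_self_right]
        have e5 : N % p = ((b : ℕ) : ℤ) := by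
          have := (ZMod.intCast_eq_intCast_iff _ _ _).1 hN
          rw [Int.ModEq] at this
          rw [this, Int.emod_eq_of_lt] <;> omega
        rw [e5, Ring.choose_natCast, Nat.choose_eq_zero_of_lt (by omega)]
        simp
    calc _ = dY k (u' * p) * (dY k i * cartan k p (B * G) * dX k i *
          (dX k ((m' + v) * p) * e)) := by simp only [mul_assoc]
      _ = dY k (u' * p) * ((dY k i * cartan k p (B * G) * dX k i * e) *
          dX k ((m' + v) * p)) := by rw [hcomm]; simp only [mul_assoc]
      _ = 0 := by rw [key, zero_mul, mul_zero]
  · intro l hl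
    have hl := Finset.mem_range.1 hl
    rw [map_smul, frobSection_tri, map_mul, pull_bin_shifted, pull_shift]
    have e1 : m * p - l * p + v * p = (m - l + v) * p := by rw [← Nat.sub_mul, ← add_mul]
    have e2 : u * p - l * p = (u - l) * p := by rw [← Nat.sub_mul]
    rw [e1, e2, ← Nat.sub_mul, choose_mul_mul]
    congr 4
    · congr 1; push_cast; ring_nf
    · congr 1; push_cast; ring_nf

/-- The element e = f(YX) μ_b commutes with the image of Fr'. The set of z satisfying the identity
for all z' is therefore closed under products, and only divided powers have to be tested. -/
theorem frobSection_mul {b : ℕ} (hb : b < p) {f : k[X]}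
    (hf : phiK k p b p ∣ phiK k p b (p - b) * f) (z z' : Hyp k) :
    frobSection k p (z * z') * (aeval (yx k) f * mu k p b) =
      frobSection k p z * frobSection k p z' * (aeval (yx k) f * mu k p b) := by
  set e := aeval (yx k) f * mu k p b with he
  have hc : ∀ z, e * frobSection k p z = frobSection k p z * e := fun z =>
    (aeval_mul_mu_commute_frobSection f b z).eq
  have hz : z ∈ Algebra.adjoin k (Set.range (dX k) ∪ Set.range (dY k)) := by
    rw [adjoin_dX_dY]; trivial
  induction hz using Algebra.adjoin_induction generalizing z' with
  | mem x hx =>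
    rcases hx with ⟨m, rfl⟩ | ⟨m, rfl⟩
    · have h2 : frobSection k p (dX k m) = dX k (m * p) := by
        have h3 := frobSection_tri 0 m (1 : PerFun k p)
        simpa only [tri, zero_mul, dY_zero, map_one, one_mul] using h3
      rw [h2]
      induction z' using tri_induction (k := k) p with
      | zero => simp
      | add x y hx hy => simp only [mul_add, map_add, add_mul, hx, hy]
      | smul c x hx => simp only [mul_smul_comm, map_smul, smul_mul_assoc, hx]
      | of_tri u F v => rw [he, dX_mul_tri_frob_eq hb hf]
    · have h2 : frobSection k p (dY k m) = dY k (m * p) := by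
        have h3 := frobSection_tri m 0 (1 : PerFun k p)
        simpa only [tri, zero_mul, dX_zero, map_one, mul_one] using h3
      rw [h2]
      congr 1
      induction z' using tri_induction (k := k) p with
      | zero => simp
      | add x y hx hy => simp only [mul_add, map_add, hx, hy]
      | smul c x hx => simp only [mul_smul_comm, map_smul, hx]
      | of_tri u F v =>
        rw [dY_mul_tri, map_smul, frobSection_tri, frobSection_tri, dY_mul_tri, ← add_mul,
          choose_mul_mul]
  | algebraMap r =>
    rw [Algebra.algebraMap_eq_smul_one, smul_mul_assoc, one_mul, map_smul, map_smul,
      frobSection_one, smul_mul_assoc, smul_mul_assoc, one_mul, smul_mul_assoc]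
  | add x y _ _ hx hy => rw [add_mul, map_add, map_add, add_mul, add_mul, add_mul, hx, hy]
  | mul x y _ _ hx hy =>
    calc frobSection k p (x * y * z') * e
        = frobSection k p x * (frobSection k p (y * z') * e) := by rw [mul_assoc x, hx, mul_assoc]
      _ = frobSection k p x * frobSection k p y * e * frobSection k p z' := by
          rw [hy, mul_assoc _ _ e, ← hc]; simp only [mul_assoc]
      _ = _ := by rw [← hx, mul_assoc, hc, ← mul_assoc]

end Triangular

end

end SL2Hyper

namespace SL2Hyper

noncomputable section

/-! ### Twisted Frobenius maps -/

section Twist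

variable {k : Type*} [Field k] {p : ℕ} [Fact p.Prime] [CharP k p]

theorem aeval_yx_mul_mu_mul_Y (f : k[X]) (b : ℤ) :
    aeval (yx k) f * mu k p b * dY k 1 =
      dY k 1 * (aeval (yx k) (f.comp (X + C ((b : k) + 2))) * mu k p (b + 2)) := by
  induction f using Polynomial.induction_on' with
  | add f g hf hg => simp only [map_add, add_mul, mul_add, add_comp] at *; rw [hf, hg]
  | monomial n a =>
    induction n with
    | zero =>
      simp only [monomial_zero_left, aeval_C, C_comp]
      rw [← mul_assoc, ← Algebra.commutes, mul_assoc, mu_mul_Y, mul_assoc]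
    | succ n ih =>
      set g : k[X] := monomial n a with hg
      have h2 := X_mul_Y_mul_mu (k := k) (p := p) (b + 2)
      have h3 : yx k + algebraMap k _ ((b + 2 : ℤ) : k)
        = aeval (yx k) (X + C ((b : k) + 2)) := by simp
      calc aeval (yx k) (monomial (n + 1) a) * mu k p b * dY k 1
          = yx k * (aeval (yx k) g * mu k p b * dY k 1) := by
            rw [← X_mul_monomial, map_mul, aeval_X, ← hg]; simp only [mul_assoc]
        _ = dY k 1 * (dX k 1 * dY k 1 * mu k p (b + 2) *
              aeval (yx k) (g.comp (X + C ((b : k) + 2)))) := by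
            rw [ih, (aeval_yx_commute_mu _ _).eq, yx]; simp only [mul_assoc]
        _ = dY k 1 * (aeval (yx k) (X + C ((b : k) + 2)) *
              (aeval (yx k) (g.comp (X + C ((b : k) + 2))) * mu k p (b + 2))) := by
            rw [h2, h3, mul_assoc (aeval _ _) (mu k p _), ← (aeval_yx_commute_mu _ _).eq]
        _ = _ := by
            rw [← mul_assoc (aeval _ _), ← map_mul, ← X_mul_monomial, mul_comp, X_comp]

theorem aeval_yx_mul_mu_mul_Y_pow (f : k[X]) (a : ℤ) (s : ℕ) :
    aeval (yx k) f * mu k p a * dY k 1 ^ s =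
      dY k 1 ^ s * (aeval (yx k) (f.comp (X + C (trans k a s))) * mu k p (a + 2 * s)) := by
  induction s with
  | zero => simp [trans]
  | succ s ih =>
    rw [pow_succ, ← mul_assoc, ih, mul_assoc, aeval_yx_mul_mu_mul_Y, ← mul_assoc, comp_assoc]
    congr 3
    · simp only [add_comp, X_comp, C_comp]
      rw [add_assoc, ← C_add]
      congr 4
      rw [trans, trans]; push_cast; ring
    · push_cast; ring

theorem aeval_mul_mu_mul (f g : k[X]) (b : ℤ) :
    aeval (yx k) f * mu k p b * (aeval (yx k) g * mu k p b) = aeval (yx k) (f * g) * mu k p b := by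
  rw [(aeval_yx_commute_mu g b).eq, mul_assoc, ← mul_assoc (mu k p b), mu_mul_self,
    ← (aeval_yx_commute_mu g b).eq, ← mul_assoc, map_mul]

theorem phiK_monic (a : ℤ) (m : ℕ) : (phiK k p a m).Monic := by
  rw [phiK_eq_prod]; exact monic_prod_of_monic _ _ fun i _ => monic_X_sub_C _

/-- For `P = φ_{a,s} R` this is `Y^s (P/φ_{a,s})(translated) μ_{a+2s} Fr'(z) X^s`, a twisted
version of `P(YX) μ_a Fr'(z)`. -/
def twist (a : ℤ) (s : ℕ) (R : k[X]) (z : Hyp k) : Hyp k :=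
  dY k 1 ^ s * (aeval (yx k) (R.comp (X + C (trans k a s))) * mu k p (a + 2 * s)) *
    frobSection k p z * dX k 1 ^ s

theorem comp_X_add_dvd {f g : k[X]} (c : k) (h : f.comp (X - C c) ∣ g) :
    f ∣ g.comp (X + C c) := by
  obtain ⟨q, rfl⟩ := h
  refine ⟨q.comp (X + C c), ?_⟩
  rw [mul_comp, comp_assoc]
  simp

/-- Dividing φ_{a,p} by φ_{a,s} leaves the translate of φ_{a+2s,p-s}, whose multiples are killed by
Y^s. So behind Y^s the polynomial R counts only through φ_{a,s} R modulo φ_{a,p}. -/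
theorem Y_pow_mul_congr {a : ℤ} {s : ℕ} (hs : s ≤ p) {R R' : k[X]}
    (h : phiK k p a p ∣ phiK k p a s * R - phiK k p a s * R') :
    dY k 1 ^ s * (aeval (yx k) (R.comp (X + C (trans k a s))) * mu k p (a + 2 * s)) =
    dY k 1 ^ s * (aeval (yx k) (R'.comp (X + C (trans k a s))) * mu k p (a + 2 * s)) := by
  rw [← sub_eq_zero, ← mul_sub, ← sub_mul, ← map_sub, ← sub_comp]
  refine Y_pow_mul_aeval_phiK (m := p - s) (by omega) _ (comp_X_add_dvd _ ?_)
  rw [← mul_sub] at h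
  have e : phiK k p a p = phiK k p a (s + (p - s)) := by rw [Nat.add_sub_cancel' hs]
  rw [e, phiK_add] at h
  exact (mul_dvd_mul_iff_left (phiK_monic a s).ne_zero).1 h

theorem twist_congr {a : ℤ} {s : ℕ} (hs : s ≤ p) {R R' : k[X]}
    (h : phiK k p a p ∣ phiK k p a s * R - phiK k p a s * R') (z : Hyp k) :
    twist (p := p) a s R z = twist (p := p) a s R' z := by
  rw [twist, Y_pow_mul_congr hs h, twist]

theorem twist_one (a : ℤ) (s : ℕ) (R : k[X]) :
    twist (p := p) a s R 1 = aeval (yx k) (phiK k p a s * R) * mu k p a := by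
  have e : (R.comp (X + C (trans k a s))).comp (X - C (trans k a s)) = R := by
    rw [comp_assoc]; simp
  rw [twist, frobSection_one, mul_one, mul_assoc, aeval_yx_mul_mu_mul_X_pow, e,
    (aeval_yx_commute_mu _ _).eq, ← mul_assoc, ← mul_assoc, Y_pow_mul_X_pow_mul_mu, map_mul,
    mul_assoc, ← (aeval_yx_commute_mu _ _).eq, mul_assoc]

variable (k p) in
/-- The condition under which the twisted Frobenius map attached to the idempotent `P₀(YX) μ_a`
is multiplicative. -/
structure IsTwistable (a : ℤ) (s b : ℕ) (P₀ : k[X]) : Prop where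
  le : s ≤ p
  lt : b < p
  eq : ((a + 2 * s : ℤ) : ZMod p) = ((b : ℤ) : ZMod p)
  dvd : phiK k p b p ∣ phiK k p b (p - b) * P₀.comp (X + C (trans k a s))

/-- The inner X^s Y^s turns into the translate of φ_{a,s}, and everything polynomial moves to the
left past Fr'(z). There P₀ can be inserted at no cost. On the resulting factor, which lives on the
residue a + 2s ≡ b, Fr' is multiplicative, and the polynomial product is reduced modulo φ_{a,p}. -/
theorem twist_mul {a : ℤ} {s b : ℕ} {P₀ : k[X]} (h : IsTwistable k p a s b P₀) {R R' R'' : k[X]}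
    (h1 : phiK k p a p ∣ phiK k p a s * R * P₀ - phiK k p a s * R)
    (h2 : phiK k p a p ∣ phiK k p a s * R * (phiK k p a s * R') - phiK k p a s * R'') (z z' : Hyp k) :
    twist (p := p) a s R z * twist (p := p) a s R' z' = twist (p := p) a s R'' (z * z') := by
  set c := trans k a s
  set d := a + 2 * (s : ℤ) with hd
  set G := phiK k p a s with hG
  have hmu : mu k p d = mu k p b := mu_congr h.eq
  have hXY : ∀ f : k[X], dX k 1 ^ s * (dY k 1 ^ s * (aeval (yx k) f * mu k p d)) =
      aeval (yx k) (G.comp (X + C c) * f) * mu k p d := fun f => by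
    rw [(aeval_yx_commute_mu f d).eq, ← mul_assoc, ← mul_assoc, X_pow_mul_Y_pow_mul_mu, mul_assoc,
      ← (aeval_yx_commute_mu f d).eq, ← mul_assoc, ← map_mul]
  have hc : ∀ (f : k[X]) z, frobSection k p z * (aeval (yx k) f * mu k p d) =
      aeval (yx k) f * mu k p d * frobSection k p z := fun f z =>
    (aeval_mul_mu_commute_frobSection f d z).eq.symm
  have hfr : aeval (yx k) (P₀.comp (X + C c)) * mu k p d * frobSection k p (z * z') =
      aeval (yx k) (P₀.comp (X + C c)) * mu k p d * frobSection k p z * frobSection k p z' := by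
    have := frobSection_mul h.lt h.dvd z z'
    rw [← hmu, hc, mul_assoc (frobSection k p z), hc, ← mul_assoc, hc] at this
    exact this
  -- The factor P₀ is introduced only so that `frobSection_mul` becomes applicable; `e2` removes it
  -- again.
  have e1 : dY k 1 ^ s * (aeval (yx k) ((R * G * R').comp (X + C c)) * mu k p d) =
      dY k 1 ^ s * (aeval (yx k) ((R * G * R' * P₀).comp (X + C c)) * mu k p d) := by
    refine Y_pow_mul_congr h.le ?_
    obtain ⟨q, hq⟩ := h1
    exact ⟨-(q * G * R'), by linear_combination (-G * R') * hq⟩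
  have e2 : dY k 1 ^ s * (aeval (yx k) ((R * G * R' * P₀).comp (X + C c)) * mu k p d) =
      dY k 1 ^ s * (aeval (yx k) (R''.comp (X + C c)) * mu k p d) := by
    rw [← e1]
    refine Y_pow_mul_congr h.le ?_
    obtain ⟨q, hq⟩ := h2
    exact ⟨q, by linear_combination hq⟩
  have e3 : ∀ f : k[X], (aeval (yx k) ((f * P₀).comp (X + C c)) * mu k p d) =
      (aeval (yx k) (f.comp (X + C c)) * mu k p d) *
        (aeval (yx k) (P₀.comp (X + C c)) * mu k p d) := fun f => by
    rw [aeval_mul_mu_mul, mul_comp]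
  calc twist (p := p) a s R z * twist (p := p) a s R' z'
      = dY k 1 ^ s * (aeval (yx k) (R.comp (X + C c)) * mu k p d) * (frobSection k p z *
          (dX k 1 ^ s * (dY k 1 ^ s * (aeval (yx k) (R'.comp (X + C c)) * mu k p d)))) *
          frobSection k p z' * dX k 1 ^ s := by simp only [twist, mul_assoc]; rfl
    _ = dY k 1 ^ s * (aeval (yx k) ((R * G * R').comp (X + C c)) * mu k p d) *
          frobSection k p z * frobSection k p z' * dX k 1 ^ s := by
        rw [hXY, hc, ← mul_assoc, mul_assoc (dY k 1 ^ s), aeval_mul_mu_mul, mul_comp, mul_comp,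
          mul_assoc (R.comp _)]
    _ = dY k 1 ^ s * (aeval (yx k) ((R * G * R' * P₀).comp (X + C c)) * mu k p d) *
          frobSection k p (z * z') * dX k 1 ^ s := by
        rw [e1, e3]
        generalize aeval (yx k) (P₀.comp (X + C c)) * mu k p d = E at hfr ⊢
        generalize aeval (yx k) ((R * G * R').comp (X + C c)) * mu k p d = E'
        calc _ = dY k 1 ^ s * E' * (E * frobSection k p z * frobSection k p z') * dX k 1 ^ s := by
              simp only [mul_assoc]
          _ = _ := by rw [← hfr]; simp only [mul_assoc]
    _ = _ := by rw [e2, twist]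

theorem mul_twist_left {a : ℤ} {s : ℕ} (hs : s ≤ p) {P₀ R : k[X]}
    (h1 : phiK k p a p ∣ phiK k p a s * R * P₀ - phiK k p a s * R) (z : Hyp k) :
    aeval (yx k) P₀ * mu k p a * twist (p := p) a s R z = twist (p := p) a s R z := by
  have e := twist_congr hs (R := R * P₀) (R' := R) (by rwa [← mul_assoc]) z
  calc aeval (yx k) P₀ * mu k p a * twist (p := p) a s R z
      = twist (p := p) a s (R * P₀) z := by
        rw [twist, twist, ← mul_assoc, ← mul_assoc, ← mul_assoc, aeval_yx_mul_mu_mul_Y_pow,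
          mul_assoc (dY k 1 ^ s), aeval_mul_mu_mul, ← mul_comp, mul_comm P₀]
    _ = _ := e

theorem mul_twist_right {a : ℤ} {s : ℕ} (hs : s ≤ p) {P₀ R : k[X]}
    (h1 : phiK k p a p ∣ phiK k p a s * R * P₀ - phiK k p a s * R) (z : Hyp k) :
    twist (p := p) a s R z * (aeval (yx k) P₀ * mu k p a) = twist (p := p) a s R z := by
  have e := twist_congr hs (R := R * P₀) (R' := R) (by rwa [← mul_assoc]) z
  calc twist (p := p) a s R z * (aeval (yx k) P₀ * mu k p a)
      = twist (p := p) a s (R * P₀) z := by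
        rw [twist, twist, mul_assoc _ (dX k 1 ^ s), X_pow_mul_aeval_yx_mul_mu, ← mul_assoc,
          mul_assoc _ (frobSection k p z), ← (aeval_mul_mu_commute_frobSection _ _ z).eq,
          mul_comp, ← aeval_mul_mu_mul]
        simp only [mul_assoc]
    _ = _ := e

/-- Each factor absorbs P₀(YX) μ_a or P₀'(YX) μ_{a'} at the junction. The product of these two is
zero, by the orthogonality of the μ's or because φ_{a,p} divides P₀ P₀'. -/
theorem twist_mul_eq_zero {a a' : ℤ} {s s' : ℕ} (hs : s ≤ p) (hs' : s' ≤ p) {P₀ R P₀' R' : k[X]}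
    (h1 : phiK k p a p ∣ phiK k p a s * R * P₀ - phiK k p a s * R)
    (h1' : phiK k p a' p ∣ phiK k p a' s' * R' * P₀' - phiK k p a' s' * R')
    (h2 : (a : ZMod p) = a' → phiK k p a p ∣ P₀ * P₀') (z z' : Hyp k) :
    twist (p := p) a s R z * twist (p := p) a' s' R' z' = 0 := by
  rw [← mul_twist_right hs h1, ← mul_twist_left hs' h1', mul_assoc, ← mul_assoc (_ * mu k p a)]
  have : aeval (yx k) P₀ * mu k p a * (aeval (yx k) P₀' * mu k p a') = 0 := by
    by_cases h : (a : ZMod p) = a'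
    · rw [← mu_congr h, aeval_mul_mu_mul, aeval_phiK_prime_mul_mu _ (h2 h)]
    · rw [(aeval_yx_commute_mu P₀' _).eq, mul_assoc, ← mul_assoc (mu k p a), mu_mul_mu, if_neg h,
        zero_mul, mul_zero]
  rw [this, zero_mul, mul_zero]

/-! ### The sums defining Z as twists, and their non-vanishing -/

theorem mu_mul_Y_pow_mul_X_pow (a : ℤ) {s m : ℕ} (h : s ≤ m) :
    mu k p a * (dY k 1 ^ m * dX k 1 ^ (m - s)) =
      dY k 1 ^ s * (aeval (yx k) (phiK k p (a + 2 * s) (m - s)) * mu k p (a + 2 * s)) := by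
  have h1 : ∀ (l : ℕ) (b : ℤ), mu k p b * dY k 1 ^ l = dY k 1 ^ l * mu k p (b + 2 * l) := fun l b => by
    rw [dY_one_pow, mul_smul_comm, mu_mul_dY, smul_mul_assoc]
  have h2 : ∀ (l : ℕ) (b : ℤ), mu k p (b + 2 * l) * dX k 1 ^ l = dX k 1 ^ l * mu k p b := fun l b => by
    rw [dX_one_pow, mul_smul_comm, smul_mul_assoc, dX_mul_mu]
  have e : a + 2 * (m : ℤ) = a + 2 * s + 2 * ((m - s : ℕ) : ℤ) := by push_cast [h]; ring
  rw [← mul_assoc, h1, mul_assoc, e, h2, ← Y_pow_mul_X_pow_mul_mu, ← mul_assoc, ← mul_assoc,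
    ← mul_assoc, ← pow_add, Nat.add_sub_cancel' h]

/-- Each summand begins with Y^m, m ≥ s, from which Y^s can be split off. By `phiK_mul_sum` the
polynomial obtained is the quotient of ∑ c_m φ_{a,m} by φ_{a,s}. -/
theorem mu_mul_sum_eq_twist (a : ℤ) {n s : ℕ} (h : s ≤ n) (c : ℕ → k) (z : Hyp k) :
    mu k p a * ∑ m ∈ Finset.Icc n (p - 1),
      c m • (dY k 1 ^ m * dX k 1 ^ (m - s) * frobSection k p z * dX k 1 ^ s) =
    twist (p := p) a s (∑ m ∈ Finset.Icc n (p - 1),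
      C (c m) * (phiK k p (a + 2 * s) (m - s)).comp (X - C (trans k a s))) z := by
  have e : ∀ f : k[X], (f.comp (X - C (trans k a s))).comp (X + C (trans k a s)) = f := fun f => by
    rw [comp_assoc]; simp
  have e2 : ∀ f : ℕ → k[X], (∑ m ∈ Finset.Icc n (p - 1), f m).comp (X + C (trans k a s)) =
      ∑ m ∈ Finset.Icc n (p - 1), (f m).comp (X + C (trans k a s)) := fun f =>
    map_sum (compRingHom (X + C (trans k a s))) _ _
  rw [twist, e2, map_sum, Finset.sum_mul, Finset.mul_sum, Finset.mul_sum,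
    Finset.sum_mul, Finset.sum_mul]
  refine Finset.sum_congr rfl fun m hm => ?_
  have hm := (Finset.mem_Icc.1 hm).1
  rw [mul_comp, C_comp, e, map_mul, aeval_C, ← Algebra.smul_def, smul_mul_assoc, mul_smul_comm,
    mul_smul_comm, ← mu_mul_Y_pow_mul_X_pow _ (h.trans hm), smul_mul_assoc, smul_mul_assoc]
  simp only [mul_assoc]

theorem phiK_mul_sum (a : ℤ) {n s : ℕ} (h : s ≤ n) (c : ℕ → k) :
    phiK k p a s * ∑ m ∈ Finset.Icc n (p - 1),
      C (c m) * (phiK k p (a + 2 * s) (m - s)).comp (X - C (trans k a s)) =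
    ∑ m ∈ Finset.Icc n (p - 1), C (c m) * phiK k p a m := by
  rw [Finset.mul_sum]
  refine Finset.sum_congr rfl fun m hm => ?_
  have hm := (Finset.mem_Icc.1 hm).1
  rw [mul_left_comm, ← phiK_add, Nat.add_sub_cancel' (h.trans hm)]

/-- The index m of a summand of Z becomes the last p-adic digit of both exponents. Hence different
summands occupy disjoint sets of basis vectors. -/
theorem mu_mul_tri_twist (a : ℤ) {s m : ℕ} (h : s ≤ m) (hm : m < p) (u v : ℕ) (F : PerFun k p) :
    mu k p a * (dY k 1 ^ m * dX k 1 ^ (m - s) * frobSection k p (tri u F v) * dX k 1 ^ s) =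
      ((m.factorial : k) ^ 2) • tri (u * p + m)
        (ind (a + 2 * m) * shift (-2 * ((m - s : ℕ) : ℤ)) (pull F)) (v * p + m) := by
  have hY : dY k (u * p + m) = dY k (u * p) * dY k m := dY_mul_prime_add u m hm
  have hX : dX k (v * p + m) = dX k (v * p) * dX k m := by
    rw [dX_mul_prime_add v m hm, (dX_commute _ _).eq]
  have hcomm : mu k p a * (dY k 1 ^ m * dX k 1 ^ (m - s)) * dY k (u * p) =
      dY k (u * p) * (mu k p a * (dY k 1 ^ m * dX k 1 ^ (m - s))) := by
    have h2 : frobSection k p (dY k u) = dY k (u * p) := by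
      have h3 := frobSection_tri u 0 (1 : PerFun k p)
      simpa only [tri, zero_mul, dX_zero, map_one, mul_one] using h3
    have h4 := aeval_mul_mu_commute_frobSection (phiK k p (a + 2 * s) (m - s)) (a + 2 * s) (dY k u)
    rw [h2] at h4
    rw [mu_mul_Y_pow_mul_X_pow _ h, mul_assoc, h4.eq, ← mul_assoc]
    rw [show dY k 1 ^ s * dY k (u * p) = dY k (u * p) * dY k 1 ^ s by
      rw [dY_one_pow, smul_mul_assoc, mul_smul_comm, (dY_commute _ _).eq], mul_assoc]
  have hXX : dX k 1 ^ (m - s) * dX k 1 ^ s = (m.factorial : k) • dX k m := by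
    rw [← pow_add, Nat.sub_add_cancel h, dX_one_pow]
  have hcar : ∀ F : PerFun k p, dX k 1 ^ (m - s) * cartan k p F =
      cartan k p (shift (-2 * ((m - s : ℕ) : ℤ)) F) * dX k 1 ^ (m - s) := fun F => by
    rw [dX_one_pow, smul_mul_assoc, dX_mul_cartan, mul_smul_comm]
  have hcv : dX k (v * p) * dX k 1 ^ s = dX k 1 ^ s * dX k (v * p) := by
    rw [dX_one_pow, smul_mul_assoc, mul_smul_comm, (dX_commute _ _).eq]
  calc _ = (mu k p a * (dY k 1 ^ m * dX k 1 ^ (m - s)) * dY k (u * p)) *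
          cartan k p (pull F) * (dX k (v * p) * dX k 1 ^ s) := by
        rw [frobSection_tri, tri]; simp only [mul_assoc]
    _ = dY k (u * p) * (mu k p a * dY k 1 ^ m) * (dX k 1 ^ (m - s) * cartan k p (pull F)) *
          dX k 1 ^ s * dX k (v * p) := by rw [hcomm, hcv]; simp only [mul_assoc]
    _ = (m.factorial : k) • (dY k (u * p) * dY k m * (mu k p (a + 2 * m) *
          cartan k p (shift (-2 * ((m - s : ℕ) : ℤ)) (pull F))) *
          (dX k 1 ^ (m - s) * dX k 1 ^ s) * dX k (v * p)) := by
        rw [hcar, dY_one_pow, mul_smul_comm, mu_mul_dY]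
        simp only [smul_mul_assoc, mul_smul_comm, mul_assoc]
    _ = _ := by
        rw [hXX, mu_eq_cartan, ← map_mul, tri, hX, hY, (dX_commute (v * p) m).eq]
        simp only [smul_mul_assoc, mul_smul_comm, mul_assoc, smul_smul, pow_two]

theorem triCoeff_twist (a : ℤ) {n s m₀ : ℕ} (h : s ≤ n) (hm₀ : m₀ ∈ Finset.Icc n (p - 1))
    (c : ℕ → k) (u v : ℕ) (N : ℤ) (z : Hyp k) :
    triCoeff k p (u * p + m₀) (v * p + m₀) N (mu k p a * ∑ m ∈ Finset.Icc n (p - 1),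
      c m • (dY k 1 ^ m * dX k 1 ^ (m - s) * frobSection k p z * dX k 1 ^ s)) =
    c m₀ * (m₀.factorial : k) ^ 2 * ((ind (a + 2 * m₀) : PerFun k p).1 N *
      triCoeff k p u v ((N - 2 * ((m₀ - s : ℕ) : ℤ)) / p) z) := by
  have hpos := (Fact.out : p.Prime).pos
  induction z using tri_induction (k := k) p with
  | zero => simp
  | add x y hx hy =>
    simp only [map_add, mul_add, add_mul, smul_add, Finset.sum_add_distrib] at hx hy ⊢
    rw [hx, hy]
  | smul d x hx =>
    have e : ∀ m, c m • (dY k 1 ^ m * dX k 1 ^ (m - s) * frobSection k p (d • x) * dX k 1 ^ s) =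
        d • (c m • (dY k 1 ^ m * dX k 1 ^ (m - s) * frobSection k p x * dX k 1 ^ s)) := fun m => by
      rw [map_smul, mul_smul_comm, smul_mul_assoc, smul_comm]
    simp only [e]
    rw [← Finset.smul_sum, mul_smul_comm, map_smul, map_smul, hx, smul_eq_mul, smul_eq_mul]
    ring
  | of_tri u' F v' =>
    rw [Finset.mul_sum, map_sum, Finset.sum_eq_single m₀]
    · have hb := Finset.mem_Icc.1 hm₀
      rw [mul_smul_comm, map_smul, mu_mul_tri_twist a (h.trans hb.1) (by omega), map_smul,
        triCoeff_tri, triCoeff_tri]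
      have e : ∀ w w' : ℕ, w' * p + m₀ = w * p + m₀ ↔ w' = w := fun w w' => by
        rw [Nat.add_right_cancel_iff, Nat.mul_left_inj hpos.ne']
      simp only [e]
      split_ifs with h1
      · change _ * (_ * ((ind (a + 2 * m₀) : PerFun k p).1 N * F.1 ((N + _) / p))) = _
        rw [show N + -2 * ((m₀ - s : ℕ) : ℤ) = N - 2 * ((m₀ - s : ℕ) : ℤ) by ring]
        ring
      · simp
    · intro m hm hne
      have hb := Finset.mem_Icc.1 hm
      have hb0 := Finset.mem_Icc.1 hm₀
      rw [mul_smul_comm, map_smul, mu_mul_tri_twist a (h.trans hb.1) (by omega), map_smul,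
        triCoeff_tri, if_neg, smul_zero, smul_zero]
      rintro ⟨h1, -⟩
      have := congrArg (· % p) h1
      simp only [Nat.mul_add_mod_self_right] at this
      rw [Nat.mod_eq_of_lt (by omega), Nat.mod_eq_of_lt (by omega)] at this
      exact hne this
    · exact fun h => absurd hm₀ h

/-- A single nonzero coefficient c_{m₀} suffices: the components whose exponents have last digit m₀
determine all the coefficients of z. -/
theorem twist_sum_ne_zero (a : ℤ) {n s m₀ : ℕ} (h : s ≤ n) (hm₀ : m₀ ∈ Finset.Icc n (p - 1))
    {c : ℕ → k} (hc : c m₀ ≠ 0) {z : Hyp k} (hz : z ≠ 0) :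
    mu k p a * ∑ m ∈ Finset.Icc n (p - 1),
      c m • (dY k 1 ^ m * dX k 1 ^ (m - s) * frobSection k p z * dX k 1 ^ s) ≠ 0 := by
  intro h0
  have hpp : p.Prime := Fact.out
  have hpos : (0 : ℤ) < p := by exact_mod_cast hpp.pos
  have hb := Finset.mem_Icc.1 hm₀
  refine hz (eq_zero_of_triCoeff p fun u v M => ?_)
  -- N is chosen in the class of a + 2 m₀, where the indicator is 1, and so that after undoing the
  -- shift by 2(m₀ - s) its quotient by p is the prescribed M.
  set N : ℤ := 2 * ((m₀ - s : ℕ) : ℤ) + (a + 2 * s) % p + M * p with hN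
  have h1 := triCoeff_twist a h hm₀ c u v N z
  rw [h0, map_zero] at h1
  have e1 : (N - 2 * ((m₀ - s : ℕ) : ℤ)) / p = M := by
    have : N - 2 * ((m₀ - s : ℕ) : ℤ) = (a + 2 * s) % p + M * p := by rw [hN]; ring
    rw [this, Int.add_mul_ediv_right _ _ hpos.ne',
      Int.ediv_eq_zero_of_lt (Int.emod_nonneg _ hpos.ne') (Int.emod_lt_of_pos _ hpos), zero_add]
  have e2 : (N : ZMod p) = ((a + 2 * m₀ : ℤ) : ZMod p) := by
    have e3 : (((a + 2 * s) % p : ℤ) : ZMod p) = ((a + 2 * s : ℤ) : ZMod p) := by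
      rw [ZMod.intCast_mod]
    have e4 : ((m₀ - s : ℕ) : ZMod p) = m₀ - s := Nat.cast_sub (h.trans hb.1)
    rw [hN, Int.cast_add, Int.cast_add, e3]
    push_cast
    rw [e4]
    simp
    ring
  rw [e1, ind_apply, if_pos e2, one_mul] at h1
  have h3 : c m₀ * (m₀.factorial : k) ^ 2 ≠ 0 :=
    mul_ne_zero hc (pow_ne_zero _ (factorial_cast_ne_zero (p := p) (by have := hpp.pos; omega)))
  exact (mul_eq_zero.1 h1.symm).resolve_left h3

end Twist

end

end SL2Hyper

namespace SL2Hyper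

noncomputable section

/-! ### The polynomials attached to a pair -/

theorem dvd_comp_X_add_iff {R : Type*} [CommRing R] {f g : R[X]} (c : R) :
    f ∣ g.comp (X + C c) ↔ f.comp (X - C c) ∣ g := by
  constructor
  · rintro ⟨q, hq⟩
    refine ⟨q.comp (X - C c), ?_⟩
    rw [← mul_comp, ← hq, comp_assoc]; simp
  · rintro ⟨q, rfl⟩
    refine ⟨q.comp (X + C c), ?_⟩
    rw [mul_comp, comp_assoc]; simp

section Pairs

variable (p : ℕ) [Fact p.Prime]

/-- The `i`-th root of `φ_{a,p}`. -/
def root (a i : ℕ) : ZMod p := (i : ZMod p) * (i + a + 1)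

open Classical in
/-- The part of `φ_{a,p}` prime to `x - ρ`. -/
def phiAway (a : ℕ) (ρ : ZMod p) : (ZMod p)[X] :=
  ∏ i ∈ Finset.range p with ¬ root p a i = ρ, (X - C (root p a i))

open Classical in
/-- The `(x - ρ)`-primary part of `φ_{a,p}`. -/
def phiAt (a : ℕ) (ρ : ZMod p) : (ZMod p)[X] :=
  ∏ i ∈ Finset.range p with root p a i = ρ, (X - C (root p a i))

variable {p}

theorem phi_eq_prod (a m : ℕ) : phi p a m = ∏ i ∈ Finset.range m, (X - C (root p a i)) := by
  rw [phi]
  exact Finset.prod_congr rfl fun i _ => by rw [root]; push_cast; rfl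

theorem phiAt_mul_phiAway (a : ℕ) (ρ : ZMod p) : phiAt p a ρ * phiAway p a ρ = phi p a p := by
  rw [phi_eq_prod, phiAt, phiAway, Finset.prod_filter_mul_prod_filter_not]

theorem prod_dvd_phiAway (a : ℕ) (ρ : ZMod p) (I : Finset ℕ) (hI : I ⊆ Finset.range p)
    (h : ∀ i ∈ I, root p a i ≠ ρ) : ∏ i ∈ I, (X - C (root p a i)) ∣ phiAway p a ρ :=
  Finset.prod_dvd_prod_of_subset _ _ _ fun i hi => Finset.mem_filter.2 ⟨hI hi, h i hi⟩

theorem phi_dvd_phiAway_mul (a : ℕ) {ρ ρ' : ZMod p} (h : ρ ≠ ρ') :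
    phi p a p ∣ phiAway p a ρ * phiAway p a ρ' := by
  rw [← phiAt_mul_phiAway a ρ, mul_comm]
  refine mul_dvd_mul_left _ ?_
  classical
  exact Finset.prod_dvd_prod_of_subset _ _ _ fun i hi => by
    rw [Finset.mem_filter] at hi ⊢
    exact ⟨hi.1, fun h2 => h (hi.2.symm.trans h2)⟩

theorem phi_monic (a : ℤ) (m : ℕ) : (phi p a m).Monic := by
  rw [phi]; exact monic_prod_of_monic _ _ fun i _ => monic_X_sub_C _

theorem degree_phi (a : ℤ) (m : ℕ) : (phi p a m).degree = m := by
  rw [degree_eq_natDegree (phi_monic a m).ne_zero, phi,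
    natDegree_prod_of_monic _ _ fun i _ => monic_X_sub_C _,
    Finset.sum_congr rfl fun i _ => natDegree_X_sub_C _]
  simp

/-- Expansion of a multiple of `φ_{a,n}` in terms of `φ_{a,m}`, `m ≥ n`. -/
theorem exists_phi_expansion (a : ℤ) (d n : ℕ) {P : (ZMod p)[X]} (h : phi p a n ∣ P)
    (hd : P.degree < (n + d : ℕ)) :
    ∃ c : ℕ → ZMod p, P = ∑ m ∈ Finset.Ico n (n + d), C (c m) * phi p a m := by
  induction d generalizing n P with
  | zero =>
    refine ⟨0, ?_⟩
    rw [add_zero] at hd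
    simpa using eq_zero_of_dvd_of_degree_lt h (by rwa [degree_phi])
  | succ d ih =>
    obtain ⟨R, rfl⟩ := h
    set x : ZMod p := (n : ZMod p) * (n + a + 1)
    -- The remainder of R at the next root x is the coefficient of φ_{a,n}; what is left is a
    -- multiple of φ_{a,n+1}.
    have hR := modByMonic_add_div R (X - C x)
    rw [modByMonic_X_sub_C_eq_C_eval] at hR
    have hs : phi p a (n + 1) = phi p a n * (X - C x) := by rw [phi, Finset.prod_range_succ, ← phi]
    have e : phi p a n * R - C (R.eval x) * phi p a n = phi p a (n + 1) * (R /ₘ (X - C x)) := by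
      rw [hs]; linear_combination phi p a n * (-hR)
    obtain ⟨c, hc⟩ := ih (n + 1) (P := phi p a n * R - C (R.eval x) * phi p a n) ⟨_, e⟩ (by
      refine (degree_sub_le _ _).trans_lt (max_lt (by rwa [show n + 1 + d = n + (d + 1) by ring]) ?_)
      have h1 := degree_mul_le (C (R.eval x)) (phi p a n)
      have h2 : (C (R.eval x)).degree + (phi p a n).degree ≤ 0 + (n : ℕ) := by
        rw [degree_phi]; exact add_le_add degree_C_le le_rfl
      refine (h1.trans h2).trans_lt ?_
      rw [zero_add]
      exact_mod_cast (by omega : n < n + 1 + d))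
    refine ⟨fun m => if m = n then R.eval x else c m, ?_⟩
    rw [Finset.sum_eq_sum_Ico_succ_bot (by omega)]
    beta_reduce
    rw [if_pos rfl, ← sub_eq_iff_eq_add', hc, show n + 1 + d = n + (d + 1) by ring]
    refine Finset.sum_congr rfl fun m hm => ?_
    rw [if_neg (by have := Finset.mem_Ico.1 hm; omega)]

variable (p) in
/-- The polynomial `P^{(ε)}` with `B^{(ε)}(a,j) = P^{(ε)}(YX) μ_a`. -/
def pairPoly (ε : Fin 2) (a : ℕ) (j : ℚ) : (ZMod p)[X] :=
  if p = 2 then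
    if a = 0 then if ε = 0 then 1 else X
    else if j = 0 then X else X + 1
  else (psiEps p ε (j : ZMod p)).comp (X + C (halfSq p a))

variable (p) in
/-- The root of `φ_{a,p}` belonging to the pair `(a,j)`. -/
def pairRoot (a : ℕ) (j : ℚ) : ZMod p :=
  if p = 2 then if a = 0 then 0 else if j = 0 then 1 else 0
  else (j : ZMod p) ^ 2 - halfSq p a

open Classical in
variable (p) in
/-- The exponent of `X` on the right of `Fr'(z)` in `Z^{(ε)}(z;(a,j))`. -/
def pairShift (a : ℕ) (j : ℚ) : ℕ := if condA p a j ∨ condC a j then sInt p a else 0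

/-- The properties of the polynomials `P^{(ε)}` and of the root `ρ` which are used. -/
structure IsPairData (a : ℕ) (j : ℚ) (ρ : ZMod p) (P : Fin 2 → (ZMod p)[X]) : Prop where
  lt : a < p
  degree_lt : ∀ ε, (P ε).degree < p
  ne_zero : ∀ ε, P ε ≠ 0
  away_dvd : ∀ ε, phiAway p a ρ ∣ P ε
  at_dvd : phiAt p a ρ ∣ P 0 - 1
  dvd_sq : IsFree p a j → phi p a p ∣ P 1 * P 1
  nInt_dvd : ∀ ε, phi p a (nInt p ε a j) ∣ P ε
  shift_le : condA p a j ∨ condC a j → ∀ ε, sInt p a ≤ nInt p ε a j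
  root_ne : ¬ (condA p a j ∨ condC a j) → ∀ i, p - a ≤ i → i < p → root p a i ≠ ρ
  shift_eq : condA p a j ∨ condC a j → ∃ b ≤ 1, a + 2 * sInt p a = p + b ∧ 1 ≤ sInt p a ∧
    (b = 1 → root p a (sInt p a - 1) ≠ ρ)

/-! #### Odd characteristic -/

theorem prod_range_add (hp : 0 < p) {M : Type*} [CommMonoid M] (F : ZMod p → M) (h : ZMod p) :
    ∏ i ∈ Finset.range p, F ((i : ZMod p) + h) = ∏ x : ZMod p, F x := by
  have : NeZero p := ⟨hp.ne'⟩
  refine Finset.prod_bij' (fun i _ => (i : ZMod p) + h) (fun x _ => (x - h).val) ?_ ?_ ?_ ?_ ?_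
  · simp
  · intro x _; simpa using ZMod.val_lt _
  · intro i hi
    simp [ZMod.val_natCast, Nat.mod_eq_of_lt (Finset.mem_range.1 hi)]
  · intro x _; simp
  · simp

theorem two_ne_zero_of_odd (hp : p ≠ 2) : (2 : ZMod p) ≠ 0 := by
  intro h
  have h2 : ((2 : ℕ) : ZMod p) = 0 := by exact_mod_cast h
  rw [ZMod.natCast_eq_zero_iff] at h2
  exact hp ((Nat.prime_dvd_prime_iff_eq Fact.out Nat.prime_two).1 h2)

/-- Completing the square. As i runs through the residues so does i + (a+1)/2; this is why the
translation by ((a+1)/2)² turns φ_{a,p} into ψ. -/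
theorem root_add_halfSq (hp : p ≠ 2) (a i : ℕ) :
    root p a i + halfSq p a = ((i : ZMod p) + ((a : ZMod p) + 1) / 2) ^ 2 := by
  have := two_ne_zero_of_odd hp
  rw [root, halfSq]
  push_cast
  field_simp
  ring

open Classical in
theorem phiAway_comp (hp : p ≠ 2) (a : ℕ) (v : ZMod p) :
    (phiAway p a (v - halfSq p a)).comp (X - C (halfSq p a)) =
      ∏ x : ZMod p with ¬ x ^ 2 = v, (X - C (x ^ 2)) := by
  rw [Finset.prod_filter, ← prod_range_add (Fact.out : p.Prime).pos _ (((a : ZMod p) + 1) / 2),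
    phiAway, Finset.prod_filter, prod_comp]
  refine Finset.prod_congr rfl fun i _ => ?_
  rw [← root_add_halfSq hp]
  simp only [eq_sub_iff_add_eq]
  split_ifs
  · simp
  · rw [sub_comp, X_comp, C_comp, C_add]; ring

open Classical in
theorem phiAt_comp (hp : p ≠ 2) (a : ℕ) (v : ZMod p) :
    (phiAt p a (v - halfSq p a)).comp (X - C (halfSq p a)) =
      ∏ x : ZMod p with x ^ 2 = v, (X - C (x ^ 2)) := by
  rw [Finset.prod_filter, ← prod_range_add (Fact.out : p.Prime).pos _ (((a : ZMod p) + 1) / 2),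
    phiAt, Finset.prod_filter, prod_comp]
  refine Finset.prod_congr rfl fun i _ => ?_
  rw [← root_add_halfSq hp]
  simp only [eq_sub_iff_add_eq]
  split_ifs
  · rw [sub_comp, X_comp, C_comp, C_add]; ring
  · simp

/-! ### The polynomial ψ and its idempotents -/

theorem prod_X_sub_C_eq : ∏ x : ZMod p, (X - C x) = X ^ p - X := by
  have hpp : p.Prime := Fact.out
  have h0 := FiniteField.roots_X_pow_card_sub_X (ZMod p)
  have h2 : (X ^ p - X : (ZMod p)[X]).natDegree = p :=
    FiniteField.X_pow_card_sub_X_natDegree_eq _ hpp.one_lt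
  rw [ZMod.card] at h0
  have h1 := prod_multiset_X_sub_C_of_monic_of_roots_card_eq (p := (X ^ p - X : (ZMod p)[X]))
    (monic_X_pow_sub (by rw [degree_X]; exact_mod_cast hpp.one_lt)) (by
      rw [h0, h2]; exact (Finset.card_univ (α := ZMod p)).trans (ZMod.card p))
  rw [h0] at h1
  exact h1

theorem odd_of_ne_two (hp : p ≠ 2) : p = 2 * ((p - 1) / 2) + 1 := by
  have := (Fact.out : p.Prime).eq_two_or_odd.resolve_left hp
  omega

/-- After substituting x² for x the left side is ∏ (x - i)(x + i) = (x^p - x)². -/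
theorem psi_eq (hp : p ≠ 2) : psi p = X * (X ^ ((p - 1) / 2) - 1) ^ 2 := by
  have hodd := odd_of_ne_two hp
  set m := (p - 1) / 2
  refine expand_injective (n := 2) two_pos ?_
  have h2 : ∏ x : ZMod p, (X + C x) = X ^ p - X := by
    rw [← prod_X_sub_C_eq, ← Equiv.prod_comp (Equiv.neg (ZMod p))]
    exact Finset.prod_congr rfl fun x _ => by simp [sub_eq_add_neg]
  have h3 : ∏ x : ZMod p, (X ^ 2 - C (x ^ 2)) = (X ^ p - X) ^ 2 := by
    rw [pow_two (X ^ p - X)]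
    nth_rw 1 [← h2]
    rw [← prod_X_sub_C_eq, ← Finset.prod_mul_distrib]
    exact Finset.prod_congr rfl fun x _ => by rw [C_pow]; ring
  have h4 : expand (ZMod p) 2 (psi p) = ∏ x : ZMod p, (X ^ 2 - C (x ^ 2)) := by
    rw [psi, map_prod]
    exact Finset.prod_congr rfl fun x _ => by simp
  rw [h4, h3]
  simp only [map_mul, map_pow, map_sub, expand_X, map_one]
  have h5 : (X : (ZMod p)[X]) ^ p = (X ^ 2) ^ m * X := by
    rw [← pow_mul, ← pow_succ, ← hodd]
  rw [h5]; ring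

open Classical in
theorem psi_eq_mul (v : ZMod p) : psi p = (∏ x : ZMod p with x ^ 2 = v, (X - C (x ^ 2))) *
    ∏ x : ZMod p with ¬ x ^ 2 = v, (X - C (x ^ 2)) := by
  rw [psi, Finset.prod_filter_mul_prod_filter_not]

open Classical in
theorem prod_sq_eq_zero :
    (∏ x : ZMod p with x ^ 2 = 0, (X - C (x ^ 2))) = (X : (ZMod p)[X]) := by
  have : (Finset.univ.filter fun x : ZMod p => x ^ 2 = 0) = {0} := by
    ext x; simp
  rw [this]; simp

open Classical in
theorem prod_sq_eq (hp : p ≠ 2) {s : ZMod p} (hs : s ≠ 0) :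
    (∏ x : ZMod p with x ^ 2 = s ^ 2, (X - C (x ^ 2))) = (X - C (s ^ 2)) ^ 2 := by
  have : (Finset.univ.filter fun x : ZMod p => x ^ 2 = s ^ 2) = {s, -s} := by
    ext x; simp [sq_eq_sq_iff_eq_or_eq_neg]
  have hne : s ≠ -s := fun h => by
    have h2 : 2 * s = 0 := by linear_combination h
    exact (mul_ne_zero (two_ne_zero_of_odd hp) hs) h2
  rw [this, Finset.prod_pair hne, neg_sq, pow_two (X - C _)]

open Classical in
theorem prod_sq_ne_eq {s : ZMod p} (hs : s ≠ 0) :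
    (∏ x : ZMod p with ¬ x ^ 2 = s ^ 2, (X - C (x ^ 2))) =
      X * ∏ i : ZMod p with i ≠ 0 ∧ i ≠ s ∧ i ≠ -s, (X - C (i ^ 2)) := by
  have : (Finset.univ.filter fun x : ZMod p => ¬ x ^ 2 = s ^ 2) =
      insert 0 (Finset.univ.filter fun i : ZMod p => i ≠ 0 ∧ i ≠ s ∧ i ≠ -s) := by
    ext x
    simp only [Finset.mem_filter, Finset.mem_univ, true_and, Finset.mem_insert,
      sq_eq_sq_iff_eq_or_eq_neg, not_or]
    by_cases hx : x = 0
    · subst hx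
      simp [hs.symm, hs]
    · simp [hx]
  rw [this, Finset.prod_insert (by simp)]
  simp

theorem sq_dvd_of_eval {f : (ZMod p)[X]} {v : ZMod p} (h : f.eval v = 0)
    (h' : (derivative f).eval v = 0) : (X - C v) ^ 2 ∣ f := by
  obtain ⟨g, rfl⟩ := dvd_iff_isRoot.2 h
  rw [derivative_mul] at h'
  simp at h'
  obtain ⟨q, rfl⟩ := dvd_iff_isRoot.2 h'
  exact ⟨q, by ring⟩

-- Explains the factor 2x(x+s²) in ψ_s^(0): it makes the polynomial congruent to 1 modulo (x - s²)².
-- With v = s² and Q = (x^{(p-1)/2} - 1)/(x - v), the product over the other squares is x Q², so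
-- only Q(v) and Q'(v) are needed.
open Classical in
theorem sq_dvd_psiEps_sub_one (hp : p ≠ 2) {s : ZMod p} (hs : s ≠ 0) :
    (X - C (s ^ 2)) ^ 2 ∣
      2 * (X + C (s ^ 2)) * (∏ x : ZMod p with ¬ x ^ 2 = s ^ 2, (X - C (x ^ 2))) - 1 := by
  have hodd := odd_of_ne_two hp
  have hpp : p.Prime := Fact.out
  obtain ⟨m, hm⟩ : ∃ m, (p - 1) / 2 = m + 1 :=
    ⟨(p - 1) / 2 - 1, by have := hpp.two_le; omega⟩
  set v := s ^ 2 with hv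
  have hv0 : v ≠ 0 := pow_ne_zero 2 hs
  have hvm : v ^ (m + 1) = 1 := by
    rw [hv, ← pow_mul, ← ZMod.pow_card_sub_one_eq_one hs]; congr 1; omega
  obtain ⟨Q, hQ⟩ : X - C v ∣ (X ^ (m + 1) - 1 : (ZMod p)[X]) :=
    dvd_iff_isRoot.2 (by simp [hvm])
  have hD : (∏ x : ZMod p with ¬ x ^ 2 = v, (X - C (x ^ 2))) = X * Q ^ 2 := by
    have h1 := psi_eq_mul (p := p) v
    rw [psi_eq hp, hm, hQ, hv, prod_sq_eq hp hs] at h1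
    refine (mul_left_cancel₀ (pow_ne_zero 2 (X_sub_C_ne_zero v)) ?_).symm
    rw [hv, ← h1]; ring
  -- This is p = 2(m + 1) + 1 read modulo p.
  have hm2 : 2 * (m : ZMod p) = -3 := by
    have : ((2 * (m + 1) + 1 : ℕ) : ZMod p) = 0 := by
      rw [← hm, ← hodd]; simp
    push_cast at this
    linear_combination this
  -- Differentiating x^{m+1} - 1 = (x - v) Q once and twice and evaluating at v gives Q(v) and 2
  -- Q'(v).
  have hd1 := congrArg (fun f => derivative f) hQ
  have hd2 := congrArg (fun f => derivative (derivative f)) hQ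
  simp only [derivative_sub, derivative_mul, derivative_X_pow, derivative_one, derivative_X,
    derivative_C, sub_zero, one_mul, derivative_add, zero_mul, zero_add, Nat.add_sub_cancel] at hd1 hd2
  have e1 := congrArg (eval v) hd1
  have e2 := congrArg (eval v) hd2
  simp only [eval_mul, eval_pow, eval_X, eval_C, eval_add, eval_sub, sub_self, zero_mul,
    add_zero] at e1 e2
  set q := Q.eval v
  set q' := (derivative Q).eval v
  have f1 : v * q = m + 1 := by
    rw [← e1]; push_cast; linear_combination ((m : ZMod p) + 1) * hvm
  have f2 : v ^ 2 * (q' + q') = (m + 1) * m := by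
    rw [← e2]
    rcases m with _ | m
    · simp
    · push_cast
      linear_combination ((m : ZMod p) + 1 + 1) * (m + 1) * hvm
  rw [hD]
  refine sq_dvd_of_eval ?_ ?_
  · simp only [eval_mul, eval_pow, eval_X, eval_C, eval_add, eval_sub, eval_one, eval_ofNat]
    change 2 * (v + v) * (v * q ^ 2) - 1 = 0
    linear_combination 4 * (v * q + m + 1) * f1 + (2 * m + 1) * hm2
  · simp only [derivative_sub, derivative_mul, derivative_X, derivative_add, derivative_C,
      derivative_one, derivative_pow, eval_mul, eval_pow, eval_X, eval_C, eval_add, eval_sub,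
      eval_one, eval_ofNat, derivative_ofNat, eval_zero]
    change (0 * (v + v) + 2 * (1 + 0)) * (v * q ^ 2) + 2 * (v + v) * (1 * q ^ 2 + v * _) - 0 = 0
    simp
    change 2 * (v * q ^ 2) + 2 * (v + v) * (q ^ 2 + v * (2 * q * q')) = 0
    linear_combination 6 * q * f1 + 4 * q * f2 + 2 * q * (m + 1) * hm2

/-! #### The data of a pair in odd characteristic -/

/-- Equality of squares gives i + (a+1)/2 ≡ ±J. Clearing the denominator makes it a divisibility of
integers, open to arguments by size and parity. -/
theorem root_eq_imp (hp : p ≠ 2) (a i J : ℕ) (h : root p a i = (J : ZMod p) ^ 2 - halfSq p a) :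
    (p : ℤ) ∣ 2 * i + a + 1 - 2 * J ∨ (p : ℤ) ∣ 2 * i + a + 1 + 2 * J := by
  have h2 := two_ne_zero_of_odd hp
  rw [eq_sub_iff_add_eq, root_add_halfSq hp, sq_eq_sq_iff_eq_or_eq_neg] at h
  refine h.imp (fun h => ?_) fun h => ?_ <;> rw [← ZMod.intCast_zmod_eq_zero_iff_dvd] <;>
    push_cast <;> field_simp at h <;> linear_combination h

theorem root_ne_of_not_cond (hp : p ≠ 2) {a i J : ℕ} (ha : a < p) (hJ : J ≤ (p - 1) / 2)
    (h : ¬ (condA p a J ∨ condC a J)) (hi : p - a ≤ i) (hip : i < p) :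
    root p a i ≠ (J : ZMod p) ^ 2 - halfSq p a := by
  intro hr
  have hodd := odd_of_ne_two hp
  have hA : ¬ (Even a ∧ p + 1 ≤ 2 * J + a) := fun ⟨h1, h2⟩ => h (Or.inl ⟨h1, by
    have : (p : ℚ) + 1 ≤ 2 * J + a := by exact_mod_cast h2
    linarith, by
    have : 2 * (J : ℚ) + 1 ≤ p := by exact_mod_cast (by omega : 2 * J + 1 ≤ p)
    linarith⟩)
  have hC : ¬ (Odd a ∧ 2 * J + 1 ≤ a) := fun ⟨h1, h2⟩ => h (Or.inr ⟨h1, by positivity, by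
    have : 2 * (J : ℚ) + 1 ≤ a := by exact_mod_cast h2
    linarith⟩)
  rw [Nat.even_iff] at hA
  rw [Nat.odd_iff] at hC
  have hpos : (0 : ℤ) < p := by omega
  -- The size of i and J leaves two values of the multiplier t in each case. As p is odd, t odd
  -- forces a even and t even forces a odd; together with p - a ≤ i < p the former yields condition
  -- (A) and the latter condition (C).
  rcases root_eq_imp hp a i J hr with ⟨t, ht⟩ | ⟨t, ht⟩
  · have h1 : t = 1 ∨ t = 2 := by
      have : 0 < t := by
        by_contra hc
        have : (p : ℤ) * t ≤ 0 := by nlinarith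
        omega
      have : t < 3 := by by_contra hc; nlinarith
      omega
    rcases h1 with rfl | rfl <;> omega
  · have h1 : t = 2 ∨ t = 3 := by
      have : 1 < t := by
        by_contra hc
        have : (p : ℤ) * t ≤ p := by nlinarith
        omega
      have : t < 4 := by by_contra hc; nlinarith
      omega
    rcases h1 with rfl | rfl <;> omega

/-- Shows what s is made for: a + 2s is congruent to 1 under (A) and to 0 under (C). -/
theorem sInt_cond (hp : p ≠ 2) {a J : ℕ} (ha : a < p) (hJ : J ≤ (p - 1) / 2)
    (h : condA p a J ∨ condC a J) : 1 ≤ sInt p a ∧ sInt p a ≤ p ∧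
      ∃ b ≤ 1, a + 2 * sInt p a = p + b ∧ (b = 0 ∧ 2 * J + 1 ≤ a ∨ b = 1 ∧ p + 1 ≤ 2 * J + a) := by
  have hodd := odd_of_ne_two hp
  rcases h with ⟨h1, h2, -⟩ | ⟨h1, -, h2⟩
  · have h3 : p + 1 ≤ 2 * J + a := by
      have : (p : ℚ) + 1 ≤ 2 * J + a := by linarith
      exact_mod_cast this
    rw [sInt, if_neg hp, if_pos h1]
    rw [Nat.even_iff] at h1
    exact ⟨by omega, by omega, 1, le_rfl, by omega, Or.inr ⟨rfl, h3⟩⟩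
  · have h3 : 2 * J + 1 ≤ a := by
      have : 2 * (J : ℚ) + 1 ≤ a := by linarith
      exact_mod_cast this
    rw [sInt, if_neg hp, if_neg (Nat.not_even_iff_odd.2 h1)]
    rw [Nat.odd_iff] at h1
    exact ⟨by omega, by omega, 0, zero_le_one, by omega, Or.inl ⟨rfl, h3⟩⟩

/-- It follows that φ_{a,s} divides the part of φ_{a,p} away from ρ, hence P^(ε). This gives s ≤
n^(ε), so that the exponents m - s in the definition of Z are genuine. -/
theorem root_ne_of_cond (hp : p ≠ 2) {a i J : ℕ} (ha : a < p) (hJ : J ≤ (p - 1) / 2)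
    (h : condA p a J ∨ condC a J) (hi : i < sInt p a) :
    root p a i ≠ (J : ZMod p) ^ 2 - halfSq p a := by
  intro hr
  have hodd := odd_of_ne_two hp
  obtain ⟨h1, -, b, hb, h2, h3⟩ := sInt_cond hp ha hJ h
  rcases root_eq_imp hp a i J hr with ⟨t, ht⟩ | ⟨t, ht⟩
  · have h4 : t = 0 := by
      have : -1 < t := by by_contra hc; nlinarith
      have : t < 1 := by
        by_contra hc
        have : (p : ℤ) ≤ p * t := by nlinarith
        omega
      omega
    subst h4; omega
  · have h4 : t = 1 := by
      have : 0 < t := by by_contra hc; nlinarith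
      have : t < 2 := by
        by_contra hc
        have : (2 * p : ℤ) ≤ p * t := by nlinarith
        omega
      omega
    subst h4; omega

theorem isPairData_of_odd (hp : p ≠ 2) {a J : ℕ} (ha : a < p) (hJ : J ≤ (p - 1) / 2) :
    IsPairData a (J : ℚ) (pairRoot p a J) (fun ε => pairPoly p ε a J) := by
  classical
  have hodd := odd_of_ne_two hp
  have hpp : p.Prime := Fact.out
  set s : ZMod p := (J : ZMod p) with hs
  have hJs : (((J : ℚ)) : ZMod p) = s := by rw [Rat.cast_natCast]
  have hρ : pairRoot p a J = s ^ 2 - halfSq p a := by rw [pairRoot, if_neg hp, hJs]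
  have hP : ∀ ε, pairPoly p ε a J = (psiEps p ε s).comp (X + C (halfSq p a)) := fun ε => by
    rw [pairPoly, if_neg hp, hJs]
  have hs0 : s = 0 ↔ J = 0 := by
    rw [hs, ZMod.natCast_eq_zero_iff]
    constructor
    · intro h
      by_contra h0
      have := Nat.le_of_dvd (Nat.pos_of_ne_zero h0) h
      omega
    · rintro rfl; exact dvd_zero _
  set D : (ZMod p)[X] := ∏ x : ZMod p with ¬ x ^ 2 = s ^ 2, (X - C (x ^ 2)) with hD
  set E : (ZMod p)[X] := ∏ x : ZMod p with x ^ 2 = s ^ 2, (X - C (x ^ 2)) with hE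
  have hpsi : psi p = E * D := psi_eq_mul _
  have hDm : D.Monic := monic_prod_of_monic _ _ fun i _ => monic_X_sub_C _
  have hEm : E.Monic := monic_prod_of_monic _ _ fun i _ => monic_X_sub_C _
  have hdeg : E.natDegree + D.natDegree = p := by
    rw [← hEm.natDegree_mul hDm, ← hpsi, psi,
      natDegree_prod_of_monic _ _ fun i _ => monic_X_sub_C _,
      Finset.sum_congr rfl fun i _ => natDegree_X_sub_C _]
    simp [ZMod.card]
  have h2 := two_ne_zero_of_odd hp
  -- Here ψ = E D, where E is the part of ψ at s² and D the part away from it. The cofactor A is 1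
  -- if s = 0, where E = x. For s ≠ 0, where E = (x - s²)², it is 2(x + s²) for ε = 0 and x - s² for
  -- ε = 1.
  have hsum : ∃ A : Fin 2 → (ZMod p)[X], (∀ ε, psiEps p ε s = A ε * D) ∧ (∀ ε, A ε ≠ 0) ∧
      (∀ ε, (A ε).natDegree < E.natDegree) ∧ E ∣ A 0 * D - 1 ∧ (J ≠ 0 → E ∣ A 1 * A 1) := by
    by_cases h0 : s = 0
    · have hEX : E = X := by
        rw [hE, h0, zero_pow two_ne_zero]; exact prod_sq_eq_zero
      have hDf : D = ∏ i : ZMod p with i ≠ 0, (X - C (i ^ 2)) := by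
        rw [hD]
        refine Finset.prod_congr ?_ fun _ _ => rfl
        ext x; simp [h0]
      refine ⟨fun _ => 1, ?_, fun _ => one_ne_zero, fun _ => by rw [hEX]; simp, ?_, ?_⟩
      · intro ε
        rw [one_mul, psiEps]
        split_ifs with h
        · have e : psi p = (X - C (s ^ 2)) * D := by rw [hpsi, hEX, h0]; simp
          rw [e, mul_divByMonic_cancel_left _ (monic_X_sub_C _)]
        · exact hDf.symm
      · have h3 := hpsi
        rw [psi_eq hp, hEX] at h3
        have h4 := mul_left_cancel₀ X_ne_zero h3
        rw [one_mul, ← h4, hEX]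
        obtain ⟨m, hm⟩ : ∃ m, (p - 1) / 2 = m + 1 :=
          ⟨(p - 1) / 2 - 1, by have := hpp.two_le; omega⟩
        rw [hm]
        exact ⟨X ^ m * (X ^ (m + 1) - 2), by ring⟩
      · exact fun h => absurd (hs0.1 h0) h
    · have hEX : E = (X - C (s ^ 2)) ^ 2 := prod_sq_eq hp h0
      have hE2 : E.natDegree = 2 := by
        rw [hEX, natDegree_pow, natDegree_X_sub_C]
      refine ⟨fun ε => if ε = 1 then X - C (s ^ 2) else 2 * (X + C (s ^ 2)), ?_, ?_, ?_, ?_, ?_⟩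
      · intro ε
        rw [psiEps]
        split_ifs with h
        · have e : psi p = (X - C (s ^ 2)) * ((X - C (s ^ 2)) * D) := by rw [hpsi, hEX]; ring
          rw [e, mul_divByMonic_cancel_left _ (monic_X_sub_C _)]
          simp only [if_pos h]
        · simp only [if_neg h]
          rw [hD, prod_sq_ne_eq h0]; ring
      · intro ε
        beta_reduce
        split_ifs
        · exact X_sub_C_ne_zero _
        · refine mul_ne_zero ?_ (X_add_C_ne_zero _)
          rw [← C_ofNat]; exact C_ne_zero.2 h2
      · intro ε
        rw [hE2]
        beta_reduce
        split_ifs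
        · rw [natDegree_X_sub_C]; exact one_lt_two
        · rw [← C_ofNat]
          exact (natDegree_C_mul_le _ _).trans_lt (by rw [natDegree_X_add_C]; exact one_lt_two)
      · rw [hEX]
        exact sq_dvd_psiEps_sub_one hp h0
      · intro _
        rw [hEX]
        simp [pow_two]
  obtain ⟨A, hA, hA0, hAdeg, hA1, hA2⟩ := hsum
  have hφD : (phiAway p a (s ^ 2 - halfSq p a)).comp (X - C (halfSq p a)) = D := phiAway_comp hp a _
  have hφE : (phiAt p a (s ^ 2 - halfSq p a)).comp (X - C (halfSq p a)) = E := phiAt_comp hp a _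
  have hlin : (X + C (halfSq p a)).natDegree = 1 := natDegree_X_add_C _
  have hne : ∀ ε, pairPoly p ε a J ≠ 0 := fun ε h => by
    rw [hP, comp_eq_zero_iff] at h
    rcases h with h | ⟨-, h⟩
    · rw [hA] at h
      exact mul_ne_zero (hA0 ε) hDm.ne_zero h
    · have := congrArg natDegree h
      rw [hlin, natDegree_C] at this
      exact one_ne_zero this
  have hdeglt : ∀ ε, (pairPoly p ε a J).degree < p := fun ε => by
    rw [degree_eq_natDegree (hne ε), hP, natDegree_comp, hlin, mul_one, hA]
    have := natDegree_mul_le (p := A ε) (q := D)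
    have := hAdeg ε
    exact_mod_cast (by omega : (A ε * D).natDegree < p)
  have hawayd : ∀ ε, phiAway p a (pairRoot p a J) ∣ pairPoly p ε a J := fun ε => by
    rw [hP, hρ, dvd_comp_X_add_iff, hφD, hA]; exact dvd_mul_left _ _
  -- Without a bound the supremum defining n^(ε) would be the default value 0; the degree supplies
  -- the bound.
  have hbdd : ∀ ε, BddAbove {n : ℕ | phi p a n ∣ (psiEps p ε ((J : ℚ) : ZMod p)).comp (X + C (halfSq p a))} :=
    fun ε => ⟨p, fun n hn => by
      have hn : phi p a n ∣ pairPoly p ε a J := by rw [hP, ← hJs]; exact hn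
      have := degree_le_of_dvd hn (hne ε)
      rw [degree_phi] at this
      exact_mod_cast (this.trans_lt (hdeglt ε)).le⟩
  refine ⟨ha, hdeglt, hne, hawayd, ?_, ?_, ?_, ?_, ?_, ?_⟩
  · have : pairPoly p 0 a J - 1 = (psiEps p 0 s - 1).comp (X + C (halfSq p a)) := by
      rw [hP, sub_comp, one_comp]
    rw [this, hρ, dvd_comp_X_add_iff, hφE, hA]
    exact hA1
  · intro hf
    rw [IsFree, if_neg hp] at hf
    have hJ0 : J ≠ 0 := by exact_mod_cast hf
    rw [hP, ← mul_comp, ← phiAt_mul_phiAway a (s ^ 2 - halfSq p a), dvd_comp_X_add_iff, mul_comp,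
      hφE, hφD, hA]
    obtain ⟨q, hq⟩ := hA2 hJ0
    exact ⟨q * D, by linear_combination D * D * hq⟩
  · intro ε
    rw [nInt, if_neg hp]
    have := Nat.sSup_mem ⟨0, by simp [phi]⟩ (hbdd ε)
    rw [hP, ← hJs]
    exact this
  · intro h ε
    rw [nInt, if_neg hp]
    refine le_csSup (hbdd ε) ?_
    change phi p a (sInt p a) ∣ _
    rw [hJs, ← hP, phi_eq_prod]
    refine (prod_dvd_phiAway a _ _ ?_ ?_).trans (hawayd ε)
    · exact Finset.range_mono (sInt_cond hp ha hJ h).2.1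
    · intro i hi
      rw [hρ]
      exact root_ne_of_cond hp ha hJ h (Finset.mem_range.1 hi)
  · intro h i hi hip
    rw [hρ]
    exact root_ne_of_not_cond hp ha hJ h hi hip
  · intro h
    obtain ⟨h1, -, b, hb, h2, -⟩ := sInt_cond hp ha hJ h
    refine ⟨b, hb, h2, h1, fun _ => ?_⟩
    rw [hρ]
    exact root_ne_of_cond hp ha hJ h (by omega)

end Pairs

end

end SL2Hyper

namespace SL2Hyper

noncomputable section

/-! #### The data of a pair in characteristic two -/

section Two

theorem one_add_one_zmod_two : (1 + 1 : ZMod 2) = 0 := by decide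

/-- Here φ_{0,2} = x², so 0 is a double root, with idempotent 1 and square-zero element x. -/
theorem isPairData_zero_half [Fact (Nat.Prime 2)] :
    IsPairData 0 (1 / 2) (pairRoot 2 0 (1 / 2)) (fun ε => pairPoly 2 ε 0 (1 / 2)) := by
  classical
  have hr0 : root 2 0 0 = 0 := by simp [root]
  have hr1 : root 2 0 1 = 0 := by
    rw [root]; push_cast; linear_combination one_add_one_zmod_two
  have hρ : pairRoot 2 0 (1 / 2) = 0 := by simp [pairRoot]
  have haway : phiAway 2 0 0 = 1 := by
    rw [phiAway, Finset.prod_filter, Finset.prod_range_succ, Finset.prod_range_one, hr0, hr1]; simp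
  have hat : phiAt 2 0 0 = X * X := by
    rw [phiAt, Finset.prod_filter, Finset.prod_range_succ, Finset.prod_range_one, hr0, hr1]; simp
  have hphi : phi 2 0 2 = X * X := by
    have := phiAt_mul_phiAway (p := 2) 0 0
    rw [hat, haway, mul_one] at this
    exact_mod_cast this.symm
  have hP0 : pairPoly 2 0 0 (1 / 2) = 1 := by simp [pairPoly]
  have hP1 : pairPoly 2 1 0 (1 / 2) = X := by simp [pairPoly]
  have hA : ¬ (condA 2 0 (1 / 2) ∨ condC 0 (1 / 2)) := by
    rintro (⟨-, h, -⟩ | ⟨h, -⟩)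
    · norm_num at h
    · exact absurd h (by decide)
  rw [hρ]
  refine ⟨two_pos, ?_, ?_, ?_, ?_, ?_, ?_, fun h => absurd h hA, ?_, fun h => absurd h hA⟩
  · refine Fin.forall_fin_two.2 ⟨?_, ?_⟩
    · rw [hP0, degree_one]; norm_num
    · rw [hP1, degree_X]; norm_num
  · refine Fin.forall_fin_two.2 ⟨?_, ?_⟩
    · rw [hP0]; exact one_ne_zero
    · rw [hP1]; exact X_ne_zero
  · intro ε; rw [haway]; exact one_dvd _
  · rw [hP0, sub_self]; exact dvd_zero _
  · intro _
    rw [hP1]; exact_mod_cast hphi.dvd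
  · refine Fin.forall_fin_two.2 ⟨?_, ?_⟩
    · simp [nInt, phi]
    · rw [hP1]; simp [nInt, phi]
  · intro _ i hi hi2; omega

/-- Here φ_{1,2} = x(x - 1), and x is the idempotent at the simple root 1. The pair falls under (C),
and s = 1 moves the residue 1 to 3 = 2 + 1. -/
theorem isPairData_one_zero [Fact (Nat.Prime 2)] :
    IsPairData 1 0 (pairRoot 2 1 0) (fun ε => pairPoly 2 ε 1 0) := by
  classical
  have hr0 : root 2 1 0 = 0 := by simp [root]
  have hr1 : root 2 1 1 = 1 := by
    rw [root]; push_cast; linear_combination one_add_one_zmod_two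
  have hρ : pairRoot 2 1 0 = 1 := by simp [pairRoot]
  have haway : phiAway 2 1 1 = X := by
    rw [phiAway, Finset.prod_filter, Finset.prod_range_succ, Finset.prod_range_one, hr0, hr1]; simp
  have hat : phiAt 2 1 1 = X - 1 := by
    rw [phiAt, Finset.prod_filter, Finset.prod_range_succ, Finset.prod_range_one, hr0, hr1]; simp
  have hP : ∀ ε, pairPoly 2 ε 1 0 = X := fun ε => by simp [pairPoly]
  have hC : condA 2 1 0 ∨ condC 1 0 := Or.inr ⟨odd_one, le_rfl, by norm_num⟩
  have hs : sInt 2 1 = 1 := by simp [sInt]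
  have hn : ∀ ε, nInt 2 ε 1 0 = 1 := fun ε => by simp [nInt]
  rw [hρ]
  refine ⟨one_lt_two, ?_, ?_, ?_, ?_, ?_, ?_, ?_, fun h => absurd hC h, ?_⟩
  · intro ε; rw [hP, degree_X]; norm_num
  · intro ε; rw [hP]; exact X_ne_zero
  · intro ε; rw [haway, hP]
  · rw [hP, hat]
  · intro h; simp [IsFree] at h
  · intro ε; rw [hP, hn]; simp [phi]
  · intro _ ε; rw [hs, hn]
  · intro _
    rw [hs]
    exact ⟨1, le_rfl, rfl, le_rfl, fun _ => by rw [hr0]; exact zero_ne_one⟩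

/-- The other root of φ_{1,2}: x + 1 is the idempotent at 0, and no twist is needed. -/
theorem isPairData_one_one [Fact (Nat.Prime 2)] :
    IsPairData 1 1 (pairRoot 2 1 1) (fun ε => pairPoly 2 ε 1 1) := by
  classical
  have hr0 : root 2 1 0 = 0 := by simp [root]
  have hr1 : root 2 1 1 = 1 := by
    rw [root]; push_cast; linear_combination one_add_one_zmod_two
  have hρ : pairRoot 2 1 1 = 0 := by simp [pairRoot]
  have haway : phiAway 2 1 0 = X - C 1 := by
    rw [phiAway, Finset.prod_filter, Finset.prod_range_succ, Finset.prod_range_one, hr0, hr1]; simp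
  have hat : phiAt 2 1 0 = X := by
    rw [phiAt, Finset.prod_filter, Finset.prod_range_succ, Finset.prod_range_one, hr0, hr1]; simp
  have hP : ∀ ε, pairPoly 2 ε 1 1 = X + C 1 := fun ε => by simp [pairPoly]
  have hC : ¬ (condA 2 1 1 ∨ condC 1 1) := by
    rintro (⟨h, -⟩ | ⟨-, -, h⟩)
    · exact absurd h (by decide)
    · norm_num at h
  have hn : ∀ ε, nInt 2 ε 1 1 = 0 := fun ε => by simp [nInt]
  rw [hρ]
  refine ⟨one_lt_two, ?_, ?_, ?_, ?_, ?_, ?_, fun h => absurd h hC, ?_, fun h => absurd h hC⟩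
  · intro ε; rw [hP, degree_X_add_C]; norm_num
  · intro ε; rw [hP]; exact X_add_C_ne_zero _
  · intro ε
    rw [haway, hP, sub_eq_add_neg, ← C_neg, show (-1 : ZMod 2) = 1 by linear_combination -one_add_one_zmod_two]
  · rw [hP, hat]; simp
  · intro h; simp [IsFree] at h
  · intro ε; rw [hn]; simp [phi]
  · intro _ i hi hi2
    obtain rfl : i = 1 := by omega
    rw [hr1]; exact one_ne_zero

end Two

section Pairs

variable {p : ℕ} [Fact p.Prime]

theorem isPairData_of_mem {a : ℕ} {j : ℚ} (h : (a, j) ∈ pairSet p) :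
    IsPairData a j (pairRoot p a j) (fun ε => pairPoly p ε a j) := by
  rw [pairSet] at h
  split_ifs at h with hp
  · subst hp
    simp only [Set.mem_insert_iff, Set.mem_singleton_iff, Prod.mk.injEq] at h
    rcases h with ⟨rfl, rfl⟩ | ⟨rfl, rfl⟩ | ⟨rfl, rfl⟩
    · exact isPairData_zero_half
    · exact isPairData_one_zero
    · exact isPairData_one_one
  · obtain ⟨h1, J, h2, h3⟩ := h
    simp only at h1 h3
    subst h3
    exact isPairData_of_odd hp h1 h2

/-- For p odd, j² = j'² means j = ±j' modulo p, and both lie in [0, (p-1)/2]. Pairs with the same a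
are thus separated by their roots, which makes their idempotents orthogonal. -/
theorem pairRoot_injective {a : ℕ} {j j' : ℚ} (h : (a, j) ∈ pairSet p) (h' : (a, j') ∈ pairSet p)
    (he : pairRoot p a j = pairRoot p a j') : j = j' := by
  rw [pairSet] at h h'
  split_ifs at h h' with hp
  · subst hp
    simp only [Set.mem_insert_iff, Set.mem_singleton_iff, Prod.mk.injEq] at h h'
    rcases h with ⟨rfl, rfl⟩ | ⟨rfl, rfl⟩ | ⟨rfl, rfl⟩ <;>
      rcases h' with ⟨h1, rfl⟩ | ⟨h1, rfl⟩ | ⟨h1, rfl⟩ <;> simp [pairRoot] at h1 he ⊢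
  · obtain ⟨h1, J, h2, h3⟩ := h
    obtain ⟨-, J', h2', h3'⟩ := h'
    simp only at h1 h3 h3'
    subst h3 h3'
    have hodd := odd_of_ne_two hp
    rw [pairRoot, pairRoot, if_neg hp, if_neg hp, sub_left_inj, Rat.cast_natCast, Rat.cast_natCast,
      sq_eq_sq_iff_eq_or_eq_neg] at he
    norm_cast
    rcases he with he | he
    · rw [ZMod.natCast_eq_natCast_iff'] at he
      rwa [Nat.mod_eq_of_lt (by omega), Nat.mod_eq_of_lt (by omega)] at he
    · rw [← sub_eq_zero, sub_neg_eq_add] at he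
      have he' : ((J + J' : ℕ) : ZMod p) = 0 := by exact_mod_cast he
      rw [ZMod.natCast_eq_zero_iff] at he'
      have := Nat.eq_zero_of_dvd_of_lt he' (by omega)
      omega

namespace IsPairData

variable {a : ℕ} {j : ℚ} {ρ : ZMod p} {P : Fin 2 → (ZMod p)[X]} (h : IsPairData a j ρ P)

include h

/-- P^(ε) is divisible by the part of φ_{a,p} away from ρ, and P^(0) - 1 by the part at ρ. So P^(0)
is idempotent modulo φ_{a,p} and acts as the identity on P^(1). -/
theorem mul_zero_dvd (ε : Fin 2) : phi p a p ∣ P ε * P 0 - P ε := by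
  rw [← phiAt_mul_phiAway a ρ, mul_comm]
  obtain ⟨q, hq⟩ := h.away_dvd ε
  obtain ⟨q', hq'⟩ := h.at_dvd
  exact ⟨q * q', by linear_combination P ε * hq' + phiAt p a ρ * q' * hq⟩

/-- The hypothesis under which Fr' is multiplicative. Without a twist, b = a, and the roots of
φ_{a,p} of index at least p - a differ from ρ, so P^(0) supplies them. With a twist b is 0 or 1. If
b = 0 there is nothing to supply; if b = 1 only the root of index p - 1 is missing, and it
corresponds to the root of index s - 1 of φ_{a,p}, again different from ρ. -/
theorem phi_dvd_comp : ∃ b < p, pairShift p a j ≤ p ∧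
    ((a + 2 * pairShift p a j : ℤ) : ZMod p) = ((b : ℤ) : ZMod p) ∧
    phi p b p ∣ phi p b (p - b) *
      (P 0).comp (X + C ((pairShift p a j : ZMod p) * (pairShift p a j + a + 1))) := by
  have hpp : p.Prime := Fact.out
  by_cases hc : condA p a j ∨ condC a j
  · obtain ⟨b, hb, h1, h2, h3⟩ := h.shift_eq hc
    have hs : pairShift p a j = sInt p a := by rw [pairShift, if_pos hc]
    rw [hs]
    set s := sInt p a
    have hlt := h.lt
    have hp2 := hpp.two_le
    have h4 : ((a : ZMod p) + 2 * s) = b := by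
      have : ((a + 2 * s : ℕ) : ZMod p) = ((p + b : ℕ) : ZMod p) := by rw [h1]
      push_cast at this
      simpa using this
    refine ⟨b, by omega, by omega, by push_cast; exact h4, ?_⟩
    rcases (by omega : b = 0 ∨ b = 1) with rfl | rfl
    · exact dvd_mul_right _ _
    · have h5 : phi p (1 : ℕ) p = phi p (1 : ℕ) (p - 1) * (X - C (root p 1 (p - 1))) := by
        rw [phi_eq_prod, phi_eq_prod, ← Finset.prod_range_succ, Nat.sub_add_cancel (by omega)]
      rw [h5]
      refine mul_dvd_mul_left _ ?_
      rw [dvd_comp_X_add_iff]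
      have h6 : root p a (s - 1) = root p 1 (p - 1) + (s : ZMod p) * (s + a + 1) := by
        rw [root, root, Nat.cast_sub h2, Nat.cast_sub (by omega)]
        push_cast at h4 ⊢
        simp only [CharP.cast_eq_zero]
        linear_combination -h4
      have h7 : (X - C (root p 1 (p - 1))).comp (X - C ((s : ZMod p) * (s + a + 1))) =
          X - C (root p a (s - 1)) := by
        rw [h6, sub_comp, X_comp, C_comp, C_add]; ring
      rw [h7]
      refine Dvd.dvd.trans ?_ (h.away_dvd 0)
      have := prod_dvd_phiAway a ρ {s - 1} (by simp; omega) (by simpa using h3 rfl)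
      simpa using this
  · have hs : pairShift p a j = 0 := by rw [pairShift, if_neg hc]
    have hlt := h.lt
    rw [hs]
    refine ⟨a, hlt, Nat.zero_le _, by simp, ?_⟩
    have h5 : phi p (a : ℤ) p = phi p a (p - a) * ∏ i ∈ Finset.Ico (p - a) p, (X - C (root p a i)) := by
      rw [phi_eq_prod, phi_eq_prod, Finset.prod_range_mul_prod_Ico _ (by omega)]
    rw [h5]
    refine mul_dvd_mul_left _ ?_
    simp only [Nat.cast_zero, zero_mul, C_0, add_zero, comp_X]
    refine Dvd.dvd.trans (prod_dvd_phiAway a ρ _ ?_ ?_) (h.away_dvd 0)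
    · intro i hi
      rw [Finset.mem_Ico] at hi
      exact Finset.mem_range.2 hi.2
    · intro i hi
      rw [Finset.mem_Ico] at hi
      exact h.root_ne hc i hi.1 hi.2

theorem exists_expansion (ε : Fin 2) : ∃ c : ℕ → ZMod p,
    P ε = ∑ m ∈ Finset.Icc (nInt p ε a j) (p - 1), C (c m) * phi p a m := by
  have hpp : p.Prime := Fact.out
  have h1 := degree_le_of_dvd (h.nInt_dvd ε) (h.ne_zero ε)
  rw [degree_phi] at h1
  have h2 : nInt p ε a j < p := by exact_mod_cast h1.trans_lt (h.degree_lt ε)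
  obtain ⟨c, hc⟩ := exists_phi_expansion a (p - nInt p ε a j) (nInt p ε a j) (h.nInt_dvd ε)
    (by rw [Nat.add_sub_cancel' h2.le]; exact h.degree_lt ε)
  refine ⟨c, hc.trans (Finset.sum_congr ?_ fun _ _ => rfl)⟩
  ext m
  rw [Finset.mem_Icc, Finset.mem_Ico]
  omega

end IsPairData

end Pairs

end

end SL2Hyper

namespace SL2Hyper

noncomputable section

/-! ### The elements attached to one pair -/

section Elements

variable {k : Type*} [Field k] {p : ℕ} [Fact p.Prime] [CharP k p]

instance : Nontrivial (Hyp k) :=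
  ⟨⟨_, 0, (monBasis k).ne_zero (0, 0, 0)⟩⟩

/-- Removes the inner μ_a from ψ(μ_a YX + c) μ_a, since the outer one already absorbs it. -/
theorem aeval_mul_add_mul_of_idempotent {A : Type*} [Ring A] [Algebra k A] {e x : A}
    (he : e * e = e) (hc : Commute e x) (c : k) (f : k[X]) :
    aeval (e * x + algebraMap k A c) f * e = aeval (x + algebraMap k A c) f * e := by
  have h1 : (e * x + algebraMap k A c) * e = (x + algebraMap k A c) * e := by
    rw [add_mul, add_mul, hc.eq, mul_assoc, he]
  have h2 : Commute e (x + algebraMap k A c) := hc.add_right (Algebra.commutes c e).symm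
  induction f using Polynomial.induction_on' with
  | add f g hf hg => rw [map_add, map_add, add_mul, add_mul, hf, hg]
  | monomial n a =>
    rw [aeval_monomial, aeval_monomial, mul_assoc, mul_assoc]
    congr 1
    induction n with
    | zero => simp
    | succ n ih =>
      rw [pow_succ, pow_succ, mul_assoc, h1, ← h2.eq, ← mul_assoc, ih, mul_assoc, h2.eq, mul_assoc]

variable (k p) in
/-- The polynomial `P^{(ε)}` over `k`. -/
def polyK (ε : Fin 2) (a : ℕ) (j : ℚ) : k[X] :=
  (pairPoly p ε a j).map (ZMod.castHom (dvd_refl p) k)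

theorem mu_mul_dY_mul_dX (b : ℤ) : mu k p b * dY k 1 * dX k 1 = mu k p b * yx k := by
  rw [mul_assoc, yx]

theorem mu_mul_yx (b : ℤ) : mu k p b * yx k = yx k * mu k p b := by
  have := (aeval_yx_commute_mu (k := k) (p := p) X b).eq
  rw [aeval_X] at this
  exact this.symm

theorem Bone_eq (ε : Fin 2) {a : ℕ} {j : ℚ} (h : (a, j) ∈ pairSet p) :
    Bone k p ε a j = aeval (yx k) (polyK k p ε a j) * mu k p a := by
  rw [Bone, polyK, pairPoly]
  split_ifs with hp ha hε hj
  · subst ha; simp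
  · subst ha; rw [mu_mul_dY_mul_dX, mu_mul_yx]; simp
  · have ha1 : a = 1 := by
      subst hp; simp [pairSet] at h; tauto
    subst ha1; rw [mu_mul_dY_mul_dX, mu_mul_yx]; simp
  · have ha1 : a = 1 := by
      subst hp; simp [pairSet] at h; tauto
    subst ha1; rw [mu_mul_dY_mul_dX, mu_mul_yx]; simp [add_mul]
  · rw [mu_mul_dY_mul_dX, aeval_mul_add_mul_of_idempotent (mu_mul_self _) (mu_mul_yx _),
      Polynomial.map_comp, aeval_comp]
    simp

theorem map_dvd_sub {f g g' : (ZMod p)[X]} (h : f ∣ g - g') :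
    f.map (ZMod.castHom (dvd_refl p) k) ∣ g.map (ZMod.castHom (dvd_refl p) k) -
      g'.map (ZMod.castHom (dvd_refl p) k) := by
  rw [← Polynomial.map_sub]; exact Polynomial.map_dvd _ h

theorem mu_mul_sum_eq (a : ℤ) (n : ℕ) (c : ℕ → k) :
    mu k p a * ∑ m ∈ Finset.Icc n (p - 1), c m • (dY k 1 ^ m * dX k 1 ^ m) =
      aeval (yx k) (∑ m ∈ Finset.Icc n (p - 1), C (c m) * phiK k p a m) * mu k p a := by
  have h := mu_mul_sum_eq_twist (p := p) a n.zero_le c 1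
  rw [twist_one, phiK_mul_sum _ n.zero_le, frobSection_one] at h
  simpa using h

/-- The uniqueness of the coefficients c_m: the non-vanishing statement at z = 1 is applied to the
difference. -/
theorem coeff_eq_of_mu_mul_sum_eq {a : ℤ} {n m : ℕ} {c c' : ℕ → k}
    (h : mu k p a * ∑ m ∈ Finset.Icc n (p - 1), c m • (dY k 1 ^ m * dX k 1 ^ m) =
      mu k p a * ∑ m ∈ Finset.Icc n (p - 1), c' m • (dY k 1 ^ m * dX k 1 ^ m))
    (hm : m ∈ Finset.Icc n (p - 1)) : c m = c' m := by
  by_contra hne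
  refine twist_sum_ne_zero (k := k) (p := p) a n.zero_le hm (c := c - c')
    (sub_ne_zero.2 hne) one_ne_zero ?_
  simp only [frobSection_one, Nat.sub_zero, mul_one, pow_zero, Pi.sub_apply, sub_smul]
  rw [Finset.sum_sub_distrib, mul_sub, h, sub_self]

theorem exists_isCoeff (ε : Fin 2) {a : ℕ} {j : ℚ} (h : (a, j) ∈ pairSet p) :
    ∃ c, IsCoeff k p ε a j c := by
  obtain ⟨c, hc⟩ := (isPairData_of_mem h).exists_expansion ε
  refine ⟨c, ?_⟩
  rw [IsCoeff, mu_mul_sum_eq (c := fun m => ZMod.castHom (dvd_refl p) k (c m)), Bone_eq ε h, polyK]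
  rw [hc]
  congr 2
  simp [Polynomial.map_sum, phiK]

theorem isCoeff_coeffB (ε : Fin 2) {a : ℕ} {j : ℚ} (h : (a, j) ∈ pairSet p) :
    IsCoeff k p ε a j (coeffB k p ε a j) := by
  rw [coeffB, dif_pos (exists_isCoeff ε h)]
  exact (exists_isCoeff (k := k) ε h).choose_spec

theorem sum_coeffB (ε : Fin 2) {a : ℕ} {j : ℚ} (h : (a, j) ∈ pairSet p) :
    ∑ m ∈ Finset.Icc (nInt p ε a j) (p - 1),
      C (ZMod.castHom (dvd_refl p) k (coeffB k p ε a j m)) * phiK k p a m = polyK k p ε a j := by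
  obtain ⟨c, hc⟩ := (isPairData_of_mem h).exists_expansion ε
  have h1 : polyK k p ε a j = ∑ m ∈ Finset.Icc (nInt p ε a j) (p - 1),
      C (ZMod.castHom (dvd_refl p) k (c m)) * phiK k p a m := by
    rw [polyK]
    rw [hc]
    simp [Polynomial.map_sum, phiK]
  rw [h1]
  refine Finset.sum_congr rfl fun m hm => ?_
  have h2 := isCoeff_coeffB (k := k) ε h
  rw [IsCoeff, Bone_eq ε h, h1, ← mu_mul_sum_eq] at h2
  rw [coeff_eq_of_mu_mul_sum_eq h2 hm]

/-- Both branches of the definition become one formula, the untwisted branch being s = 0, because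
B^(ε)(a,j) commutes with Fr'(z). -/
theorem Zel_eq_mu_mul_sum (ε : Fin 2) {a : ℕ} {j : ℚ} (h : (a, j) ∈ pairSet p) (z : Hyp k) :
    Zel k p ε a j z = mu k p a * ∑ m ∈ Finset.Icc (nInt p ε a j) (p - 1),
      ZMod.castHom (dvd_refl p) k (coeffB k p ε a j m) •
        (dY k 1 ^ m * dX k 1 ^ (m - pairShift p a j) * frobSection k p z *
          dX k 1 ^ pairShift p a j) := by
  rw [Zel, pairShift]
  split_ifs with hc
  · rfl
  · simp only [Nat.sub_zero, pow_zero, mul_one, ← smul_mul_assoc _ _ (frobSection k p z)]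
    rw [← Finset.sum_mul, ← mul_assoc, mu_mul_sum_eq (c := fun m => ZMod.castHom (dvd_refl p) k (coeffB k p ε a j m)),
      sum_coeffB ε h, Bone_eq ε h]
    exact (aeval_mul_mu_commute_frobSection _ _ z).eq.symm

theorem pairShift_le_nInt (ε : Fin 2) {a : ℕ} {j : ℚ} (h : (a, j) ∈ pairSet p) :
    pairShift p a j ≤ nInt p ε a j := by
  rw [pairShift]
  split_ifs with hc
  · exact (isPairData_of_mem h).shift_le hc ε
  · exact Nat.zero_le _

/-- R is independent of z, so products of elements Z are governed by P^(ε) = φ_{a,s} R modulo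
φ_{a,p} alone. -/
theorem exists_Zel_eq_twist (ε : Fin 2) {a : ℕ} {j : ℚ} (h : (a, j) ∈ pairSet p) :
    ∃ R : k[X], phiK k p a (pairShift p a j) * R = polyK k p ε a j ∧
      ∀ z, Zel k p ε a j z = twist (p := p) a (pairShift p a j) R z := by
  have hs := pairShift_le_nInt ε h
  have h1 := phiK_mul_sum (p := p) (a : ℤ) hs
    fun m => ZMod.castHom (dvd_refl p) k (coeffB k p ε a j m)
  rw [sum_coeffB ε h] at h1
  refine ⟨_, h1, fun z => ?_⟩
  rw [Zel_eq_mu_mul_sum ε h, mu_mul_sum_eq_twist _ hs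
    (fun m => ZMod.castHom (dvd_refl p) k (coeffB k p ε a j m))]

theorem Zel_ne_zero (ε : Fin 2) {a : ℕ} {j : ℚ} (h : (a, j) ∈ pairSet p) {z : Hyp k} (hz : z ≠ 0) :
    Zel k p ε a j z ≠ 0 := by
  have hne : polyK k p ε a j ≠ 0 := by
    rw [polyK, Ne, Polynomial.map_eq_zero]
    exact (isPairData_of_mem h).ne_zero ε
  rw [← sum_coeffB ε h] at hne
  obtain ⟨m, hm, hm0⟩ := Finset.exists_ne_zero_of_sum_ne_zero hne
  rw [Zel_eq_mu_mul_sum ε h]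
  refine twist_sum_ne_zero _ (pairShift_le_nInt ε h) hm
    (c := fun m => ZMod.castHom (dvd_refl p) k (coeffB k p ε a j m)) ?_ hz
  intro h0
  rw [h0, C_0, zero_mul] at hm0
  exact hm0 rfl

theorem Zel_one (ε : Fin 2) {a : ℕ} {j : ℚ} (h : (a, j) ∈ pairSet p) :
    Zel k p ε a j 1 = Bone k p ε a j := by
  obtain ⟨R, hR, hZ⟩ := exists_Zel_eq_twist (k := k) ε h
  rw [hZ, twist_one, hR, Bone_eq ε h]

theorem polyK_mul_zero_dvd (ε : Fin 2) {a : ℕ} {j : ℚ} (h : (a, j) ∈ pairSet p) :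
    phiK k p a p ∣ polyK k p ε a j * polyK k p 0 a j - polyK k p ε a j := by
  have := map_dvd_sub (k := k) ((isPairData_of_mem h).mul_zero_dvd ε)
  rwa [Polynomial.map_mul] at this

theorem isTwistable {a : ℕ} {j : ℚ} (h : (a, j) ∈ pairSet p) :
    ∃ b, IsTwistable k p a (pairShift p a j) b (polyK k p 0 a j) := by
  obtain ⟨b, hb, hs, he, hd⟩ := (isPairData_of_mem h).phi_dvd_comp
  refine ⟨b, hs, hb, he, ?_⟩
  have := Polynomial.map_dvd (ZMod.castHom (dvd_refl p) k) hd
  rw [Polynomial.map_mul, Polynomial.map_comp] at this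
  simpa [polyK, phiK, trans] using this

theorem Zel_mul_Zel {a : ℕ} {j : ℚ} (h : (a, j) ∈ pairSet p) {ε ε' ε'' : Fin 2}
    (he : phiK k p a p ∣ polyK k p ε a j * polyK k p ε' a j - polyK k p ε'' a j) (z z' : Hyp k) :
    Zel k p ε a j z * Zel k p ε' a j z' = Zel k p ε'' a j (z * z') := by
  obtain ⟨R, hR, hZ⟩ := exists_Zel_eq_twist (k := k) ε h
  obtain ⟨R', hR', hZ'⟩ := exists_Zel_eq_twist (k := k) ε' h
  obtain ⟨R'', hR'', hZ''⟩ := exists_Zel_eq_twist (k := k) ε'' h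
  obtain ⟨b, hb⟩ := isTwistable (k := k) h
  rw [hZ, hZ', hZ'']
  refine twist_mul hb ?_ ?_ z z'
  · rw [hR]; exact polyK_mul_zero_dvd ε h
  · rw [hR, hR', hR'']; exact he

theorem Zel_mul_Zel_zero {a : ℕ} {j : ℚ} (h : (a, j) ∈ pairSet p) (ε : Fin 2) (z z' : Hyp k) :
    Zel k p ε a j z * Zel k p 0 a j z' = Zel k p ε a j (z * z') :=
  Zel_mul_Zel h (polyK_mul_zero_dvd ε h) z z'

theorem Zel_zero_mul_Zel {a : ℕ} {j : ℚ} (h : (a, j) ∈ pairSet p) (ε : Fin 2) (z z' : Hyp k) :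
    Zel k p 0 a j z * Zel k p ε a j z' = Zel k p ε a j (z * z') :=
  Zel_mul_Zel h (by rw [mul_comm (polyK k p 0 a j)]; exact polyK_mul_zero_dvd ε h) z z'

theorem Zel_one_mul_Zel_one {a : ℕ} {j : ℚ} (h : (a, j) ∈ pairSet p) (hf : IsFree p a j)
    (z z' : Hyp k) : Zel k p 1 a j z * Zel k p 1 a j z' = 0 := by
  obtain ⟨R, hR, hZ⟩ := exists_Zel_eq_twist (k := k) 1 h
  obtain ⟨b, hb⟩ := isTwistable (k := k) h
  have h0 : ∀ z : Hyp k, twist (p := p) a (pairShift p a j) 0 z = 0 := fun z => by simp [twist]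
  rw [hZ, hZ, ← h0 (z * z')]
  refine twist_mul hb ?_ ?_ z z'
  · rw [hR]; exact polyK_mul_zero_dvd 1 h
  · have := Polynomial.map_dvd (ZMod.castHom (dvd_refl p) k) ((isPairData_of_mem h).dvd_sq hf)
    rw [Polynomial.map_mul] at this
    rw [hR, mul_zero, sub_zero]
    exact this

/-- Either the residues differ and the μ's are orthogonal, or the roots differ and every root of
φ_{a,p} is covered, with multiplicity, by one of the two idempotents. -/
theorem Zel_mul_Zel_of_ne {a a' : ℕ} {j j' : ℚ} (h : (a, j) ∈ pairSet p) (h' : (a', j') ∈ pairSet p)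
    (hne : (a, j) ≠ (a', j')) (ε ε' : Fin 2) (z z' : Hyp k) :
    Zel k p ε a j z * Zel k p ε' a' j' z' = 0 := by
  obtain ⟨R, hR, hZ⟩ := exists_Zel_eq_twist (k := k) ε h
  obtain ⟨R', hR', hZ'⟩ := exists_Zel_eq_twist (k := k) ε' h'
  obtain ⟨b, hb⟩ := isTwistable (k := k) h
  obtain ⟨b', hb'⟩ := isTwistable (k := k) h'
  rw [hZ, hZ']
  refine twist_mul_eq_zero hb.le hb'.le (P₀ := polyK k p 0 a j) (P₀' := polyK k p 0 a' j') ?_ ?_ ?_ z z'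
  · rw [hR]; exact polyK_mul_zero_dvd ε h
  · rw [hR']; exact polyK_mul_zero_dvd ε' h'
  · intro haa
    have haa' : a = a' := by
      have : ((a : ℕ) : ZMod p) = (a' : ℕ) := by exact_mod_cast haa
      rw [ZMod.natCast_eq_natCast_iff'] at this
      rwa [Nat.mod_eq_of_lt (isPairData_of_mem h).lt, Nat.mod_eq_of_lt (isPairData_of_mem h').lt]
        at this
    subst haa'
    have hρ : pairRoot p a j ≠ pairRoot p a j' := fun he =>
      hne (by rw [pairRoot_injective h h' he])
    have := ((phi_dvd_phiAway_mul a hρ).trans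
      (mul_dvd_mul ((isPairData_of_mem h).away_dvd 0) ((isPairData_of_mem h').away_dvd 0)))
    have := Polynomial.map_dvd (ZMod.castHom (dvd_refl p) k) this
    rwa [Polynomial.map_mul] at this

/-! ### The elements attached to r pairs and their products -/

theorem Bel_succ {r : ℕ} (ε : Fin (r + 1) → Fin 2) {a : Fin (r + 1) → ℕ} {j : Fin (r + 1) → ℚ}
    (h : (a 0, j 0) ∈ pairSet p) :
    Bel k p (r + 1) ε a j = Zel k p (ε 0) (a 0) (j 0)
      (Bel k p r (fun i => ε i.succ) (fun i => a i.succ) fun i => j i.succ) := by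
  cases r with
  -- The case r = 1 has its own clause in the definition; it fits the recursion because Z^(ε)(1) =
  -- B^(ε).
  | zero => rw [Bel, Bel, Zel_one _ h]
  | succ r => rw [Bel]

theorem Bel_ne_zero {r : ℕ} (ε : Fin r → Fin 2) {a : Fin r → ℕ} {j : Fin r → ℚ}
    (h : ∀ i, (a i, j i) ∈ pairSet p) : Bel k p r ε a j ≠ 0 := by
  induction r with
  | zero => rw [Bel]; exact one_ne_zero
  | succ r ih =>
    rw [Bel_succ _ (h 0)]
    exact Zel_ne_zero _ (h 0) (ih _ fun i => h i.succ)

theorem Bel_mul_of_ne {r : ℕ} (ε ε' : Fin r → Fin 2) {a a' : Fin r → ℕ} {j j' : Fin r → ℚ}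
    (h : ∀ i, (a i, j i) ∈ pairSet p) (h' : ∀ i, (a' i, j' i) ∈ pairSet p) (i : Fin r)
    (hne : (a i, j i) ≠ (a' i, j' i)) : Bel k p r ε a j * Bel k p r ε' a' j' = 0 := by
  induction r with
  | zero => exact i.elim0
  | succ r ih =>
    rw [Bel_succ _ (h 0), Bel_succ _ (h' 0)]
    by_cases h0 : (a 0, j 0) = (a' 0, j' 0)
    · obtain ⟨h1, h2⟩ := Prod.mk.inj h0
      have hi : i ≠ 0 := by rintro rfl; exact hne h0
      obtain ⟨i, rfl⟩ := Fin.exists_succ_eq.2 hi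
      have h3 := ih (fun i => ε i.succ) (fun i => ε' i.succ) (fun i => h i.succ)
        (fun i => h' i.succ) i hne
      have hz : ∀ ε, Zel k p ε (a 0) (j 0) 0 = 0 := fun ε => by
        obtain ⟨R, -, hZ⟩ := exists_Zel_eq_twist (k := k) ε (h 0)
        rw [hZ]; simp [twist]
      -- Writing Z^(ε)(z) as Z^(ε)(1) Z^(0)(z) brings the product of the two tails together, where
      -- the induction hypothesis applies even if the leading ε's do not multiply well.
      rw [← h1, ← h2, ← one_mul (Bel k p r _ _ _), ← Zel_mul_Zel_zero (h 0), mul_assoc,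
        Zel_zero_mul_Zel (h 0), h3, hz, mul_zero]
    · exact Zel_mul_Zel_of_ne (h 0) (h' 0) h0 _ _ _ _

theorem Bel_mul {r : ℕ} (ε ε' ε'' : Fin r → Fin 2) {a : Fin r → ℕ} {j : Fin r → ℚ}
    (h : ∀ i, (a i, j i) ∈ pairSet p)
    (hε : ∀ i, (ε i = 0 ∧ ε'' i = ε' i) ∨ (ε' i = 0 ∧ ε'' i = ε i)) :
    Bel k p r ε a j * Bel k p r ε' a j = Bel k p r ε'' a j := by
  induction r with
  | zero => simp [Bel]
  | succ r ih =>
    rw [Bel_succ _ (h 0), Bel_succ _ (h 0), Bel_succ _ (h 0),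
      ← ih _ _ (fun i => ε'' i.succ) (fun i => h i.succ) fun i => hε i.succ]
    rcases hε 0 with ⟨h1, h2⟩ | ⟨h1, h2⟩
    · rw [h1, h2, Zel_zero_mul_Zel (h 0)]
    · rw [h1, h2, Zel_mul_Zel_zero (h 0)]

theorem Bel_mul_eq_zero {r : ℕ} (ε ε' : Fin r → Fin 2) {a : Fin r → ℕ} {j : Fin r → ℚ}
    (h : ∀ i, (a i, j i) ∈ pairSet p) (i : Fin r) (hf : IsFree p (a i) (j i))
    (hε : ε i = 1) (hε' : ε' i = 1) :
    Bel k p r ε a j * Bel k p r ε' a j = 0 := by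
  induction r with
  | zero => exact i.elim0
  | succ r ih =>
    rw [Bel_succ _ (h 0), Bel_succ _ (h 0)]
    rcases Fin.eq_zero_or_eq_succ i with rfl | ⟨i, rfl⟩
    · rw [hε, hε', Zel_one_mul_Zel_one (h 0) hf]
    · have h3 := ih (fun i => ε i.succ) (fun i => ε' i.succ) (fun i => h i.succ) i hf hε hε'
      have hz : ∀ ε, Zel k p ε (a 0) (j 0) 0 = 0 := fun ε => by
        obtain ⟨R, -, hZ⟩ := exists_Zel_eq_twist (k := k) ε (h 0)
        rw [hZ]; simp [twist]
      rw [← one_mul (Bel k p r _ _ _), ← Zel_mul_Zel_zero (h 0), mul_assoc,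
        Zel_zero_mul_Zel (h 0), h3, hz, mul_zero]

end Elements

end

end SL2Hyper

namespace SL2Hyper

noncomputable section

/-! ### The algebra `𝒜_r` -/

section Level

variable {k : Type*} [Field k] {p : ℕ} [Fact p.Prime] [CharP k p]

variable (k p) in
/-- The functions which are periodic modulo `p ^ r`. -/
def perLevel (r : ℕ) : Subalgebra k (PerFun k p) where
  carrier := {f | Function.Periodic f.1 ((p : ℤ) ^ r)}
  mul_mem' := fun hf hg => hf.mul hg
  add_mem' := fun hf hg => hf.add hg
  algebraMap_mem' := fun _ _ => rfl

theorem bin_mem_perLevel (c : ℤ) {m r : ℕ} (h : m < p ^ r) : bin k p c m ∈ perLevel k p r :=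
  bin_periodic c h

theorem shift_mem_perLevel (c : ℤ) {r : ℕ} {f : PerFun k p} (h : f ∈ perLevel k p r) :
    shift c f ∈ perLevel k p r := fun N => by
  rw [shift_apply, shift_apply, add_right_comm]; exact h _

theorem pull_mem_perLevel {r : ℕ} {f : PerFun k p} (h : f ∈ perLevel k p r) :
    pull f ∈ perLevel k p (r + 1) := fun N => by
  have hp : (p : ℤ) ≠ 0 := by exact_mod_cast (Fact.out : p.Prime).ne_zero
  rw [pull_apply, pull_apply, pow_succ, Int.add_mul_ediv_right _ _ hp]; exact h _

theorem ind_mem_perLevel (b : ℤ) (r : ℕ) : (ind b : PerFun k p) ∈ perLevel k p (r + 1) := fun N => by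
  rw [ind_apply, ind_apply]; simp

theorem exists_mem_perLevel (f : PerFun k p) : ∃ r, f ∈ perLevel k p r := f.2

/-! ### Binomial coefficients modulo p and generation by p-powers -/

theorem bin_eq_sum (c : ℤ) (m : ℕ) : bin k p c m =
    ∑ ij ∈ Finset.HasAntidiagonal.antidiagonal m, ((Ring.choose c ij.2 : ℤ) : k) • bin k p 0 ij.1 :=
  PerFun.ext fun N => by
    rw [bin_apply, Ring.add_choose_eq _ (Commute.all _ _), Int.cast_sum]
    have : ∀ s : Finset (ℕ × ℕ), (∑ ij ∈ s, ((Ring.choose c ij.2 : ℤ) : k) • bin k p 0 ij.1).1 N =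
        ∑ ij ∈ s, ((Ring.choose c ij.2 : ℤ) : k) * (Ring.choose N ij.1 : ℤ) := fun s => by
      induction s using Finset.cons_induction with
      | empty => rfl
      | cons a s ha ih =>
        rw [Finset.sum_cons, Finset.sum_cons, ← ih]
        change _ * (bin k p 0 a.1).1 N + _ = _
        rw [bin_apply, add_zero]
    rw [this]
    exact Finset.sum_congr rfl fun ij _ => by push_cast; ring

theorem bin_mul_bin (q n : ℕ) : bin k p 0 q * bin k p (-q) n = ((n + q).choose q : k) • bin k p 0 (n + q) :=
  PerFun.ext fun N => by
    have h := congrArg (Int.cast : ℤ → k) (Ring.choose_add_smul_choose (N - q) n q)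
    rw [nsmul_eq_mul, Int.cast_mul, Int.cast_mul, sub_add_cancel] at h
    change (bin k p 0 q).1 N * (bin k p (-q) n).1 N = _ * (bin k p 0 (n + q)).1 N
    rw [bin_apply, bin_apply, bin_apply, add_zero, ← sub_eq_add_neg, ← h]
    simp

-- By Lucas this binomial coefficient is the leading p-adic digit of m. So the m-th divided power is
-- a unit multiple of the product of those of exponents p^i and m - p^i, with p^i the largest power
-- of p not exceeding m.
variable (k) in
theorem choose_log_ne_zero {m : ℕ} (hm : m ≠ 0) : (m.choose (p ^ Nat.log p m) : k) ≠ 0 := by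
  have hpp : p.Prime := Fact.out
  induction m using Nat.strong_induction_on with
  | h m ih =>
    rcases lt_or_ge m p with h | h
    · rw [Nat.log_of_lt h, pow_zero, Nat.choose_one_right, Ne, CharP.cast_eq_zero_iff k p]
      exact Nat.not_dvd_of_pos_of_lt (Nat.pos_of_ne_zero hm) h
    · have hq : m / p ≠ 0 := (Nat.div_pos h hpp.pos).ne'
      have h1 := ih (m / p) (Nat.div_lt_self (Nat.pos_of_ne_zero hm) hpp.one_lt) hq
      have h2 := Choose.choose_modEq_choose_mod_mul_choose_div_nat (n := m)
        (k := p ^ (Nat.log p (m / p) + 1)) (p := p)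
      rw [pow_succ, Nat.mul_mod_left, Nat.choose_zero_right, one_mul,
        Nat.mul_div_cancel _ hpp.pos] at h2
      rw [Nat.log_of_one_lt_of_le hpp.one_lt h, pow_succ]
      rwa [(CharP.natCast_eq_natCast k p).2 h2]

-- Adding m and u produces a carry. If it happens in the last digit, that digit of the sum is
-- smaller than the one of m and the Lucas factor is 0; otherwise the quotients by p are treated
-- inductively. Consequently divided powers with exponents below p^r are closed under products.
variable (k) in
theorem choose_add_eq_zero {r m u : ℕ} (hm : m < p ^ r) (hu : u < p ^ r) (h : p ^ r ≤ m + u) :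
    ((m + u).choose m : k) = 0 := by
  have hpp : p.Prime := Fact.out
  rw [CharP.cast_eq_zero_iff k p]
  induction r generalizing m u with
  | zero => rw [pow_zero] at hm hu h; omega
  | succ r ih =>
    have h2 := Choose.choose_modEq_choose_mod_mul_choose_div_nat (n := m + u) (k := m) (p := p)
    rw [← Nat.modEq_zero_iff_dvd]
    refine h2.trans ?_
    have hpr : p ^ (r + 1) = p * p ^ r := pow_succ' _ _
    have em := Nat.div_add_mod m p
    have eu := Nat.div_add_mod u p
    have lm := Nat.mod_lt m hpp.pos
    have lu := Nat.mod_lt u hpp.pos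
    rw [Nat.modEq_zero_iff_dvd]
    rcases lt_or_ge (m % p + u % p) p with hc | hc
    · refine Dvd.dvd.mul_left ?_ _
      rw [Nat.add_div hpp.pos, if_neg (by omega), add_zero]
      refine ih (Nat.div_lt_of_lt_mul (by rwa [← hpr])) (Nat.div_lt_of_lt_mul (by rwa [← hpr])) ?_
      have : p * p ^ r < p * (m / p + u / p + 1) := by
        rw [← hpr]; rw [mul_add, mul_add]; omega
      have := Nat.lt_of_mul_lt_mul_left this
      omega
    · have : (m + u) % p < m % p := by
        rw [Nat.add_mod, Nat.mod_eq_sub_mod hc, Nat.mod_eq_of_lt (by omega)]; omega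
      rw [Nat.choose_eq_zero_of_lt this, zero_mul]
      exact dvd_zero _

variable (k p) in
/-- The span of the `Y^(u) F X^(v)` with `(u, v)` in a given set and `F` in a given subalgebra. -/
def triSpan (I : Set (ℕ × ℕ)) (T : Subalgebra k (PerFun k p)) : Submodule k (Hyp k) :=
  Submodule.span k {x | ∃ u v F, (u, v) ∈ I ∧ F ∈ T ∧ x = tri u F v}

theorem tri_mem_triSpan {I : Set (ℕ × ℕ)} {T : Subalgebra k (PerFun k p)} {u v : ℕ} {F : PerFun k p}
    (h : (u, v) ∈ I) (hF : F ∈ T) : tri u F v ∈ triSpan k p I T :=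
  Submodule.subset_span ⟨u, v, F, h, hF, rfl⟩

theorem triSpan_le {I : Set (ℕ × ℕ)} {T : Subalgebra k (PerFun k p)} {W : Submodule k (Hyp k)}
    (h : ∀ u v F, (u, v) ∈ I → F ∈ T → tri u F v ∈ W) : triSpan k p I T ≤ W :=
  Submodule.span_le.2 (by rintro _ ⟨u, v, F, h1, h2, rfl⟩; exact h u v F h1 h2)

theorem mul_mem_triSpan {I J : Set (ℕ × ℕ)} {T S : Subalgebra k (PerFun k p)} {y x : Hyp k}
    (h : ∀ u v F, (u, v) ∈ I → F ∈ T → y * tri u F v ∈ triSpan k p J S)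
    (hx : x ∈ triSpan k p I T) : y * x ∈ triSpan k p J S :=
  triSpan_le (W := (triSpan k p J S).comap (LinearMap.mulLeft k y)) h hx

theorem one_eq_tri : (1 : Hyp k) = tri 0 (1 : PerFun k p) 0 := by
  rw [tri, dY_zero, dX_zero, map_one, mul_one, mul_one]

/-- A subalgebra generated by elements which stabilize a subspace containing `1` lies in it. -/
theorem adjoin_le_of_mul_mem {A : Type*} [Ring A] [Algebra k A] {G : Set A} {W : Submodule k A}
    (h1 : 1 ∈ W) (hG : ∀ g ∈ G, ∀ x ∈ W, g * x ∈ W) {y : A} (hy : y ∈ Algebra.adjoin k G) : y ∈ W := by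
  have : ∀ x ∈ W, y * x ∈ W := by
    induction hy using Algebra.adjoin_induction with
    | mem g hg => exact hG g hg
    | algebraMap c => intro x hx; rw [← Algebra.smul_def]; exact W.smul_mem _ hx
    | add a b _ _ ha hb => intro x hx; rw [add_mul]; exact W.add_mem (ha x hx) (hb x hx)
    | mul a b _ _ ha hb => intro x hx; rw [mul_assoc]; exact ha _ (hb x hx)
  simpa using this 1 h1

variable (p) in
/-- The pairs of numbers less than `p ^ r`. -/
def boxSet (r : ℕ) : Set (ℕ × ℕ) := {q | q.1 < p ^ r ∧ q.2 < p ^ r}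

/-! ### Upper bounds for 𝒰_r and 𝒜 in triangular form -/

theorem dY_mul_mem_triSpan {r m : ℕ} (hm : m < p ^ r) {x : Hyp k}
    (hx : x ∈ triSpan k p (boxSet p r) (perLevel k p r)) :
    dY k m * x ∈ triSpan k p (boxSet p r) (perLevel k p r) := by
  refine mul_mem_triSpan (fun u v F huv hF => ?_) hx
  rw [dY_mul_tri]
  rcases lt_or_ge (m + u) (p ^ r) with h | h
  · exact Submodule.smul_mem _ _ (tri_mem_triSpan ⟨h, huv.2⟩ hF)
  · rw [choose_add_eq_zero k hm huv.1 h, zero_smul]; exact zero_mem _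

theorem dX_mul_mem_triSpan {r m : ℕ} (hm : m < p ^ r) {x : Hyp k}
    (hx : x ∈ triSpan k p (boxSet p r) (perLevel k p r)) :
    dX k m * x ∈ triSpan k p (boxSet p r) (perLevel k p r) := by
  refine mul_mem_triSpan (fun u v F huv hF => ?_) hx
  rw [dX_mul_tri]
  refine Submodule.sum_mem _ fun l hl => ?_
  have hl' : l ≤ m := by have := Finset.mem_range.1 hl; omega
  have hu := huv.1
  have hv := huv.2
  rcases lt_or_ge (m - l + v) (p ^ r) with h | h
  · refine Submodule.smul_mem _ _ (tri_mem_triSpan ⟨?_, h⟩ ?_)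
    · change u - l < _
      dsimp only at hu; omega
    · exact mul_mem (bin_mem_perLevel _ (by omega)) (shift_mem_perLevel _ hF)
  · rw [choose_add_eq_zero k (by omega) hv h, zero_smul]; exact zero_mem _

theorem frobKernelAlg_le {r : ℕ} {x : Hyp k} (hx : x ∈ frobKernelAlg k p r) :
    x ∈ triSpan k p (boxSet p r) (perLevel k p r) := by
  have hpp : p.Prime := Fact.out
  refine adjoin_le_of_mul_mem ?_ ?_ hx
  · rw [one_eq_tri (p := p)]
    exact tri_mem_triSpan ⟨pow_pos hpp.pos _, pow_pos hpp.pos _⟩ (one_mem _)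
  · rintro g ⟨i, hi, rfl | rfl⟩ x hx
    · exact dX_mul_mem_triSpan (Nat.pow_lt_pow_right hpp.one_lt hi) hx
    · exact dY_mul_mem_triSpan (Nat.pow_lt_pow_right hpp.one_lt hi) hx

/-- The pairs of equal numbers. -/
def diagSet : Set (ℕ × ℕ) := {q | q.1 = q.2}

theorem cartan_mul_mem_triSpan {x : Hyp k} (G : PerFun k p)
    (hx : x ∈ triSpan k p diagSet ⊤) : cartan k p G * x ∈ triSpan k p diagSet ⊤ := by
  refine mul_mem_triSpan (fun u v F huv hF => ?_) hx
  rw [cartan_mul_tri]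
  exact tri_mem_triSpan huv trivial

theorem dY_mul_dX_mul_mem_triSpan {x : Hyp k} (m : ℕ)
    (hx : x ∈ triSpan k p diagSet ⊤) : dY k m * dX k m * x ∈ triSpan k p diagSet ⊤ := by
  refine mul_mem_triSpan (fun u v F huv hF => ?_) hx
  obtain rfl : u = v := huv
  rw [mul_assoc, dX_mul_tri, Finset.mul_sum]
  refine Submodule.sum_mem _ fun l hl => ?_
  have hl' : l ≤ m ∧ l ≤ u := by have := Finset.mem_range.1 hl; omega
  rw [mul_smul_comm, dY_mul_tri]
  refine Submodule.smul_mem _ _ (Submodule.smul_mem _ _ (tri_mem_triSpan ?_ trivial))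
  change m + (u - l) = m - l + u
  omega

theorem cartanAlg_le {x : Hyp k} (hx : x ∈ cartanAlg k p) : ∃ F, cartan k p F = x := by
  have : cartanAlg k p ≤ (cartan k p).range := Algebra.adjoin_le (by
    rintro _ ⟨i, rfl⟩
    exact ⟨_, cartan_bin 0 (p ^ i)⟩)
  exact this hx

theorem degZeroAlg_le {x : Hyp k} (hx : x ∈ degZeroAlg k p) : x ∈ triSpan k p diagSet ⊤ := by
  refine adjoin_le_of_mul_mem ?_ ?_ hx
  · rw [one_eq_tri (p := p)]
    exact tri_mem_triSpan rfl trivial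
  · rintro g (hg | ⟨i, rfl⟩) x hx
    · obtain ⟨F, rfl⟩ := cartanAlg_le hg
      exact cartan_mul_mem_triSpan F hx
    · exact dY_mul_dX_mul_mem_triSpan _ hx

/-! #### Lower bounds -/

/-- `Y^(m)` or `X^(m)` from the divided powers with smaller exponents. -/
theorem dp_mem {A : Subalgebra k (Hyp k)} {d : ℕ → Hyp k} (h0 : d 0 = 1)
    (hd : ∀ m n, d m * d n = ((m + n).choose m : k) • d (m + n)) {r : ℕ}
    (hA : ∀ i < r, d (p ^ i) ∈ A) {m : ℕ} (hm : m < p ^ r) : d m ∈ A := by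
  have hpp : p.Prime := Fact.out
  induction m using Nat.strong_induction_on with
  | h m ih =>
    rcases eq_or_ne m 0 with rfl | hm0
    · rw [h0]; exact one_mem _
    · set i := Nat.log p m
      have h1 : p ^ i ≤ m := Nat.pow_log_le_self p hm0
      have hi : i < r := (Nat.pow_lt_pow_iff_right hpp.one_lt).1 (h1.trans_lt hm)
      have hpos : 0 < p ^ i := pow_pos hpp.pos _
      have h2 := A.mul_mem (hA i hi) (ih (m - p ^ i) (by omega) (by omega))
      rw [hd, Nat.add_sub_cancel' h1] at h2
      have h3 := A.smul_mem h2 ((m.choose (p ^ i) : k)⁻¹)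
      rwa [smul_smul, inv_mul_cancel₀ (choose_log_ne_zero k hm0), one_smul] at h3

theorem dX_mem_frobKernelAlg {r m : ℕ} (hm : m < p ^ r) : dX k m ∈ frobKernelAlg k p r :=
  dp_mem dX_zero dX_mul_dX (A := frobKernelAlg k p r)
    (fun i hi => Algebra.subset_adjoin ⟨i, hi, Or.inl rfl⟩) hm

theorem dY_mem_frobKernelAlg {r m : ℕ} (hm : m < p ^ r) : dY k m ∈ frobKernelAlg k p r :=
  dp_mem dY_zero dY_mul_dY (A := frobKernelAlg k p r)
    (fun i hi => Algebra.subset_adjoin ⟨i, hi, Or.inr rfl⟩) hm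

theorem cartan_bin_mem {A : Subalgebra k (Hyp k)} {m : ℕ}
    (h : ∀ n ≤ m, cartan k p (bin k p 0 n) ∈ A) (c : ℤ) : cartan k p (bin k p c m) ∈ A := by
  rw [bin_eq_sum, map_sum]
  refine sum_mem fun ij hij => ?_
  rw [map_smul]
  exact A.smul_mem (h _ (by have := Finset.HasAntidiagonal.mem_antidiagonal.1 hij; omega)) _

theorem cartan_mem_of_bin {A : Subalgebra k (Hyp k)} {r : ℕ}
    (h : ∀ n < p ^ r, cartan k p (bin k p 0 n) ∈ A) {F : PerFun k p} (hF : F ∈ perLevel k p r) :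
    cartan k p F ∈ A := by
  rw [periodic_eq_sum_bin hF, map_sum]
  refine sum_mem fun n hn => ?_
  rw [map_smul]
  exact A.smul_mem (h n (Finset.mem_range.1 hn)) _

/-- (H choose n) is the last term of X^(n) Y^(n); the other terms involve only binomials of smaller
degree. -/
theorem cartan_mem_frobKernelAlg {r : ℕ} {F : PerFun k p} (hF : F ∈ perLevel k p r) :
    cartan k p F ∈ frobKernelAlg k p r := by
  refine cartan_mem_of_bin (fun n hn => ?_) hF
  induction n using Nat.strong_induction_on with
  | h n ih =>
    have h := dX_mul_dY (k := k) p n n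
    rw [min_self, Finset.sum_range_succ, Nat.sub_self, dY_zero, dX_zero, one_mul, mul_one,
      show (2 * n - n - n : ℤ) = 0 by ring] at h
    rw [← sub_eq_iff_eq_add'.2 h]
    refine sub_mem (mul_mem (dX_mem_frobKernelAlg hn) (dY_mem_frobKernelAlg hn))
      (sum_mem fun l hl => ?_)
    have hl := Finset.mem_range.1 hl
    exact mul_mem (mul_mem (dY_mem_frobKernelAlg (by omega))
      (cartan_bin_mem (fun n' hn' => ih n' (by omega) (by omega)) _)) (dX_mem_frobKernelAlg (by omega))

/-- With q the largest power of p not exceeding n, (H choose q)(H-q choose n-q) is a nonzero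
multiple of (H choose n), and the second factor has smaller degree. -/
theorem cartan_mem_cartanAlg (F : PerFun k p) : cartan k p F ∈ cartanAlg k p := by
  have hpp : p.Prime := Fact.out
  obtain ⟨r, hr⟩ := exists_mem_perLevel F
  refine cartan_mem_of_bin (fun n hn => ?_) hr
  induction n using Nat.strong_induction_on with
  | h n ih =>
    rcases eq_or_ne n 0 with rfl | hn0
    · rw [bin_zero, map_one]; exact one_mem _
    · set i := Nat.log p n
      have h1 : p ^ i ≤ n := Nat.pow_log_le_self p hn0
      have hpos : 0 < p ^ i := pow_pos hpp.pos _
      have h2 := bin_mul_bin (k := k) (p := p) (p ^ i) (n - p ^ i)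
      rw [Nat.sub_add_cancel h1] at h2
      have hq : cartan k p (bin k p 0 (p ^ i)) ∈ cartanAlg k p := by
        rw [cartan_bin]; exact Algebra.subset_adjoin ⟨i, rfl⟩
      have h3 := (cartanAlg k p).mul_mem hq
        (cartan_bin_mem (A := cartanAlg k p) (m := n - p ^ i) (fun n' hn' => ih n' (by omega) (by omega))
          (-(p ^ i : ℕ)))
      rw [← map_mul, h2, map_smul] at h3
      have h4 := (cartanAlg k p).smul_mem h3 ((n.choose (p ^ i) : k)⁻¹)
      rwa [smul_smul, inv_mul_cancel₀ (choose_log_ne_zero k hn0), one_smul] at h4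

theorem cartan_mem_degZeroAlg (F : PerFun k p) : cartan k p F ∈ degZeroAlg k p :=
  Algebra.subset_adjoin (Or.inl (cartan_mem_cartanAlg F))

theorem tri_eq_dY_mul_dX_mul (m : ℕ) (F : PerFun k p) :
    tri m F m = dY k m * dX k m * cartan k p (shift (2 * m) F) := by
  rw [tri, mul_assoc, cartan_mul_dX, mul_assoc]

/-- With q the largest power of p not exceeding m, the leading term of Y^(q)X^(q) · Y^(m-q)X^(m-q)
is (m choose q)² Y^(m)X^(m), with nonzero coefficient. The remaining terms have smaller exponents
and are known inductively. -/
theorem dY_mul_dX_mem_degZeroAlg (m : ℕ) : dY k m * dX k m ∈ degZeroAlg k p := by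
  have hpp : p.Prime := Fact.out
  induction m using Nat.strong_induction_on with
  | h m ih =>
    rcases eq_or_ne m 0 with rfl | hm0
    · rw [dY_zero, dX_zero, one_mul]; exact one_mem _
    · set i := Nat.log p m
      have h1 : p ^ i ≤ m := Nat.pow_log_le_self p hm0
      have hpos : 0 < p ^ i := pow_pos hpp.pos _
      set q := p ^ i
      have hq : dY k q * dX k q ∈ degZeroAlg k p := Algebra.subset_adjoin (Or.inr ⟨i, rfl⟩)
      have h2 := (degZeroAlg k p).mul_mem hq (ih (m - q) (by omega))
      have e : dY k q * dX k q * (dY k (m - q) * dX k (m - q)) =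
          dY k q * (dX k q * tri (m - q) (1 : PerFun k p) (m - q)) := by
        rw [tri, map_one, mul_one, mul_assoc]
      rw [e, dX_mul_tri, Finset.sum_range_succ', mul_add, Finset.mul_sum, Nat.sub_zero, Nat.sub_zero,
        mul_smul_comm, dY_mul_tri, Nat.add_sub_cancel' h1, bin_zero, map_one, mul_one] at h2
      have h3 : ∑ l ∈ Finset.range (min q (m - q)), dY k q *
          ((q - (l + 1) + (m - q)).choose (q - (l + 1)) : k) • tri (m - q - (l + 1))
            (bin k p (2 * (l + 1 : ℕ) - q - (m - q : ℕ)) (l + 1) *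
              shift (-2 * (q - (l + 1) : ℕ)) (1 : PerFun k p)) (q - (l + 1) + (m - q)) ∈
          degZeroAlg k p := by
        refine sum_mem fun l hl => ?_
        have hl := Finset.mem_range.1 hl
        rw [mul_smul_comm, dY_mul_tri, show q - (l + 1) + (m - q) = q + (m - q - (l + 1)) by omega,
          tri_eq_dY_mul_dX_mul]
        exact (degZeroAlg k p).smul_mem ((degZeroAlg k p).smul_mem
          (mul_mem (ih _ (by omega)) (cartan_mem_degZeroAlg _)) _) _
      have h4 := sub_mem h2 h3
      rw [add_sub_cancel_left, smul_smul] at h4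
      have h5 := (degZeroAlg k p).smul_mem h4 ((m.choose q : k) * (m.choose q : k))⁻¹
      rwa [smul_smul, inv_mul_cancel₀ (mul_ne_zero (choose_log_ne_zero k hm0)
        (choose_log_ne_zero k hm0)), one_smul, tri, map_one, mul_one] at h5

theorem tri_mem_Ar {r m : ℕ} (hm : m < p ^ r) {F : PerFun k p} (hF : F ∈ perLevel k p r) :
    tri m F m ∈ Ar k p r := by
  refine ⟨?_, ?_⟩
  · rw [tri_eq_dY_mul_dX_mul]
    exact mul_mem (dY_mul_dX_mem_degZeroAlg m) (cartan_mem_degZeroAlg _)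
  · exact mul_mem (mul_mem (dY_mem_frobKernelAlg hm) (cartan_mem_frobKernelAlg hF))
      (dX_mem_frobKernelAlg hm)

theorem Bel_mem_triSpan {r : ℕ} (ε : Fin r → Fin 2) {a : Fin r → ℕ} {j : Fin r → ℚ}
    (h : ∀ i, (a i, j i) ∈ pairSet p) :
    Bel k p r ε a j ∈ triSpan k p (diagSet ∩ boxSet p r) (perLevel k p r) := by
  have hpp : p.Prime := Fact.out
  induction r with
  | zero =>
    rw [Bel, one_eq_tri (p := p)]
    exact tri_mem_triSpan ⟨rfl, one_pos, one_pos⟩ (one_mem _)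
  | succ r ih =>
    rw [Bel_succ _ (h 0), Zel_eq_mu_mul_sum _ (h 0), Finset.mul_sum]
    refine Submodule.sum_mem _ fun m hm => ?_
    rw [mul_smul_comm]
    refine Submodule.smul_mem _ _ ?_
    have hm := Finset.mem_Icc.1 hm
    have hmp : m < p := by have := hpp.pos; omega
    have hs := (pairShift_le_nInt (ε 0) (h 0)).trans hm.1
    set s := pairShift p (a 0) (j 0)
    have hz := ih (fun i => ε i.succ) fun i => h i.succ
    set W := triSpan k p (diagSet ∩ boxSet p (r + 1)) (perLevel k p (r + 1))
    let f : Hyp k →ₗ[k] Hyp k := LinearMap.mulLeft k (mu k p (a 0)) ∘ₗ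
      LinearMap.mulRight k (dX k 1 ^ s) ∘ₗ
      LinearMap.mulLeft k (dY k 1 ^ m * dX k 1 ^ (m - s)) ∘ₗ frobSection k p
    refine triSpan_le (W := W.comap f) ?_ hz
    rintro u v F ⟨huv, hu, -⟩ hF
    obtain rfl : u = v := huv
    change mu k p (a 0) * (dY k 1 ^ m * dX k 1 ^ (m - s) * frobSection k p (tri u F u) *
      dX k 1 ^ s) ∈ W
    rw [mu_mul_tri_twist _ hs hmp]
    have hlt : u * p + m < p ^ (r + 1) := by
      have hu : u + 1 ≤ p ^ r := hu
      calc u * p + m < (u + 1) * p := by rw [add_mul, one_mul]; omega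
        _ ≤ p ^ (r + 1) := by rw [pow_succ]; exact Nat.mul_le_mul_right _ hu
    exact W.smul_mem _ (tri_mem_triSpan ⟨rfl, hlt, hlt⟩ (mul_mem (ind_mem_perLevel _ _)
      (shift_mem_perLevel _ (pull_mem_perLevel hF))))

theorem Bel_mem_Ar {r : ℕ} (ε : Fin r → Fin 2) {a : Fin r → ℕ} {j : Fin r → ℚ}
    (h : ∀ i, (a i, j i) ∈ pairSet p) : Bel k p r ε a j ∈ Ar k p r := by
  refine triSpan_le (W := Subalgebra.toSubmodule (Ar k p r)) ?_ (Bel_mem_triSpan ε h)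
  rintro u v F ⟨huv, hu, -⟩ hF
  obtain rfl : u = v := huv
  exact tri_mem_Ar hu hF

/-! #### The dimension -/

/-- Membership in 𝒰_r bounds the exponents by p^r, membership in 𝒜 makes those of Y and X equal.
Both conditions say that the support lies in a set of vectors of one and the same basis, so they can
be intersected. -/
theorem Ar_le_span (r : ℕ) : Subalgebra.toSubmodule (Ar k p r) ≤
    Submodule.span k (monBasis k '' {w | w.1 < p ^ r ∧ w.2.1 < p ^ r ∧ w.1 = w.2.2}) := by
  intro x hx
  have h1 : x ∈ Submodule.span k (monBasis k '' {w | w.1 < p ^ r ∧ w.2.1 < p ^ r}) := by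
    refine triSpan_le ?_ (frobKernelAlg_le hx.2)
    intro u v F huv hF
    have : tri u F v ∈ (Submodule.span k (monBasis k '' {w | w.1 < p ^ r ∧ w.2.1 < p ^ r})) := by
      change triLin (k := k) (p := p) u v F ∈ _
      rw [periodic_eq_sum_bin hF, map_sum]
      refine Submodule.sum_mem _ fun n hn => ?_
      rw [map_smul]
      refine Submodule.smul_mem _ _ (Submodule.subset_span ⟨(u, n, v), ⟨huv.1, Finset.mem_range.1 hn⟩, ?_⟩)
      exact monBasis_eq_tri (p := p) (u, n, v)
    exact this
  have h2 : x ∈ Submodule.span k (monBasis k '' {w | w.1 = w.2.2}) := by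
    refine triSpan_le ?_ (degZeroAlg_le hx.1)
    intro u v F huv _
    obtain rfl : u = v := huv
    obtain ⟨r, hF⟩ := exists_mem_perLevel F
    have : triLin (k := k) (p := p) u u F ∈ (Submodule.span k (monBasis k '' {w | w.1 = w.2.2})) := by
      rw [periodic_eq_sum_bin hF, map_sum]
      refine Submodule.sum_mem _ fun n hn => ?_
      rw [map_smul]
      refine Submodule.smul_mem _ _ (Submodule.subset_span ⟨(u, n, u), rfl, ?_⟩)
      exact monBasis_eq_tri (p := p) (u, n, u)
    exact this
  rw [Module.Basis.mem_span_image] at h1 h2 ⊢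
  intro w hw
  exact ⟨(h1 hw).1, (h1 hw).2, h2 hw⟩

theorem finite_Ar_and_finrank_le (r : ℕ) : Module.Finite k (Ar k p r) ∧
    Module.finrank k (Ar k p r) ≤ p ^ r * p ^ r := by
  classical
  set S : Finset (Hyp k) := (Finset.range (p ^ r) ×ˢ Finset.range (p ^ r)).image
    fun w => monBasis k (w.1, w.2, w.1)
  have hle : Subalgebra.toSubmodule (Ar k p r) ≤ Submodule.span k (S : Set (Hyp k)) := by
    refine (Ar_le_span r).trans (Submodule.span_mono ?_)
    rintro _ ⟨⟨m, n, m'⟩, ⟨h1, h2, h3⟩, rfl⟩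
    obtain rfl : m = m' := h3
    exact Finset.mem_coe.2 (Finset.mem_image.2 ⟨(m, n), by simpa using ⟨h1, h2⟩, rfl⟩)
  have hfin : Module.Finite k (Submodule.span k (S : Set (Hyp k))) :=
    FiniteDimensional.span_finset k S
  have h1 : Module.Finite k (Subalgebra.toSubmodule (Ar k p r)) :=
    Submodule.finiteDimensional_of_le hle
  refine ⟨h1, ?_⟩
  have h2 : Module.finrank k (Subalgebra.toSubmodule (Ar k p r)) ≤ S.card :=
    (Submodule.finrank_mono hle).trans (finrank_span_finset_le_card S)
  refine h2.trans (Finset.card_image_le.trans ?_)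
  simp

end Level

end

end SL2Hyper

namespace SL2Hyper

noncomputable section

/-! ### Algebras with a basis indexed by points and sets -/

section Abstract

variable {k : Type*} [Field k] {U : Type*} [Ring U] [Algebra k U] {E ι : Type*} [DecidableEq ι]

/-- The multiplication rules of a family `β e S`, where `S` runs through the subsets of `F e`: it
behaves like the family of squarefree monomials in the product over `e` of the algebras
`k[x_s : s ∈ F e] / (x_s²)`. -/
structure IsMonomialFamily (F : E → Finset ι) (β : E → Finset ι → U) : Prop where
  mul_of_ne : ∀ {e e'} S S', e ≠ e' → β e S * β e' S' = 0
  mul_union : ∀ {e S S'}, S ⊆ F e → S' ⊆ F e → Disjoint S S' → β e S * β e S' = β e (S ∪ S')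
  mul_eq_zero : ∀ {e S S'}, S ⊆ F e → S' ⊆ F e → ¬ Disjoint S S' → β e S * β e S' = 0
  ne_zero : ∀ e, β e (F e) ≠ 0

namespace IsMonomialFamily

variable {F : E → Finset ι} {β : E → Finset ι → U}

/-- In a relation choose a monomial S of least degree in a block and multiply by its complement in F
e: every other monomial meets the complement, and only the nonzero top monomial survives. -/
theorem linearIndependent (h : IsMonomialFamily F β) : LinearIndependent k
    fun x : {x : E × Finset ι // x.2 ⊆ F x.1} => β x.1.1 x.1.2 := by
  classical
  rw [linearIndependent_iff']
  intro s g hg x₀ hx₀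
  by_contra hne
  set e := x₀.1.1
  obtain ⟨x, hx, hmin⟩ := (s.filter fun x => x.1.1 = e ∧ g x ≠ 0).exists_min_image
    (fun x => x.1.2.card) ⟨x₀, Finset.mem_filter.2 ⟨hx₀, rfl, hne⟩⟩
  obtain ⟨hxs, hxe, hgx⟩ := Finset.mem_filter.1 hx
  have h1 := congrArg (· * β e (F e \ x.1.2)) hg
  simp only [zero_mul, Finset.sum_mul, smul_mul_assoc] at h1
  have hsub : x.1.2 ⊆ F e := hxe ▸ x.2
  rw [Finset.sum_eq_single x] at h1
  · rw [hxe, h.mul_union hsub Finset.sdiff_subset Finset.disjoint_sdiff,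
      Finset.union_sdiff_of_subset hsub] at h1
    exact (smul_ne_zero hgx (h.ne_zero e)) h1
  · intro y hy hyx
    by_cases hye : y.1.1 = e
    · have hysub : y.1.2 ⊆ F e := hye ▸ y.2
      by_cases hd : Disjoint y.1.2 (F e \ x.1.2)
      · have hyx' : y.1.2 ⊆ x.1.2 := fun i hi => by
          by_contra hix
          exact Finset.disjoint_left.1 hd hi (Finset.mem_sdiff.2 ⟨hysub hi, hix⟩)
        by_cases hgy : g y = 0
        · rw [hgy, zero_smul]
        · have := hmin y (Finset.mem_filter.2 ⟨hy, hye, hgy⟩)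
          have h2 := Finset.eq_of_subset_of_card_le hyx' this
          exact absurd (Subtype.ext (Prod.ext (hye.trans hxe.symm) h2)) hyx
      · rw [hye, h.mul_eq_zero hysub Finset.sdiff_subset hd, smul_zero]
    · rw [h.mul_of_ne _ _ hye, smul_zero]
  · exact fun h' => absurd hxs h'

variable (k F β) in
/-- The span of the `β e S` with `S` of cardinality at least `n`. -/
def level (n : ℕ) : Submodule k U :=
  Submodule.span k {x | ∃ e S, S ⊆ F e ∧ n ≤ S.card ∧ x = β e S}

variable (k F β) in
/-- The span of the `β e S` with `S₀ ⊆ S` and `S` of cardinality at least `n`. -/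
def levelAt (e : E) (S₀ : Finset ι) (n : ℕ) : Submodule k U :=
  Submodule.span k {x | ∃ S, S₀ ⊆ S ∧ S ⊆ F e ∧ n ≤ S.card ∧ x = β e S}

theorem level_antitone {m n : ℕ} (hmn : m ≤ n) : level k F β n ≤ level k F β m :=
  Submodule.span_mono fun _ ⟨e, S, h1, h2, h3⟩ => ⟨e, S, h1, hmn.trans h2, h3⟩

theorem mem_level {n : ℕ} {e : E} {S : Finset ι} (h1 : S ⊆ F e) (h2 : n ≤ S.card) :
    β e S ∈ level k F β n := Submodule.subset_span ⟨e, S, h1, h2, rfl⟩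

theorem mem_levelAt {n : ℕ} {e : E} {S₀ S : Finset ι} (h0 : S₀ ⊆ S) (h1 : S ⊆ F e)
    (h2 : n ≤ S.card) : β e S ∈ levelAt k F β e S₀ n :=
  Submodule.subset_span ⟨S, h0, h1, h2, rfl⟩

/-- Products of elements of spans. -/
theorem _root_.Submodule.mul_mem_of_span {s t : Set U} {W : Submodule k U}
    (h : ∀ x ∈ s, ∀ y ∈ t, x * y ∈ W) {x y : U} (hx : x ∈ Submodule.span k s)
    (hy : y ∈ Submodule.span k t) : x * y ∈ W := by
  have := Submodule.mul_mem_mul hx hy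
  rw [Submodule.span_mul_span] at this
  refine Submodule.span_le.2 ?_ this
  rintro _ ⟨a, ha, b, hb, rfl⟩
  exact h a ha b hb

theorem mul_mem_level (h : IsMonomialFamily F β) {m n : ℕ} {x y : U} (hx : x ∈ level k F β m)
    (hy : y ∈ level k F β n) : x * y ∈ level k F β (m + n) := by
  refine Submodule.mul_mem_of_span ?_ hx hy
  rintro _ ⟨e, S, h1, h2, rfl⟩ _ ⟨e', S', h1', h2', rfl⟩
  by_cases he : e = e'
  · subst he
    by_cases hd : Disjoint S S'
    · rw [h.mul_union h1 h1' hd]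
      refine mem_level (Finset.union_subset h1 h1') ?_
      rw [Finset.card_union_of_disjoint hd]; omega
    · rw [h.mul_eq_zero h1 h1' hd]; exact zero_mem _
  · rw [h.mul_of_ne _ _ he]; exact zero_mem _

theorem mul_mem_levelAt (h : IsMonomialFamily F β) {m n : ℕ} {e : E} {S₀ : Finset ι} {x y : U}
    (hx : x ∈ level k F β m) (hy : y ∈ levelAt k F β e S₀ n) :
    x * y ∈ levelAt k F β e S₀ (m + n) := by
  refine Submodule.mul_mem_of_span ?_ hx hy
  rintro _ ⟨e', S', h1', h2', rfl⟩ _ ⟨S, h0, h1, h2, rfl⟩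
  by_cases he : e' = e
  · subst he
    by_cases hd : Disjoint S' S
    · rw [h.mul_union h1' h1 hd]
      refine mem_levelAt (h0.trans Finset.subset_union_right) (Finset.union_subset h1' h1) ?_
      rw [Finset.card_union_of_disjoint hd]; omega
    · rw [h.mul_eq_zero h1' h1 hd]; exact zero_mem _
  · rw [h.mul_of_ne _ _ he]; exact zero_mem _

theorem pow_mem_level (h : IsMonomialFamily F β) {x : U} (hx : x ∈ level k F β 1) (n : ℕ) :
    x ^ (n + 1) ∈ level k F β (n + 1) := by
  induction n with
  | zero => simpa using hx
  | succ n ih => rw [pow_succ]; exact h.mul_mem_level ih hx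

theorem level_eq_bot [Fintype ι] {n : ℕ} (hn : Fintype.card ι < n) : level k F β n = ⊥ := by
  rw [level, Submodule.span_eq_bot]
  rintro _ ⟨e, S, -, h2, -⟩
  have := S.card_le_univ
  omega

theorem levelAt_eq_bot {e : E} {S₀ : Finset ι} {n : ℕ} (hn : (F e).card < n) :
    levelAt k F β e S₀ n = ⊥ := by
  rw [levelAt, Submodule.span_eq_bot]
  rintro _ ⟨S, -, h1, h2, -⟩
  have := Finset.card_le_card h1
  omega

theorem empty_ne_zero (h : IsMonomialFamily F β) (e : E) : β e ∅ ≠ 0 := fun h0 => by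
  have := h.mul_union (Finset.empty_subset (F e)) (subset_refl (F e)) (Finset.disjoint_empty_left _)
  rw [h0, zero_mul, Finset.empty_union] at this
  exact h.ne_zero e this.symm

/-- Modulo monomials of positive degree, the block of e is the field k. -/
theorem empty_mul_sub_mem (h : IsMonomialFamily F β) (e : E) {x : U} (hx : x ∈ level k F β 0) :
    ∃ c : k, β e ∅ * x - c • β e ∅ ∈ level k F β 1 := by
  induction hx using Submodule.span_induction with
  | mem x hx =>
    obtain ⟨e', S, h1, -, rfl⟩ := hx
    by_cases he : e = e'
    · subst he
      rw [h.mul_union (Finset.empty_subset _) h1 (Finset.disjoint_empty_left _), Finset.empty_union]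
      rcases S.eq_empty_or_nonempty with rfl | hS
      · exact ⟨1, by rw [one_smul, sub_self]; exact zero_mem _⟩
      · refine ⟨0, ?_⟩
        rw [zero_smul, sub_zero]
        exact mem_level h1 hS.card_pos
    · exact ⟨0, by rw [h.mul_of_ne _ _ he, zero_smul, sub_zero]; exact zero_mem _⟩
  | zero => exact ⟨0, by simp⟩
  | add x y _ _ hx hy =>
    obtain ⟨c, hc⟩ := hx
    obtain ⟨d, hd⟩ := hy
    exact ⟨c + d, by
      have := add_mem hc hd
      rwa [sub_add_sub_comm, ← mul_add, ← add_smul] at this⟩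
  | smul d x _ hx =>
    obtain ⟨c, hc⟩ := hx
    exact ⟨d * c, by
      have := Submodule.smul_mem _ d hc
      rwa [smul_sub, ← mul_smul_comm, smul_smul] at this⟩

/-! #### The Jacobson radical -/

variable {A : Subalgebra k U}

/-- The elements of positive degree are nilpotent and form an ideal, hence lie in the radical.
Conversely, a nonzero constant term in some block would put the idempotent β e ∅ into the radical.
-/
theorem mem_jacobson_iff [Fintype ι] (h : IsMonomialFamily F β)
    (hA : Subalgebra.toSubmodule A = level k F β 0) (x : A) :
    x ∈ Ring.jacobson A ↔ (x : U) ∈ level k F β 1 := by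
  have hmem : ∀ y : A, (y : U) ∈ level k F β 0 := fun y => by rw [← hA]; exact y.2
  have hle : ∀ x : A, (x : U) ∈ level k F β 1 → x ∈ Ring.jacobson A := fun x hx => by
    rw [← Ideal.jacobson_bot, Ideal.mem_jacobson_iff]
    intro y
    have hyx : ((y * x : A) : U) ∈ level k F β 1 := by
      have := h.mul_mem_level (hmem y) hx
      rwa [zero_add] at this
    have hnil : IsNilpotent (y * x) := ⟨Fintype.card ι + 1, Subtype.ext (by
      have := h.pow_mem_level hyx (Fintype.card ι)
      rw [level_eq_bot (by omega), Submodule.mem_bot] at this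
      rw [SubmonoidClass.coe_pow, this]; rfl)⟩
    obtain ⟨u, hu⟩ := hnil.isUnit_one_add
    refine ⟨↑u⁻¹, ?_⟩
    rw [Submodule.mem_bot, mul_assoc, sub_eq_zero]
    calc (↑u⁻¹ : A) * (y * x) + ↑u⁻¹ = ↑u⁻¹ * (1 + y * x) := by rw [mul_add, mul_one, add_comm]
      _ = 1 := by rw [← hu, Units.inv_mul]
  refine ⟨fun hx => ?_, hle x⟩
  have hβ : ∀ {e S}, S ⊆ F e → β e S ∈ A := fun hS => by
    have := mem_level (k := k) (β := β) hS (Nat.zero_le _)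
    rw [← hA] at this; exact this
  have key : ∀ e, β e ∅ * (x : U) ∈ level k F β 1 := fun e => by
    obtain ⟨c, hc⟩ := h.empty_mul_sub_mem e (hmem x)
    set f : A := ⟨β e ∅, hβ (Finset.empty_subset _)⟩ with hf
    have hff : f * f = f := Subtype.ext (by
      change β e ∅ * β e ∅ = β e ∅
      rw [h.mul_union (Finset.empty_subset _) (Finset.empty_subset _) (Finset.disjoint_empty_left _),
        Finset.empty_union])
    have h1 : f * x - c • f ∈ Ring.jacobson A := hle _ hc
    have h2 : c • f ∈ Ring.jacobson A := by
      have := sub_mem (Ideal.mul_mem_left _ f hx) h1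
      rwa [sub_sub_cancel] at this
    by_cases hc0 : c = 0
    · rwa [hc0, zero_smul, sub_zero] at hc
    · exfalso
      have h3 : f ∈ Ring.jacobson A := by
        have := Ideal.mul_mem_left _ (algebraMap k A c⁻¹) h2
        rwa [← Algebra.smul_def, smul_smul, inv_mul_cancel₀ hc0, one_smul] at this
      rw [← Ideal.jacobson_bot, Ideal.mem_jacobson_iff] at h3
      -- This says that z is a left inverse of 1 - f; as (1 - f) f = 0, the idempotent f would be
      -- zero.
      obtain ⟨z, hz⟩ := h3 (-1)
      rw [Submodule.mem_bot, sub_eq_zero] at hz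
      have h4 : f = 0 := by
        rw [← one_mul f, ← hz, add_mul, mul_assoc _ f f, hff, ← add_mul, mul_neg_one, neg_add_cancel,
          zero_mul]
      have h5 := congrArg A.val h4
      rw [map_zero] at h5
      exact h.empty_ne_zero e h5
  -- Applied to y = 1, this spares writing 1 as the sum of the block idempotents.
  have h1 : ∀ y ∈ level k F β 0, y * (x : U) ∈ level k F β 1 := fun y hy => by
    refine Submodule.span_le (p := (level k F β 1).comap (LinearMap.mulRight k (x : U))).2 ?_ hy
    rintro _ ⟨e, S, h1, -, rfl⟩
    rcases S.eq_empty_or_nonempty with rfl | hS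
    · exact key e
    · have := h.mul_mem_level (mem_level (k := k) (β := β) h1 hS.card_pos) (hmem x)
      rwa [add_zero] at this
  simpa using h1 1 (hmem 1)

/-- Degrees add under multiplication, and a monomial of degree at least n + 1 is one of degree at
least n times a variable. -/
theorem mem_jacobson_pow_iff [Fintype ι] (h : IsMonomialFamily F β)
    (hA : Subalgebra.toSubmodule A = level k F β 0) (n : ℕ) (x : A) :
    x ∈ Ring.jacobson A ^ n ↔ (x : U) ∈ level k F β n := by
  have hmem : ∀ y : A, (y : U) ∈ level k F β 0 := fun y => by rw [← hA]; exact y.2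
  have hmem' : ∀ {y : U} {n}, y ∈ level k F β n → y ∈ A := fun hy => by
    have := level_antitone (Nat.zero_le _) hy
    rw [← hA] at this; exact this
  induction n generalizing x with
  | zero => rw [Submodule.pow_zero, Ideal.one_eq_top]; exact ⟨fun _ => hmem x, fun _ => Submodule.mem_top⟩
  | succ n ih =>
    rw [Submodule.pow_succ]
    constructor
    · intro hx
      refine Submodule.smul_induction_on (p := fun x : A => (x : U) ∈ level k F β (n + 1)) hx ?_ ?_
      · intro y hy z hz
        exact h.mul_mem_level ((ih y).1 hy) ((h.mem_jacobson_iff hA z).1 hz)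
      · intro y z hy hz; exact add_mem hy hz
    · intro hx
      have : ∀ u ∈ level k F β (n + 1), ∀ hu : u ∈ A, (⟨u, hu⟩ : A) ∈ Ring.jacobson A ^ n * Ring.jacobson A := by
        intro u hu
        induction hu using Submodule.span_induction with
        | mem u hu =>
          obtain ⟨e, S, h1, h2, rfl⟩ := hu
          intro hu
          obtain ⟨s, hs⟩ : S.Nonempty := Finset.card_pos.1 (by omega)
          have h3 : S.erase s ⊆ F e := (Finset.erase_subset _ _).trans h1
          have h4 : {s} ⊆ F e := by simpa using h1 hs
          have h5 : β e (S.erase s) ∈ level k F β n :=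
            mem_level h3 (by rw [Finset.card_erase_of_mem hs]; omega)
          have h6 : β e {s} ∈ level k F β 1 := mem_level h4 (by simp)
          have h7 : (⟨β e S, hu⟩ : A) = ⟨β e (S.erase s), hmem' h5⟩ * ⟨β e {s}, hmem' h6⟩ :=
            Subtype.ext (by
              change β e S = β e (S.erase s) * β e {s}
              rw [h.mul_union h3 h4 (by simp), Finset.union_comm, ← Finset.insert_eq,
                Finset.insert_erase hs])
          rw [h7]
          exact Ideal.mul_mem_mul ((ih _).2 h5) ((h.mem_jacobson_iff hA _).2 h6)
        | zero => intro _; exact zero_mem _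
        | add u v hu hv hu' hv' =>
          intro _
          exact add_mem (hu' (hmem' hu)) (hv' (hmem' hv))
        | smul c u hu hu' =>
          intro hcu
          have h8 : (⟨c • u, hcu⟩ : A) = algebraMap k A c * ⟨u, hmem' hu⟩ :=
            Subtype.ext (Algebra.smul_def c u)
          rw [h8]
          exact Ideal.mul_mem_left _ _ (hu' _)
      exact this x hx x.2

/-! #### The cyclic modules -/

variable [Fintype ι] (h : IsMonomialFamily F β) (hA : Subalgebra.toSubmodule A = level k F β 0)
  {e : E} {S₀ : Finset ι} (hS₀ : S₀ ⊆ F e)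

theorem mem_levelAt_induction {n : ℕ} {W : Submodule A U}
    (hW : ∀ S, S₀ ⊆ S → S ⊆ F e → n ≤ S.card → β e S ∈ W) {u : U} (hu : u ∈ levelAt k F β e S₀ n) :
    u ∈ W := by
  have : levelAt k F β e S₀ n ≤ W.restrictScalars k := Submodule.span_le.2 (by
    rintro _ ⟨S, h0, h1, h2, rfl⟩
    exact hW S h0 h1 h2)
  exact this hu

include h hA hS₀ in
theorem mem_span_iff (u : U) :
    u ∈ Submodule.span A {β e S₀} ↔ u ∈ levelAt k F β e S₀ S₀.card := by
  constructor
  · rw [Submodule.mem_span_singleton]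
    rintro ⟨c, rfl⟩
    have hc : (c : U) ∈ level k F β 0 := by rw [← hA]; exact c.2
    have := h.mul_mem_levelAt hc (mem_levelAt (k := k) (β := β) (subset_refl S₀) hS₀ le_rfl)
    rwa [zero_add] at this
  · refine mem_levelAt_induction fun S h0 h1 _ => ?_
    have h2 : β e (S \ S₀) ∈ A := by
      have : β e (S \ S₀) ∈ level k F β 0 := mem_level (Finset.sdiff_subset.trans h1) (Nat.zero_le _)
      rw [← hA] at this; exact this
    rw [Submodule.mem_span_singleton]
    refine ⟨⟨_, h2⟩, ?_⟩
    change β e (S \ S₀) * β e S₀ = _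
    rw [h.mul_union (Finset.sdiff_subset.trans h1) hS₀ Finset.sdiff_disjoint,
      Finset.sdiff_union_of_subset h0]

include h hA hS₀ in
theorem mem_radPow_iff (i : ℕ) (x : Submodule.span A {β e S₀}) :
    x ∈ radPow A (Submodule.span A {β e S₀}) i ↔ (x : U) ∈ levelAt k F β e S₀ (S₀.card + i) := by
  constructor
  · intro hx
    refine Submodule.smul_induction_on
      (p := fun x : Submodule.span A {β e S₀} => (x : U) ∈ levelAt k F β e S₀ (S₀.card + i)) hx ?_ ?_
    · intro c hc y _
      have := h.mul_mem_levelAt ((h.mem_jacobson_pow_iff hA i c).1 hc)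
        ((h.mem_span_iff hA hS₀ _).1 y.2)
      rwa [add_comm] at this
    · intro y z hy hz; exact add_mem hy hz
  · intro hx
    have : (x : U) ∈ (radPow A (Submodule.span A {β e S₀}) i).map (Submodule.subtype _) := by
      refine mem_levelAt_induction (fun S h0 h1 h2 => ?_) hx
      have h3 : S \ S₀ ⊆ F e := Finset.sdiff_subset.trans h1
      have h4 : β e (S \ S₀) ∈ level k F β i :=
        mem_level h3 (by rw [Finset.card_sdiff_of_subset h0]; omega)
      have h5 : β e (S \ S₀) ∈ A := by
        have := level_antitone (Nat.zero_le _) h4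
        rw [← hA] at this; exact this
      refine ⟨(⟨_, h5⟩ : A) • ⟨β e S₀, Submodule.mem_span_singleton_self _⟩,
        Submodule.smul_mem_smul ((h.mem_jacobson_pow_iff hA i _).2 h4) Submodule.mem_top, ?_⟩
      change β e (S \ S₀) * β e S₀ = _
      rw [h.mul_union h3 hS₀ Finset.sdiff_disjoint, Finset.sdiff_union_of_subset h0]
    obtain ⟨y, hy, hyx⟩ := this
    rwa [← Subtype.ext hyx]

theorem exists_sum_of_mem_levelAt {n : ℕ} {u : U} (hu : u ∈ levelAt k F β e S₀ n) :
    ∃ g : Finset ι → k, u = ∑ S ∈ (F e).powerset with S₀ ⊆ S ∧ n ≤ S.card, g S • β e S := by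
  have : levelAt k F β e S₀ n = Submodule.span k (β e ''
      (((F e).powerset.filter fun S => S₀ ⊆ S ∧ n ≤ S.card : Finset (Finset ι)) : Set (Finset ι))) := by
    rw [levelAt]
    congr 1
    ext x
    simp only [Set.mem_ofPred_eq, Set.mem_image, Finset.coe_filter, Finset.mem_powerset]
    constructor
    · rintro ⟨S, h0, h1, h2, rfl⟩; exact ⟨S, ⟨h1, h0, h2⟩, rfl⟩
    · rintro ⟨S, ⟨h1, h0, h2⟩, rfl⟩; exact ⟨S, h0, h1, h2, rfl⟩
  rw [this, Submodule.mem_span_image_finset_iff_exists_fun'] at hu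
  obtain ⟨g, hg⟩ := hu
  exact ⟨g, hg.symm⟩

include h in
-- The core of the socle computation. If S has |S| + n ≤ |F e|, its complement has degree at least n
-- and kills u. Once the coefficients of the proper subsets of S are known to vanish, the only
-- contribution left is that of S, to the top monomial; hence an induction on |S|.
theorem mem_levelAt_of_mul_eq_zero {m n : ℕ} {u : U} (hu : u ∈ levelAt k F β e S₀ m)
    (hn : ∀ S, S ⊆ F e → n ≤ S.card → β e S * u = 0) :
    u ∈ levelAt k F β e S₀ ((F e).card + 1 - n) := by
  obtain ⟨g, rfl⟩ := exists_sum_of_mem_levelAt hu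
  set s := (F e).powerset.filter fun S => S₀ ⊆ S ∧ m ≤ S.card
  refine Submodule.sum_mem _ fun S hS => ?_
  have key : ∀ l, ∀ S ∈ s, S.card = l → S.card + n ≤ (F e).card → g S = 0 := by
    intro l
    induction l using Nat.strong_induction_on with
    | h l ih =>
      intro S hS hl hSn
      have h1 : S ⊆ F e := Finset.mem_powerset.1 (Finset.mem_filter.1 hS).1
      have h2 := hn (F e \ S) Finset.sdiff_subset (by rw [Finset.card_sdiff_of_subset h1]; omega)
      rw [Finset.mul_sum, Finset.sum_eq_single S] at h2
      · rw [mul_smul_comm, h.mul_union Finset.sdiff_subset h1 Finset.sdiff_disjoint,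
          Finset.sdiff_union_of_subset h1] at h2
        exact (smul_eq_zero.1 h2).resolve_right (h.ne_zero e)
      · intro T hT hTS
        have h3 : T ⊆ F e := Finset.mem_powerset.1 (Finset.mem_filter.1 hT).1
        rw [mul_smul_comm]
        by_cases hd : Disjoint (F e \ S) T
        · have hTS' : T ⊆ S := fun i hi => by
            by_contra hiS
            exact Finset.disjoint_right.1 hd hi (Finset.mem_sdiff.2 ⟨h3 hi, hiS⟩)
          have hlt := Finset.card_lt_card (Finset.ssubset_iff_subset_ne.2 ⟨hTS', hTS⟩)
          rw [ih T.card (by omega) T hT rfl (by omega), zero_smul]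
        · rw [h.mul_eq_zero Finset.sdiff_subset h3 hd, smul_zero]
      · exact fun h' => absurd hS h'
  by_cases hc : S.card + n ≤ (F e).card
  · rw [key _ S hS rfl hc, zero_smul]; exact zero_mem _
  · have h1 := Finset.mem_filter.1 hS
    exact Submodule.smul_mem _ _ (mem_levelAt h1.2.1 (Finset.mem_powerset.1 h1.1) (by omega))

include h hA hS₀ in
theorem mem_socPow_iff {n : ℕ} (hn : n + S₀.card ≤ (F e).card + 1) (x : Submodule.span A {β e S₀}) :
    x ∈ socPow A (Submodule.span A {β e S₀}) n ↔
      (x : U) ∈ levelAt k F β e S₀ ((F e).card + 1 - n) := by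
  constructor
  · intro hx
    refine h.mem_levelAt_of_mul_eq_zero ((h.mem_span_iff hA hS₀ _).1 x.2) fun S h1 h2 => ?_
    have h3 : β e S ∈ level k F β n := mem_level h1 h2
    have h4 : β e S ∈ A := by
      have := level_antitone (Nat.zero_le _) h3
      rw [← hA] at this; exact this
    exact congrArg Subtype.val (hx ⟨_, h4⟩ ((h.mem_jacobson_pow_iff hA n _).2 h3))
  · intro hx c hc
    have := h.mul_mem_levelAt ((h.mem_jacobson_pow_iff hA n c).1 hc) hx
    rw [levelAt_eq_bot (by omega), Submodule.mem_bot] at this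
    exact Subtype.ext this

include h hA hS₀ in
-- Both sides are the span of the multiples of the monomial S₀ of degree at least |S₀| + i.
theorem radPow_eq_socPow {i : ℕ} (hi : i ≤ (F e).card + 1 - S₀.card) :
    radPow A (Submodule.span A {β e S₀}) i =
      socPow A (Submodule.span A {β e S₀}) ((F e).card + 1 - S₀.card - i) := by
  have hc := Finset.card_le_card hS₀
  ext x
  rw [h.mem_radPow_iff hA hS₀, h.mem_socPow_iff hA hS₀ (by omega)]
  rw [show (F e).card + 1 - ((F e).card + 1 - S₀.card - i) = S₀.card + i by omega]

include h hA hS₀ in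
theorem isLoewyLength :
    IsLoewyLength A (Submodule.span A {β e S₀}) ((F e).card + 1 - S₀.card) := by
  have hc := Finset.card_le_card hS₀
  constructor
  · change radPow A (Submodule.span A {β e S₀}) _ = ⊥
    rw [eq_bot_iff]
    intro x hx
    rw [h.mem_radPow_iff hA hS₀, levelAt_eq_bot (by omega), Submodule.mem_bot] at hx
    exact (Submodule.mem_bot A).2 (Subtype.ext hx)
  · intro n hn
    have hn : radPow A (Submodule.span A {β e S₀}) n = ⊥ := hn
    by_contra hlt
    have h1 : β e (F e) ∈ levelAt k F β e S₀ (S₀.card + n) :=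
      mem_levelAt hS₀ (subset_refl _) (by omega)
    have h2 : β e (F e) ∈ Submodule.span A {β e S₀} :=
      (h.mem_span_iff hA hS₀ _).2 (mem_levelAt hS₀ (subset_refl _) hc)
    have h3 := (h.mem_radPow_iff hA hS₀ n ⟨_, h2⟩).2 h1
    rw [hn, Submodule.mem_bot] at h3
    exact h.ne_zero e (congrArg Subtype.val h3)

include h hA hS₀ in
theorem isRigid : IsRigid A (Submodule.span A {β e S₀}) :=
  ⟨_, h.isLoewyLength hA hS₀, fun _ hi => h.radPow_eq_socPow hA hS₀ hi⟩

include h hA hS₀ in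
theorem map_socPow_one : (socPow A (Submodule.span A {β e S₀}) 1).map (Submodule.subtype _) =
    Submodule.span A {β e (F e)} := by
  have hc := Finset.card_le_card hS₀
  ext u
  rw [h.mem_span_iff hA (subset_refl _)]
  have hle : levelAt k F β e (F e) (F e).card = levelAt k F β e S₀ (F e).card := by
    refine le_antisymm (Submodule.span_mono ?_) (Submodule.span_mono ?_)
    · rintro _ ⟨S, h0, h1, h2, rfl⟩; exact ⟨S, hS₀.trans h0, h1, h2, rfl⟩
    · rintro _ ⟨S, h0, h1, h2, rfl⟩
      exact ⟨S, (Finset.eq_of_subset_of_card_le h1 h2).ge, h1, h2, rfl⟩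
  rw [hle]
  constructor
  · rintro ⟨x, hx, rfl⟩
    have := (h.mem_socPow_iff hA hS₀ (by omega) x).1 hx
    rwa [Nat.add_sub_cancel] at this
  · intro hu
    have h1 : u ∈ Submodule.span A {β e S₀} := by
      refine mem_levelAt_induction (fun S h0 h1 h2 => ?_) hu
      exact (h.mem_span_iff hA hS₀ _).2 (mem_levelAt h0 h1 (hc.trans h2))
    exact ⟨⟨u, h1⟩, (h.mem_socPow_iff hA hS₀ (by omega) ⟨u, h1⟩).2 (by rwa [Nat.add_sub_cancel]), rfl⟩

include h hA in
-- The top monomial has no multiples but its scalar multiples, so the module is one-dimensional over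
-- k.
theorem isSimpleModule_span : IsSimpleModule A (Submodule.span A {β e (F e)}) := by
  have hk : ∀ u ∈ Submodule.span A {β e (F e)}, ∃ c : k, u = c • β e (F e) := by
    intro u hu
    rw [h.mem_span_iff hA (subset_refl _)] at hu
    obtain ⟨g, rfl⟩ := exists_sum_of_mem_levelAt hu
    refine ⟨∑ S ∈ (F e).powerset with F e ⊆ S ∧ (F e).card ≤ S.card, g S, ?_⟩
    rw [Finset.sum_smul]
    refine Finset.sum_congr rfl fun S hS => ?_
    have h1 := Finset.mem_filter.1 hS
    rw [(Finset.mem_powerset.1 h1.1).antisymm h1.2.1]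
  rw [isSimpleModule_iff_toSpanSingleton_surjective]
  have h0 : (⟨β e (F e), Submodule.mem_span_singleton_self _⟩ : Submodule.span A {β e (F e)}) ≠ 0 :=
    fun h0 => h.ne_zero e (congrArg Subtype.val h0)
  refine ⟨nontrivial_of_ne _ _ h0, fun x hx y => ?_⟩
  obtain ⟨c, hc⟩ := hk _ x.2
  obtain ⟨d, hd⟩ := hk _ y.2
  have hc0 : c ≠ 0 := by
    rintro rfl
    exact hx (Subtype.ext (by rw [hc, zero_smul]; rfl))
  refine ⟨algebraMap k A (d * c⁻¹), Subtype.ext ?_⟩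
  change (algebraMap k U (d * c⁻¹)) * (x : U) = y
  rw [hc, hd, ← Algebra.smul_def, smul_smul, mul_assoc, inv_mul_cancel₀ hc0, mul_one]

include h hA hS₀ in
theorem nonempty_socPow_one_equiv : Nonempty (socPow A (Submodule.span A {β e S₀}) 1 ≃ₗ[A]
    Submodule.span A {β e (F e)}) :=
  ⟨(Submodule.equivSubtypeMap _ _).trans (LinearEquiv.ofEq _ _ (h.map_socPow_one hA hS₀))⟩

include h hA hS₀ in
theorem isSimpleModule_socPow_one :
    IsSimpleModule A (socPow A (Submodule.span A {β e S₀}) 1) := by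
  obtain ⟨f⟩ := h.nonempty_socPow_one_equiv hA hS₀
  have := h.isSimpleModule_span hA (e := e)
  exact IsSimpleModule.congr f

end IsMonomialFamily

end Abstract

end

end SL2Hyper

namespace SL2Hyper

noncomputable section

/-! ### The basis of `𝒜_r` -/

section Final

variable (p : ℕ) [Fact p.Prime]

/-- Pairs indexed by `0 ≤ a < p` and a square root of the parameter in `𝔽_p`, together with
the choice of `ε`. -/
def indexedPair (x : Fin p × Fin p) : (ℕ × ℚ) × Fin 2 :=
  if p = 2 then
    if (x.1 : ℕ) = 0 then ((0, 1 / 2), if (x.2 : ℕ) = 0 then 0 else 1)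
    else ((1, ((x.2 : ℕ) : ℚ)), 0)
  else if 2 * (x.2 : ℕ) < p then ((x.1, ((x.2 : ℕ) : ℚ)), 0)
  else ((x.1, ((p - x.2 : ℕ) : ℚ)), 1)

theorem indexedPair_mem (x : Fin p × Fin p) : (indexedPair p x).1 ∈ pairSet p := by
  obtain ⟨⟨x, hx⟩, ⟨y, hy⟩⟩ := x
  rw [indexedPair, pairSet]
  by_cases hp : p = 2
  · subst hp
    rw [if_pos rfl, if_pos rfl]
    dsimp only
    split_ifs with h1 h2
    · simp
    · simp
    · have : y = 0 ∨ y = 1 := by omega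
      rcases this with rfl | rfl <;> simp
  · rw [if_neg hp, if_neg hp]
    have := odd_of_ne_two hp
    dsimp only
    split_ifs with h2
    · exact ⟨hx, y, by omega, rfl⟩
    · exact ⟨hx, p - y, by omega, rfl⟩

theorem indexedPair_isFree (x : Fin p × Fin p) (h : (indexedPair p x).2 ≠ 0) :
    IsFree p (indexedPair p x).1.1 (indexedPair p x).1.2 := by
  obtain ⟨⟨x, hx⟩, ⟨y, hy⟩⟩ := x
  rw [indexedPair] at h ⊢
  rw [IsFree]
  by_cases hp : p = 2
  · subst hp
    rw [if_pos rfl] at h ⊢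
    rw [if_pos rfl]
    dsimp only at h ⊢
    split_ifs at h ⊢ with h1 <;> simp at h ⊢
  · rw [if_neg hp] at h ⊢
    rw [if_neg hp]
    dsimp only at h ⊢
    split_ifs at h ⊢ with h1
    · simp at h
    · change ((p - y : ℕ) : ℚ) ≠ 0
      exact_mod_cast (by omega : p - y ≠ 0)

/-- The count behind the basis: for odd p and each a, the value j = 0 is used once and each j ≠ 0
twice, as j and p - j. This makes p choices for each a, and p² in all for every index; for p = 2 the
four choices are listed directly. -/
theorem indexedPair_injective : Function.Injective (indexedPair p) := by
  rintro ⟨⟨x, hx⟩, ⟨y, hy⟩⟩ ⟨⟨x', hx'⟩, ⟨y', hy'⟩⟩ h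
  rw [indexedPair, indexedPair] at h
  have key : x = x' ∧ y = y' := by
    by_cases hp : p = 2
    · subst hp
      rw [if_pos rfl, if_pos rfl] at h
      dsimp only at h
      split_ifs at h <;> simp at h <;> omega
    · rw [if_neg hp, if_neg hp] at h
      dsimp only at h
      split_ifs at h <;> simp only [Prod.mk.injEq, Nat.cast_inj] at h <;> simp at h <;> omega
  simp [key.1, key.2]

variable (r : ℕ)

/-- The index set of the blocks of `𝒜_r`. -/
abbrev PairTuple : Type := {e : Fin r → ℕ × ℚ // ∀ i, e i ∈ pairSet p}

variable {p r}

open Classical in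
/-- The set of free indices. -/
def freeSet (e : PairTuple p r) : Finset (Fin r) :=
  Finset.univ.filter fun i => IsFree p (e.1 i).1 (e.1 i).2

theorem mem_freeSet {e : PairTuple p r} {i : Fin r} :
    i ∈ freeSet e ↔ IsFree p (e.1 i).1 (e.1 i).2 := by simp [freeSet]

/-- The element of `{0,1}^r` with support `S`. -/
def indicator (S : Finset (Fin r)) : Fin r → Fin 2 := fun i => if i ∈ S then 1 else 0

/-- The support of an element of `{0,1}^r`. -/
def supp (ε : Fin r → Fin 2) : Finset (Fin r) := Finset.univ.filter fun i => ε i ≠ 0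

theorem mem_supp {ε : Fin r → Fin 2} {i : Fin r} : i ∈ supp ε ↔ ε i ≠ 0 := by simp [supp]

theorem indicator_supp (ε : Fin r → Fin 2) : indicator (supp ε) = ε := by
  funext i
  rw [indicator, supp]
  simp only [Finset.mem_filter, Finset.mem_univ, true_and]
  split_ifs with h <;> omega

theorem card_supp (ε : Fin r → Fin 2) : (supp ε).card = hammingNorm ε := rfl

variable (k : Type*) [Field k] [CharP k p]

/-- The basis elements of `𝒜_r`. -/
def blockElement (e : PairTuple p r) (S : Finset (Fin r)) : Hyp k :=
  Bel k p r (indicator S) (fun i => (e.1 i).1) fun i => (e.1 i).2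

theorem isMonomialFamily_blockElement :
    IsMonomialFamily (freeSet (p := p) (r := r)) (blockElement k) where
  mul_of_ne := fun {e e'} S S' h => by
    obtain ⟨i, hi⟩ := Function.ne_iff.1 fun h' => h (Subtype.ext h')
    exact Bel_mul_of_ne _ _ e.2 e'.2 i hi
  mul_union := fun {e S S'} _ _ hd => by
    refine Bel_mul _ _ _ e.2 fun i => ?_
    simp only [indicator, Finset.mem_union]
    by_cases h : i ∈ S
    · simp [h, Finset.disjoint_left.1 hd h]
    · simp [h]
  mul_eq_zero := fun {e S S'} hS _ hd => by
    obtain ⟨i, h1, h2⟩ := Finset.not_disjoint_iff.1 hd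
    exact Bel_mul_eq_zero _ _ e.2 i (mem_freeSet.1 (hS h1)) (if_pos h1) (if_pos h2)
  ne_zero := fun e => Bel_ne_zero _ e.2

/-- The p^{2r} independent elements indexed by (Fin p × Fin p)^r lie in 𝒜_r, whose dimension is at
most p^{2r}; so they span it. -/
theorem toSubmodule_Ar_eq_level :
    Subalgebra.toSubmodule (Ar k p r) =
      IsMonomialFamily.level k (freeSet (p := p) (r := r)) (blockElement k) 0 := by
  have hmem : ∀ (e : PairTuple p r) S, blockElement k e S ∈ Ar k p r := fun e S => Bel_mem_Ar _ e.2
  have hle : IsMonomialFamily.level k (freeSet (p := p) (r := r)) (blockElement k) 0 ≤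
      Subalgebra.toSubmodule (Ar k p r) := Submodule.span_le.2 (by
    rintro _ ⟨e, S, -, -, rfl⟩; exact hmem e S)
  obtain ⟨hfin, hrank⟩ := finite_Ar_and_finrank_le (k := k) (p := p) r
  have hfin' : Module.Finite k (Subalgebra.toSubmodule (Ar k p r)) := hfin
  let f : (Fin r → Fin p × Fin p) →
      {x : PairTuple p r × Finset (Fin r) // x.2 ⊆ freeSet x.1} := fun t =>
    ⟨(⟨fun i => (indexedPair p (t i)).1, fun i => indexedPair_mem p _⟩,
      supp fun i => (indexedPair p (t i)).2), fun i hi =>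
        mem_freeSet.2 (indexedPair_isFree p _ (mem_supp.1 hi))⟩
  have hf : Function.Injective f := fun t t' h => by
    have h1 := congrArg (fun x => x.1.1.1) h
    have h2 := congrArg (fun x => indicator x.1.2) h
    simp only [f, indicator_supp] at h1 h2
    exact funext fun i => indexedPair_injective p (Prod.ext (congrFun h1 i) (congrFun h2 i))
  have hli := ((isMonomialFamily_blockElement (p := p) (r := r) k).linearIndependent (k := k)).comp f hf
  have hspan : Submodule.span k (Set.range ((fun x : {x : PairTuple p r × Finset (Fin r) //
      x.2 ⊆ freeSet x.1} => blockElement k x.1.1 x.1.2) ∘ f)) ≤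
      IsMonomialFamily.level k (freeSet (p := p) (r := r)) (blockElement k) 0 := by
    refine Submodule.span_le.2 ?_
    rintro _ ⟨t, rfl⟩
    exact IsMonomialFamily.mem_level (f t).2 (Nat.zero_le _)
  have hcard := finrank_span_eq_card hli
  have h1 := Submodule.eq_of_le_of_finrank_le (hspan.trans hle) (by
    rw [hcard]
    refine hrank.trans ?_
    simp [mul_pow])
  exact le_antisymm (h1 ▸ hspan) hle

theorem blockElement_freeSet (e : PairTuple p r) :
    blockElement k e (freeSet e) = Bel k p r (tau p (fun i => (e.1 i).1) fun i => (e.1 i).2)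
      (fun i => (e.1 i).1) fun i => (e.1 i).2 := by
  rw [blockElement]
  congr 1
  funext i
  by_cases h : IsFree p (e.1 i).1 (e.1 i).2 <;> simp [indicator, mem_freeSet, tau, h]

theorem card_freeSet (e : PairTuple p r) :
    (freeSet e).card = wInt p (fun i => (e.1 i).1) fun i => (e.1 i).2 := by
  classical
  rw [freeSet, wInt]
  split_ifs with hp
  · subst hp
    have h1 : hammingNorm (fun i => (e.1 i).1) =
        (Finset.univ.filter fun i => ¬ IsFree 2 (e.1 i).1 (e.1 i).2).card := by
      rw [hammingNorm]
      congr 1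
      ext i
      have : e.1 i ∈ pairSet 2 := e.2 i
      simp only [pairSet, if_true, Set.mem_insert_iff, Set.mem_singleton_iff] at this
      simp only [Finset.mem_filter, Finset.mem_univ, true_and, IsFree, if_true, not_not]
      rcases this with h | h | h <;> simp [h]
    have h2 := Finset.card_filter_add_card_filter_not (s := (Finset.univ : Finset (Fin r)))
      (fun i => IsFree 2 (e.1 i).1 (e.1 i).2)
    rw [Finset.card_univ, Fintype.card_fin] at h2
    omega
  · rw [hammingNorm]
    congr 1
    ext i
    simp [IsFree, hp]

end Final

end

end SL2Hyper

theorem theorem3p12 (k : Type*) [Field k] [IsAlgClosed k] (p : ℕ) [Fact p.Prime] [CharP k p]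
    (r : ℕ) (hr : 0 < r) (a : Fin r → ℕ) (j : Fin r → ℚ)
    (haj : ∀ s, (a s, j s) ∈ SL2Hyper.pairSet p)
    (ε : Fin r → Fin 2) (hε : ε ∈ SL2Hyper.admissible p a j) :
    SL2Hyper.IsRigid (SL2Hyper.Ar k p r) (SL2Hyper.AB k p ε a j) ∧
    (∀ i : ℕ, i + hammingNorm ε ≤ SL2Hyper.wInt p a j →
      SL2Hyper.radPow (SL2Hyper.Ar k p r) (SL2Hyper.AB k p ε a j) i =
        SL2Hyper.socPow (SL2Hyper.Ar k p r) (SL2Hyper.AB k p ε a j)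
          (SL2Hyper.wInt p a j + 1 - hammingNorm ε - i)) ∧
    IsSimpleModule (SL2Hyper.Ar k p r)
      (SL2Hyper.socPow (SL2Hyper.Ar k p r) (SL2Hyper.AB k p ε a j) 1) ∧
    Nonempty (SL2Hyper.socPow (SL2Hyper.Ar k p r) (SL2Hyper.AB k p ε a j) 1
      ≃ₗ[SL2Hyper.Ar k p r] SL2Hyper.simpleS k p a j) := by
  open SL2Hyper in
  have h := isMonomialFamily_blockElement (p := p) (r := r) k
  have hA := toSubmodule_Ar_eq_level (p := p) (r := r) k
  let e : PairTuple p r := ⟨fun i => (a i, j i), haj⟩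
  have hS : supp ε ⊆ freeSet e := fun i hi => by
    rw [mem_freeSet]
    by_contra hn
    exact mem_supp.1 hi (hε i hn)
  have hM : Submodule.span (Ar k p r) {blockElement k e (supp ε)} = AB k p ε a j := by
    rw [AB, blockElement, indicator_supp]
  have hT : Submodule.span (Ar k p r) {blockElement k e (freeSet e)} = simpleS k p a j := by
    rw [simpleS, AB, blockElement_freeSet]
  have hw : (freeSet e).card = wInt p a j := card_freeSet e
  rw [← hM, ← hT, ← hw, ← card_supp]
  exact ⟨h.isRigid hA hS, fun i hi => h.radPow_eq_socPow hA hS (by omega),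
    h.isSimpleModule_socPow_one hA hS, h.nonempty_socPow_one_equiv hA hS⟩
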